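/- **Theorem G.3 (rates for discrete noisy observations with adaptive bandwidth).** *Model.* Let $X_1,X_2,\dots$ be copies of a mean-zero random element $X$ of $\mathcal L^2[0,1]^2$ with $\mathbb E\|X\|^4<\infty$, whose covariance operator $C$ has kernel $$c(t,s,t',s')=a_1(t,t')\,a_2(s,s')+b(t,s,t',s'),\qquad b(t,s,t',s')=\varsigma(|t-t'|,|s-s'|),$$ where the kernel $a=a_1a_2$ of $A=A_1\tilde\otimes A_2$ is Lipschitz on $[0,1]^4$ (Euclidean distance) with constant $L>0$, $\varsigma$ is continuous on $[0,1]^2$, and $b$ is banded by $\delta^\star\in[0,1)$. Here banded by $\delta$ means that $b=0$ a.e. on $\{\max(|t-t'|,|s-s'|)\ge\delta\}$. *Proxies.* For $\delta\in[0,1)$ put $\mathrm{Tr}^\delta(C)=\int_0^{1-\delta}\!\int_0^{1-\delta}c(t,s,t+\delta,s+\delta)\,dt\,ds$, let $\mathrm{Tr}_1^\delta(C)$ and $\mathrm{Tr}_2^\delta(C)$ have kernels $\int_0^{1-\delta}c(t,s,t',s+\delta)\,ds$ and $\int_0^{1-\delta}c(t,s,t+\delta,s')\,dt$, and set $$A(\delta)=\mathrm{Tr}_1^\delta(C)\,\tilde\otimes\,\mathrm{Tr}_2^\delta(C)/\mathrm{Tr}^\delta(C),\qquad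 C(\delta)=A(\delta)+\mathrm{Ta}(C-A(\delta)).$$ $\mathrm{Ta}$ is Toeplitz averaging, the orthogonal projection onto kernels that depend only on $(|t-t'|,|s-s'|)$: each value is replaced by the average over all pairs of points with the same absolute lags. *Candidates.* Let $\Delta\subset[0,1)$ be finite with $\mathrm{Tr}^\delta(C)\ne0$ for all $\delta\in\Delta$, with some $\delta\in\Delta$ satisfying $\delta>\delta^\star$, and such that $\Xi(\delta):=\|C(\delta)-C\|_2^2>0$ for every $\delta\in\Delta$ by which $b$ is not banded. *Data.* For every $K$ split $[0,1]$ into $K$ intervals $I_1,\dots,I_K$ of length $1/K$. One observes $\widetilde{\mathbf X}^K_n[i,j]=\mathbf X^K_n[i,j]+\mathbf E^K_n[i,j]$, $1\le i,j\le K$, where one of the following holds. * (S1) The $X_n$ have continuous paths, $\sup_{t,s}\mathbb E X(t,s)^4<\infty$, and $\mathbf X_n^K[i,j]=X_n(t_i^K,s_j^K)$ with $t^K_i\in\overline{I_i}$, $s^K_j\in\overline{I_j}$. * (S2) $\mathbf X_n^K[i,j]=K^2\int_{I_i\times I_j}X_n$. For each $K$ the pairs $(X_n,\mathbf E_n^K)_{n}$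 are i.i.d. For a constant $\sigma$ not depending on $K$ and all indices, the errors satisfy: * $\mathbb E\,\mathbf E^K_n[i,j]=0$ and $\mathbb E\,\mathbf E^K_n[i,j]^2\le\sigma^2$; * $\mathbb E(\mathbf E^K_n[i,j]\mathbf E^K_n[k,l])=0$ and $\mathbb E(\mathbf E^K_n[i,j]^2\mathbf E^K_n[k,l]^2)\le\sigma^4$ for $(i,j)\ne(k,l)$; * $\mathbb E(\mathbf E^K_n[i,j]\mathbf X^K_n[k,l])=0$; * $\mathbb E(\mathbf E^K_n[i,j]\mathbf E^K_n[k,l]\mathbf X^K_n[i',j']\mathbf X^K_n[k',l'])=\mathbb E(\mathbf E^K_n[i,j]\mathbf E^K_n[k,l])\,\mathbb E(\mathbf X^K_n[i',j']\mathbf X^K_n[k',l'])$, the expectations being finite. *Estimators.* Let $d=\lceil\delta K\rceil+1$. For a tensor $\mathbf M\in\mathbb R^{K\times K\times K\times K}$ put $$\mathrm{Tr}_1^d(\mathbf M)[i,k]=\sum_j\mathbf M[i,j,k,j+d],\quad \mathrm{Tr}_2^d(\mathbf M)[j,l]=\sum_i\mathbf M[i,j,i+d,l],\quad \mathrm{Tr}^d(\mathbf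 M)=\sum_{i,j}\mathbf M[i,j,i+d,j+d].$$ Let $\widehat{\mathbf C}_N=\frac1N\sum_{n\le N}\widetilde{\mathbf X}_n^K\otimes\widetilde{\mathbf X}_n^K$ and $$\widehat{\mathbf A}(\delta)=\mathrm{Tr}_1^d(\widehat{\mathbf C}_N)\,\tilde\otimes\,\mathrm{Tr}_2^d(\widehat{\mathbf C}_N)/\mathrm{Tr}^d(\widehat{\mathbf C}_N),\qquad \widehat{\mathbf C}(\delta)=\widehat{\mathbf A}(\delta)+\mathrm{Ta}(\widehat{\mathbf C}_N-\widehat{\mathbf A}(\delta)),$$ where discrete $\mathrm{Ta}$ replaces each entry $[i,j,k,l]$ by the average of all entries with the same $(|i-k|,|j-l|)$. Let $\widehat{\mathbf C}_{-n}(\delta)$ be the same estimator computed without the $n$-th observation. With the semi-inner product that removes the diagonal, $$\langle\mathbf F,\mathbf G\rangle_\star=K^{-4}\sum_{(i,j)\ne(k,l)}\mathbf F[i,j,k,l]\,\mathbf G[i,j,k,l],\qquad \|\mathbf F\|_\star^2=\langle\mathbf F,\mathbf F\rangle_\star,$$ let $\widehat\delta$ be any minimizer over $\delta\in\Delta$ of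 $$\widehat\Xi^K(\delta)=\|\widehat{\mathbf C}(\delta)\|_\star^2-\frac2N\sum_{n=1}^N\big\langle\widehat{\mathbf C}_{-n}(\delta),\widetilde{\mathbf X}^K_n\otimes\widetilde{\mathbf X}^K_n\big\rangle_\star .$$ Let $\widehat A^K(\widehat\delta)=\widehat A_1^K(\widehat\delta)\,\tilde\otimes\,\widehat A_2^K(\widehat\delta)$ be the operator whose kernel is the piecewise constant continuation of $\widehat{\mathbf A}(\widehat\delta)$. *Conclusion.* There is $K_0\in\mathbb N$ such that $$\big\|\widehat A_1^K(\widehat\delta)\,\tilde\otimes\,\widehat A_2^K(\widehat\delta)-A_1\tilde\otimes A_2\big\|_2^2\le\mathcal O_P(N^{-1})+2K^{-2}L^2$$ with the $\mathcal O_P(N^{-1})$ term uniform in $K\ge K_0$. That is, for every $\varepsilon>0$ there are $M$ and $N_0$ such that for all $N\ge N_0$ and all $K\ge K_0$, $$\mathbb P\big(\|\widehat A^K(\widehat\delta)-A\|_2^2>M/N+2K^{-2}L^2\big)\le\varepsilon .$$ -/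

import Mathlib

open MeasureTheory ProbabilityTheory Set

namespace SPT

/-! ### Kernels on the unit square

An integral operator on `L²([0,1]²)` is handled through its kernel `k(t,s,t',s')`. -/

/-- Four-variable kernels `k t s t' s'`; only their values on `[0,1]⁴` matter. -/
abbrev Kernel4 := ℝ → ℝ → ℝ → ℝ → ℝ

/-- Lebesgue measure on the unit square. -/
noncomputable def sqMeasure : Measure (ℝ × ℝ) :=
  volume.restrict (Icc (0 : ℝ) 1 ×ˢ Icc (0 : ℝ) 1)

/-- The real Hilbert space `L²([0,1]²)`. -/
noncomputable abbrev L2Square := Lp ℝ 2 sqMeasure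

/-- `L²([0,1]²)` carries its Borel sigma-algebra. -/
noncomputable instance : MeasurableSpace L2Square := borel L2Square

instance : BorelSpace L2Square := ⟨rfl⟩

/-- Squared Hilbert-Schmidt norm of the integral operator on `L²([0,1]²)` with kernel `k`,
that is, the squared `L²([0,1]⁴)` norm of `k`. -/
noncomputable def hsNormSq (k : Kernel4) : ℝ :=
  ∫ p, ∫ q, (k p.1 p.2 q.1 q.2) ^ 2 ∂sqMeasure ∂sqMeasure

/-- The kernel of the separable operator with marginal kernels `a₁` and `a₂`. -/
def sepKernel (a₁ a₂ : ℝ → ℝ → ℝ) : Kernel4 := fun t s t' s' => a₁ t t' * a₂ s s'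

/-- The stationary kernel with symbol `ς`. -/
def statKernel (ς : ℝ → ℝ → ℝ) : Kernel4 := fun t s t' s' => ς |t - t'| |s - s'|

/-- `b` is banded by `δ`: it vanishes almost everywhere on the part of `[0,1]⁴` where
`max (|t - t'|, |s - s'|) ≥ δ`. -/
def IsBandedBy (δ : ℝ) (b : Kernel4) : Prop :=
  ∀ᵐ z ∂(sqMeasure.prod sqMeasure),
    δ ≤ max |z.1.1 - z.2.1| |z.1.2 - z.2.2| → b z.1.1 z.1.2 z.2.1 z.2.2 = 0

/-- `k` is Lipschitz on `[0,1]⁴` with constant `L`, for the Euclidean distance. -/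
def IsLipschitzOnCube (L : ℝ) (k : Kernel4) : Prop :=
  ∀ t ∈ Icc (0 : ℝ) 1, ∀ s ∈ Icc (0 : ℝ) 1, ∀ t' ∈ Icc (0 : ℝ) 1, ∀ s' ∈ Icc (0 : ℝ) 1,
  ∀ u ∈ Icc (0 : ℝ) 1, ∀ v ∈ Icc (0 : ℝ) 1, ∀ u' ∈ Icc (0 : ℝ) 1, ∀ v' ∈ Icc (0 : ℝ) 1,
    |k t s t' s' - k u v u' v'|
      ≤ L * Real.sqrt ((t - u) ^ 2 + (s - v) ^ 2 + (t' - u') ^ 2 + (s' - v') ^ 2)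

/-! ### Shifted (partial) traces and the bandwidth-`δ` proxy of a covariance kernel -/

/-- The `δ`-shifted trace. -/
noncomputable def shiftTrace (δ : ℝ) (c : Kernel4) : ℝ :=
  ∫ t in (0 : ℝ)..(1 - δ), ∫ s in (0 : ℝ)..(1 - δ), c t s (t + δ) (s + δ)

/-- Kernel of the first `δ`-shifted partial trace. -/
noncomputable def shiftTrace₁ (δ : ℝ) (c : Kernel4) (t t' : ℝ) : ℝ :=
  ∫ s in (0 : ℝ)..(1 - δ), c t s t' (s + δ)

/-- Kernel of the second `δ`-shifted partial trace. -/
noncomputable def shiftTrace₂ (δ : ℝ) (c : Kernel4) (s s' : ℝ) : ℝ :=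
  ∫ t in (0 : ℝ)..(1 - δ), c t s (t + δ) s'

/-- The separable proxy `A(δ)` of `c`: the tensor product of the two `δ`-shifted partial traces,
divided by the `δ`-shifted trace. -/
noncomputable def sepProxy (δ : ℝ) (c : Kernel4) : Kernel4 := fun t s t' s' =>
  shiftTrace₁ δ c t t' * (shiftTrace₂ δ c s s' / shiftTrace δ c)

/-- Symbol of the Toeplitz average of `k`: the mean of `k` over all pairs of points of the unit
square whose coordinates differ by `h` and `l` in absolute value (four choices of signs). -/
noncomputable def toeplitzSymbol (k : Kernel4) (h l : ℝ) : ℝ :=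
  (∫ t in (0 : ℝ)..(1 - h), ∫ s in (0 : ℝ)..(1 - l),
      (k t s (t + h) (s + l) + k (t + h) s t (s + l)
        + k t (s + l) (t + h) s + k (t + h) (s + l) t s)) / (4 * (1 - h) * (1 - l))

/-- Toeplitz averaging, the orthogonal projection onto the stationary kernels. -/
noncomputable def toeplitzAvg (k : Kernel4) : Kernel4 := statKernel (toeplitzSymbol k)

/-- The separable-plus-stationary proxy `C(δ) = A(δ) + B(δ)`, where `B(δ)` is the Toeplitz average
of `C - A(δ)`. -/
noncomputable def fullProxy (δ : ℝ) (c : Kernel4) : Kernel4 := fun t s t' s' =>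
  sepProxy δ c t s t' s'
    + toeplitzAvg (fun t s t' s' => c t s t' s' - sepProxy δ c t s t' s') t s t' s'

/-- The theoretical bandwidth objective `Ξ(δ) = ‖C(δ) - C‖²`. -/
noncomputable def Xi (δ : ℝ) (c : Kernel4) : ℝ :=
  hsNormSq (fun t s t' s' => fullProxy δ c t s t' s' - c t s t' s')

/-! ### Discrete estimators on a `K × K` grid -/

/-- `K × K × K × K` tensors `M[i,j,k,l]`. -/
abbrev Tensor (K : ℕ) := Fin K → Fin K → Fin K → Fin K → ℝ

/-- The outer product `x ⊗ x`. -/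
def outerSq {K : ℕ} (x : Fin K → Fin K → ℝ) : Tensor K := fun i j k l => x i j * x k l

/-- Uncentred empirical covariance of the observations with index in `S`. -/
noncomputable def empCov {K : ℕ} (x : ℕ → Fin K → Fin K → ℝ) (S : Finset ℕ) : Tensor K :=
  fun i j k l => (∑ n ∈ S, outerSq (x n) i j k l) / (S.card : ℝ)

/-- Discrete shifted trace, the sum of the entries `M[i,j,i+d,j+d]`. -/
def dTrace {K : ℕ} (d : ℕ) (M : Tensor K) : ℝ :=
  ∑ i : Fin K, ∑ k : Fin K, ∑ j : Fin K, ∑ l : Fin K,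
    if (k : ℕ) = i + d ∧ (l : ℕ) = j + d then M i j k l else 0

/-- First discrete shifted partial trace: entry `(i,k)` is the sum over `j` of `M[i,j,k,j+d]`. -/
def dTrace₁ {K : ℕ} (d : ℕ) (M : Tensor K) (i k : Fin K) : ℝ :=
  ∑ j : Fin K, ∑ l : Fin K, if (l : ℕ) = j + d then M i j k l else 0

/-- Second discrete shifted partial trace: entry `(j,l)` is the sum over `i` of `M[i,j,i+d,l]`. -/
def dTrace₂ {K : ℕ} (d : ℕ) (M : Tensor K) (j l : Fin K) : ℝ :=
  ∑ i : Fin K, ∑ k : Fin K, if (k : ℕ) = i + d then M i j k l else 0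

/-- The discrete bandwidth `d_K = ⌈δK⌉ + 1` that corresponds to `δ`. -/
noncomputable def discreteBandwidth (δ : ℝ) (K : ℕ) : ℕ := ⌈δ * K⌉₊ + 1

/-- The separable estimator computed from the tensor `M` with discrete bandwidth `d`. -/
noncomputable def sepEst {K : ℕ} (d : ℕ) (M : Tensor K) : Tensor K := fun i j k l =>
  dTrace₁ d M i k * (dTrace₂ d M j l / dTrace d M)

/-- The entries with the same absolute lags as the entry `(i,j,k,l)`. -/
def lagClass {K : ℕ} (i j k l : Fin K) : Finset (Fin K × Fin K × Fin K × Fin K) :=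
  Finset.univ.filter fun q =>
    ((q.1 : ℤ) - (q.2.2.1 : ℤ)).natAbs = ((i : ℤ) - (k : ℤ)).natAbs ∧
      ((q.2.1 : ℤ) - (q.2.2.2 : ℤ)).natAbs = ((j : ℤ) - (l : ℤ)).natAbs

/-- Discrete Toeplitz averaging, the orthogonal projection onto the stationary tensors:
every entry is replaced by the mean of the entries with the same absolute lags. -/
noncomputable def dToeplitzAvg {K : ℕ} (M : Tensor K) : Tensor K := fun i j k l =>
  (∑ q ∈ lagClass i j k l, M q.1 q.2.1 q.2.2.1 q.2.2.2) / ((lagClass i j k l).card : ℝ)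

/-- The separable-plus-stationary estimator computed from `M` with discrete bandwidth `d`. -/
noncomputable def fullEst {K : ℕ} (d : ℕ) (M : Tensor K) : Tensor K := fun i j k l =>
  sepEst d M i j k l
    + dToeplitzAvg (fun i j k l => M i j k l - sepEst d M i j k l) i j k l

/-- The semi-inner product without the diagonal: the Hilbert-Schmidt inner product of the
piecewise constant continuations, minus the contribution of the entries with `(i,j) = (k,l)`. -/
noncomputable def starInner {K : ℕ} (F G : Tensor K) : ℝ :=
  (∑ i : Fin K, ∑ j : Fin K, ∑ k : Fin K, ∑ l : Fin K,
    if (i, j) ≠ (k, l) then F i j k l * G i j k l else 0) / (K : ℝ) ^ 4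

/-- The empirical leave-one-out objective at `δ`, from the observations `x 0, …, x (N-1)`. -/
noncomputable def XiHat {K : ℕ} (N : ℕ) (x : ℕ → Fin K → Fin K → ℝ) (δ : ℝ) : ℝ :=
  starInner (fullEst (discreteBandwidth δ K) (empCov x (Finset.range N)))
      (fullEst (discreteBandwidth δ K) (empCov x (Finset.range N)))
    - 2 / (N : ℝ) * ∑ n ∈ Finset.range N,
        starInner (fullEst (discreteBandwidth δ K) (empCov x ((Finset.range N).erase n)))
          (outerSq (x n))

/-- The `i`-th of the `K` equal cells of the unit interval. -/
def cell (K : ℕ) (i : Fin K) : Set ℝ := Ico ((i : ℝ) / K) (((i : ℝ) + 1) / K)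

/-- Piecewise constant continuation of a tensor to a kernel. -/
noncomputable def continuation {K : ℕ} (M : Tensor K) : Kernel4 := fun t s t' s' =>
  ∑ i : Fin K, ∑ j : Fin K, ∑ k : Fin K, ∑ l : Fin K,
    M i j k l * ((cell K i).indicator 1 t * (cell K j).indicator 1 s
      * (cell K k).indicator 1 t' * (cell K l).indicator 1 s')

/-! ### The random surfaces, the sampling schemes and the measurement errors -/

section Random

variable {Ω : Type*} [MeasurableSpace Ω]

/-- The random surface `X` has mean zero and its covariance operator has kernel `c`. -/
def IsCenteredWithCov (μ : Measure Ω) (X : Ω → L2Square) (c : Kernel4) : Prop :=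
  ∫ ω, X ω ∂μ = 0 ∧
  ∀ f g : L2Square,
    cov[fun ω => inner ℝ (X ω) f, fun ω => inner ℝ (X ω) g; μ]
      = ∫ p, ∫ q, c p.1 p.2 q.1 q.2 * f p * g q ∂sqMeasure ∂sqMeasure

/-- Pointwise sampling. The surfaces have continuous versions `Y n`, which are evaluated at
grid points lying in the respective cells (at either end of a cell is allowed); the pointwise
fourth moments are finite, uniformly over the unit square. -/
def PointwiseScheme (μ : Measure Ω) (X : ℕ → Ω → L2Square)
    (x : (K : ℕ) → ℕ → Ω → Fin K → Fin K → ℝ) : Prop :=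
  ∃ (Y : ℕ → Ω → ℝ × ℝ → ℝ) (τ ξ : (K : ℕ) → Fin K → ℝ),
    (∀ n, ∀ᵐ ω ∂μ, ContinuousOn (Y n ω) (Icc (0 : ℝ) 1 ×ˢ Icc (0 : ℝ) 1) ∧
      X n ω =ᵐ[sqMeasure] Y n ω) ∧
    (∃ m : ℝ, ∀ u ∈ Icc (0 : ℝ) 1 ×ˢ Icc (0 : ℝ) 1,
      Integrable (fun ω => (Y 0 ω u) ^ 4) μ ∧ ∫ ω, (Y 0 ω u) ^ 4 ∂μ ≤ m) ∧
    (∀ (K : ℕ) (i : Fin K), τ K i ∈ Icc ((i : ℝ) / K) (((i : ℝ) + 1) / K)) ∧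
    (∀ (K : ℕ) (j : Fin K), ξ K j ∈ Icc ((j : ℝ) / K) (((j : ℝ) + 1) / K)) ∧
    ∀ K n ω i j, x K n ω i j = Y n ω (τ K i, ξ K j)

/-- Pixel-wise sampling: the average of the surface over every pixel is observed. -/
def PixelScheme (X : ℕ → Ω → L2Square)
    (x : (K : ℕ) → ℕ → Ω → Fin K → Fin K → ℝ) : Prop :=
  ∀ K n ω i j, x K n ω i j
    = (∫ p in cell K i ×ˢ cell K j, (X n ω : ℝ × ℝ → ℝ) p) / ((K : ℝ) ^ 2)⁻¹

/-- Moment conditions on the measurement error array `e` of one sampled surface `x`. -/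
structure IsNoise (μ : Measure Ω) (σ : ℝ) {K : ℕ} (x e : Ω → Fin K → Fin K → ℝ) : Prop where
  memLp : ∀ i j, MemLp (fun ω => e ω i j) 2 μ
  mean_zero : ∀ i j, ∫ ω, e ω i j ∂μ = 0
  var_le : ∀ i j, ∫ ω, (e ω i j) ^ 2 ∂μ ≤ σ ^ 2
  uncorrelated : ∀ i j k l, (i, j) ≠ (k, l) → ∫ ω, e ω i j * e ω k l ∂μ = 0
  uncorrelated_signal : ∀ i j k l, ∫ ω, e ω i j * x ω k l ∂μ = 0
  mixed_integrable : ∀ i j k l i' j' k' l',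
    Integrable (fun ω => e ω i j * e ω k l * x ω i' j' * x ω k' l') μ
  mixed : ∀ i j k l i' j' k' l',
    ∫ ω, e ω i j * e ω k l * x ω i' j' * x ω k' l' ∂μ
      = (∫ ω, e ω i j * e ω k l ∂μ) * ∫ ω, x ω i' j' * x ω k' l' ∂μ
  fourth_integrable : ∀ i j k l, (i, j) ≠ (k, l) →
    Integrable (fun ω => (e ω i j) ^ 2 * (e ω k l) ^ 2) μ
  fourth_le : ∀ i j k l, (i, j) ≠ (k, l) →
    ∫ ω, (e ω i j) ^ 2 * (e ω k l) ^ 2 ∂μ ≤ σ ^ 4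

end Random

end SPT

/-! Off the diagonal, the mean of the observed outer products is a tensor of local means of the
covariance kernel `c`: each entry integrates `c` against a product of probability measures on the
four cells, Dirac measures for pointwise sampling and uniform laws for pixel averages
(`exists_isSample`). Measurement error changes this mean on the diagonal only. The estimator sees
the data through shifted traces with a positive shift, and the objective sees only off-diagonal
entries, so the diagonal never matters.

Stochastic error. `bandSeminorm` collects the off-diagonal part, the two shifted partial traces and
the shifted trace. The image of one outer product under these linear maps has a second moment
bounded uniformly in `K` (`integral_norm_sq_outerSq_le`), so the empirical covariance is within
`O_P(N^{-1/2})` of its mean in this seminorm, uniformly in `K`. While the trace stays away from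
zero, the separable estimator is Lipschitz in the seminorm (`norm_sepEst_sub_le`). So is the full
estimator, since Toeplitz averaging contracts the off-diagonal norm.

Exactness at banded bandwidths. The shift `⌈δK⌉ + 1` keeps the cells involved at distance at least
`δ`. If `b` is banded by `δ`, the traces of the mean tensor do not see `b`, and the separable
estimator applied to the mean tensor returns exactly the local means of `a`
(`meanTensor_congr_of_lag_le`, `sepEst_eq_of_product`).

Selection. Up to a small error, the leave-one-out objective is `‖C(δ) - C‖² - ‖C‖²` in the
off-diagonal norm, computed from mean tensors (`abs_XiHat_sub_le`). At a banded `δ` the residual `C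
- A(δ)` approximates a stationary kernel and the first term tends to zero with `K`. At any other
candidate, positivity of `Xi` says that the residual kernel is not stationary: it takes different
values at two points with equal lags. By continuity it does so on whole boxes, and no stationary
tensor can match both (`Approximates.exists_le_of_not_stationary`). So beyond some `K₀`, which does
not depend on `ε`, the two kinds of candidates are separated by a fixed gap, and with high
probability the minimizer is banded (`exists_rate_of_isSeparated`). Which banded candidate is chosen
does not matter, since the error bounds hold for all of the finitely many candidates at once.

Bias. Replacing `a` by the piecewise constant function of its local means costs an amount determined
by the Lipschitz constant and by the mean squared distance inside a cell. Together with Young's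
inequality this gives `2 K⁻² L²` (`hsNormSq_continuation_sub_le`). -/

namespace SPT

/-! ### Sums along a shifted diagonal -/

/-- The sum of the entries `f j (j + d)`. -/
def shiftSum {K : ℕ} (d : ℕ) (f : Fin K → Fin K → ℝ) : ℝ :=
  ∑ j : Fin K, ∑ l : Fin K, if (l : ℕ) = j + d then f j l else 0

lemma dTrace₁_eq {K : ℕ} (d : ℕ) (M : Tensor K) (i k : Fin K) :
    dTrace₁ d M i k = shiftSum d (fun j l => M i j k l) := rfl

lemma dTrace₂_eq {K : ℕ} (d : ℕ) (M : Tensor K) (j l : Fin K) :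
    dTrace₂ d M j l = shiftSum d (fun i k => M i j k l) := rfl

lemma dTrace_eq {K : ℕ} (d : ℕ) (M : Tensor K) :
    dTrace d M = shiftSum d (fun i k => shiftSum d (fun j l => M i j k l)) := by
  unfold dTrace shiftSum
  refine Finset.sum_congr rfl fun i _ => Finset.sum_congr rfl fun k _ => ?_
  split_ifs with h
  · simp [h]
  · simp [h]

section shiftSum

variable {K : ℕ} {d : ℕ}

lemma shiftSum_congr {f g : Fin K → Fin K → ℝ} (h : ∀ j l : Fin K, (l : ℕ) = j + d → f j l = g j l) :
    shiftSum d f = shiftSum d g := by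
  unfold shiftSum
  refine Finset.sum_congr rfl fun j _ => Finset.sum_congr rfl fun l _ => ?_
  split_ifs with hl
  · exact h j l hl
  · rfl

lemma shiftSum_le {f g : Fin K → Fin K → ℝ} (h : ∀ j l : Fin K, (l : ℕ) = j + d → f j l ≤ g j l) :
    shiftSum d f ≤ shiftSum d g := by
  unfold shiftSum
  refine Finset.sum_le_sum fun j _ => Finset.sum_le_sum fun l _ => ?_
  split_ifs with hl
  · exact h j l hl
  · rfl

lemma shiftSum_nonneg {f : Fin K → Fin K → ℝ} (h : ∀ j l, 0 ≤ f j l) : 0 ≤ shiftSum d f := by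
  unfold shiftSum
  refine Finset.sum_nonneg fun j _ => Finset.sum_nonneg fun l _ => ?_
  split_ifs
  · exact h j l
  · rfl

lemma shiftSum_add (f g : Fin K → Fin K → ℝ) :
    shiftSum d (fun j l => f j l + g j l) = shiftSum d f + shiftSum d g := by
  unfold shiftSum
  simp only [← Finset.sum_add_distrib]
  refine Finset.sum_congr rfl fun j _ => Finset.sum_congr rfl fun l _ => ?_
  split_ifs <;> simp

lemma shiftSum_mul_left (r : ℝ) (f : Fin K → Fin K → ℝ) :
    shiftSum d (fun j l => r * f j l) = r * shiftSum d f := by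
  unfold shiftSum
  simp only [Finset.mul_sum]
  refine Finset.sum_congr rfl fun j _ => Finset.sum_congr rfl fun l _ => ?_
  split_ifs <;> simp

lemma shiftSum_mul_right (r : ℝ) (f : Fin K → Fin K → ℝ) :
    shiftSum d (fun j l => f j l * r) = shiftSum d f * r := by
  simp only [mul_comm _ r, shiftSum_mul_left]

lemma shiftSum_row_le (j : Fin K) (r : ℝ) (hr : 0 ≤ r) :
    (∑ l : Fin K, if (l : ℕ) = j + d then r else 0) ≤ r := by
  by_cases h : (j : ℕ) + d < K
  · rw [Finset.sum_eq_single (⟨j + d, h⟩ : Fin K)]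
    · simp
    · intro l _ hl
      rw [if_neg]
      intro h'
      exact hl (Fin.ext h')
    · simp
  · rw [Finset.sum_eq_zero]
    · exact hr
    · intro l _
      rw [if_neg]
      have := l.2
      omega

lemma shiftSum_const_le (r : ℝ) (hr : 0 ≤ r) :
    shiftSum (K := K) d (fun _ _ => r) ≤ K * r := by
  unfold shiftSum
  refine (Finset.sum_le_sum fun j _ => shiftSum_row_le j r hr).trans ?_
  simp

/-- Cauchy–Schwarz against the indicator of the shifted diagonal, which has at most `K` entries. -/
lemma shiftSum_sq_le (f : Fin K → Fin K → ℝ) :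
    (shiftSum d f) ^ 2 ≤ K * shiftSum d (fun j l => f j l ^ 2) := by
  have h := Finset.sum_mul_sq_le_sq_mul_sq (Finset.univ : Finset (Fin K × Fin K))
    (fun p => if (p.2 : ℕ) = p.1 + d then (1 : ℝ) else 0)
    (fun p => if (p.2 : ℕ) = p.1 + d then f p.1 p.2 else 0)
  have h1 : ∑ p : Fin K × Fin K, (if (p.2 : ℕ) = p.1 + d then (1 : ℝ) else 0)
      * (if (p.2 : ℕ) = p.1 + d then f p.1 p.2 else 0) = shiftSum d f := by
    rw [Fintype.sum_prod_type]
    refine Finset.sum_congr rfl fun j _ => Finset.sum_congr rfl fun l _ => ?_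
    split_ifs <;> simp
  have h2 : ∑ p : Fin K × Fin K, (if (p.2 : ℕ) = p.1 + d then (1 : ℝ) else 0) ^ 2
      = shiftSum (K := K) d (fun _ _ => 1) := by
    rw [Fintype.sum_prod_type]
    refine Finset.sum_congr rfl fun j _ => Finset.sum_congr rfl fun l _ => ?_
    split_ifs <;> simp
  have h3 : ∑ p : Fin K × Fin K, (if (p.2 : ℕ) = p.1 + d then f p.1 p.2 else 0) ^ 2
      = shiftSum d (fun j l => f j l ^ 2) := by
    rw [Fintype.sum_prod_type]
    refine Finset.sum_congr rfl fun j _ => Finset.sum_congr rfl fun l _ => ?_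
    split_ifs <;> simp
  rw [h1, h2, h3] at h
  refine h.trans (mul_le_mul_of_nonneg_right ?_ (shiftSum_nonneg fun _ _ => sq_nonneg _))
  simpa using shiftSum_const_le (K := K) (d := d) 1 zero_le_one

lemma shiftSum_col_le (l : Fin K) (r : ℝ) (hr : 0 ≤ r) :
    (∑ j : Fin K, if (l : ℕ) = j + d then r else 0) ≤ r := by
  by_cases h : d ≤ (l : ℕ)
  · have hl := l.2
    rw [Finset.sum_eq_single (⟨l - d, by omega⟩ : Fin K)]
    · split_ifs <;> simp [hr]
    · intro j _ hj
      rw [if_neg]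
      intro h'
      apply hj
      ext
      simp
      omega
    · simp
  · rw [Finset.sum_eq_zero]
    · exact hr
    · intro j _
      rw [if_neg]
      omega

/-- Every index occurs at most once as a row and at most once as a column of the shifted diagonal,
so for products Cauchy–Schwarz costs no factor `K`. -/
lemma shiftSum_mul_sq_le (u v : Fin K → ℝ) :
    (shiftSum d (fun j l => u j * v l)) ^ 2 ≤ (∑ j, u j ^ 2) * ∑ l, v l ^ 2 := by
  have h := Finset.sum_mul_sq_le_sq_mul_sq (Finset.univ : Finset (Fin K × Fin K))
    (fun p => if (p.2 : ℕ) = p.1 + d then u p.1 else 0)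
    (fun p => if (p.2 : ℕ) = p.1 + d then v p.2 else 0)
  have h1 : ∑ p : Fin K × Fin K, (if (p.2 : ℕ) = p.1 + d then u p.1 else 0)
      * (if (p.2 : ℕ) = p.1 + d then v p.2 else 0) = shiftSum d (fun j l => u j * v l) := by
    rw [Fintype.sum_prod_type]
    refine Finset.sum_congr rfl fun j _ => Finset.sum_congr rfl fun l _ => ?_
    split_ifs <;> simp
  rw [h1] at h
  refine h.trans (mul_le_mul ?_ ?_ (Finset.sum_nonneg fun _ _ => sq_nonneg _)
    (Finset.sum_nonneg fun _ _ => sq_nonneg _))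
  · rw [Fintype.sum_prod_type]
    refine Finset.sum_le_sum fun j _ => ?_
    have := shiftSum_row_le (d := d) j (u j ^ 2) (sq_nonneg _)
    simpa [ite_pow] using this
  · rw [Fintype.sum_prod_type_right]
    refine Finset.sum_le_sum fun l _ => ?_
    have := shiftSum_col_le (d := d) l (v l ^ 2) (sq_nonneg _)
    simpa [ite_pow] using this

end shiftSum

/-! ### Normalised tensors and partial traces as Euclidean vectors -/

/-- Index set of the entries of a tensor. -/
abbrev Idx (K : ℕ) := Fin K × Fin K × Fin K × Fin K

/-- Off-diagonal part of a tensor as a Euclidean vector with the normalised norm. -/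
noncomputable def starVec {K : ℕ} : Tensor K →ₗ[ℝ] EuclideanSpace ℝ (Idx K) where
  toFun M := WithLp.toLp 2 fun v =>
    if (v.1, v.2.1) ≠ (v.2.2.1, v.2.2.2) then M v.1 v.2.1 v.2.2.1 v.2.2.2 / (K : ℝ) ^ 2 else 0
  map_add' M M' := by
    ext v
    simp only [PiLp.add_apply, Pi.add_apply]
    split_ifs <;> ring
  map_smul' r M := by
    ext v
    simp only [PiLp.smul_apply, Pi.smul_apply, smul_eq_mul, RingHom.id_apply]
    split_ifs <;> ring

/-- A tensor as a Euclidean vector with the normalised norm. -/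
noncomputable def tensorVec {K : ℕ} : Tensor K →ₗ[ℝ] EuclideanSpace ℝ (Idx K) where
  toFun M := WithLp.toLp 2 fun v => M v.1 v.2.1 v.2.2.1 v.2.2.2 / (K : ℝ) ^ 2
  map_add' M M' := by
    ext v
    simp only [PiLp.add_apply, Pi.add_apply]
    ring
  map_smul' r M := by
    ext v
    simp only [PiLp.smul_apply, Pi.smul_apply, smul_eq_mul, RingHom.id_apply]
    ring

lemma starVec_apply {K : ℕ} (M : Tensor K) (v : Idx K) : starVec M v =
    if (v.1, v.2.1) ≠ (v.2.2.1, v.2.2.2) then M v.1 v.2.1 v.2.2.1 v.2.2.2 / (K : ℝ) ^ 2 else 0 :=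
  rfl

lemma tensorVec_apply {K : ℕ} (M : Tensor K) (v : Idx K) :
    tensorVec M v = M v.1 v.2.1 v.2.2.1 v.2.2.2 / (K : ℝ) ^ 2 := rfl

/-- Normalised first shifted partial trace. -/
noncomputable def trace₁Vec {K : ℕ} (d : ℕ) : Tensor K →ₗ[ℝ] EuclideanSpace ℝ (Fin K × Fin K) where
  toFun M := WithLp.toLp 2 fun v => dTrace₁ d M v.1 v.2 / (K : ℝ) ^ 2
  map_add' M M' := by
    ext v
    simp only [PiLp.add_apply, dTrace₁_eq, Pi.add_apply, shiftSum_add]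
    ring
  map_smul' r M := by
    ext v
    simp only [PiLp.smul_apply, dTrace₁_eq, Pi.smul_apply, smul_eq_mul, RingHom.id_apply,
      shiftSum_mul_left]
    ring

/-- Normalised second shifted partial trace. -/
noncomputable def trace₂Vec {K : ℕ} (d : ℕ) : Tensor K →ₗ[ℝ] EuclideanSpace ℝ (Fin K × Fin K) where
  toFun M := WithLp.toLp 2 fun v => dTrace₂ d M v.1 v.2 / (K : ℝ) ^ 2
  map_add' M M' := by
    ext v
    simp only [PiLp.add_apply, dTrace₂_eq, Pi.add_apply, shiftSum_add]
    ring
  map_smul' r M := by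
    ext v
    simp only [PiLp.smul_apply, dTrace₂_eq, Pi.smul_apply, smul_eq_mul, RingHom.id_apply,
      shiftSum_mul_left]
    ring

/-- Normalised shifted trace, as a one-dimensional vector. -/
noncomputable def traceVec {K : ℕ} (d : ℕ) : Tensor K →ₗ[ℝ] EuclideanSpace ℝ Unit where
  toFun M := WithLp.toLp 2 fun _ => dTrace d M / (K : ℝ) ^ 2
  map_add' M M' := by
    ext v
    simp only [PiLp.add_apply, dTrace_eq, Pi.add_apply, shiftSum_add]
    ring
  map_smul' r M := by
    ext v
    simp only [PiLp.smul_apply, dTrace_eq, Pi.smul_apply, smul_eq_mul, RingHom.id_apply,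
      shiftSum_mul_left]
    ring

lemma trace₁Vec_apply {K : ℕ} (d : ℕ) (M : Tensor K) (v : Fin K × Fin K) :
    trace₁Vec d M v = dTrace₁ d M v.1 v.2 / (K : ℝ) ^ 2 := rfl

lemma trace₂Vec_apply {K : ℕ} (d : ℕ) (M : Tensor K) (v : Fin K × Fin K) :
    trace₂Vec d M v = dTrace₂ d M v.1 v.2 / (K : ℝ) ^ 2 := rfl

lemma traceVec_apply {K : ℕ} (d : ℕ) (M : Tensor K) (v : Unit) :
    traceVec d M v = dTrace d M / (K : ℝ) ^ 2 := rfl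

lemma norm_traceVec {K : ℕ} (d : ℕ) (M : Tensor K) :
    ‖traceVec d M‖ = |dTrace d M / (K : ℝ) ^ 2| := by
  rw [EuclideanSpace.norm_eq]
  simp only [traceVec_apply, Finset.univ_unique, Finset.sum_singleton, Real.norm_eq_abs, sq_abs,
    Real.sqrt_sq_eq_abs]

lemma starInner_eq {K : ℕ} (F G : Tensor K) : starInner F G = inner ℝ (starVec F) (starVec G) := by
  unfold starInner
  rw [PiLp.inner_apply]
  simp only [Fintype.sum_prod_type, Finset.sum_div]
  refine Finset.sum_congr rfl fun i _ => Finset.sum_congr rfl fun j _ =>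
    Finset.sum_congr rfl fun k _ => Finset.sum_congr rfl fun l _ => ?_
  simp only [starVec_apply, RCLike.inner_apply, conj_trivial]
  split_ifs
  · ring
  · simp

lemma norm_starVec_le {K : ℕ} (M : Tensor K) : ‖starVec M‖ ≤ ‖tensorVec M‖ := by
  rw [EuclideanSpace.norm_eq, EuclideanSpace.norm_eq]
  refine Real.sqrt_le_sqrt (Finset.sum_le_sum fun v _ => ?_)
  rw [starVec_apply, tensorVec_apply]
  split_ifs
  · rfl
  · simp; positivity

/-- The seminorm that controls the estimators with discrete bandwidth `d`. -/
noncomputable def bandSeminorm {K : ℕ} (d : ℕ) : Seminorm ℝ (Tensor K) :=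
  (normSeminorm ℝ _).comp starVec + (normSeminorm ℝ _).comp (trace₁Vec d)
    + (normSeminorm ℝ _).comp (trace₂Vec d) + (normSeminorm ℝ _).comp (traceVec d)

lemma bandSeminorm_apply {K : ℕ} (d : ℕ) (M : Tensor K) :
    bandSeminorm d M = ‖starVec M‖ + ‖trace₁Vec d M‖ + ‖trace₂Vec d M‖ + ‖traceVec d M‖ := rfl

/-- Tensor product of two Euclidean matrices. -/
noncomputable def otimes {K : ℕ} (u w : EuclideanSpace ℝ (Fin K × Fin K)) :
    EuclideanSpace ℝ (Idx K) :=
  WithLp.toLp 2 fun v => u (v.1, v.2.2.1) * w (v.2.1, v.2.2.2)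

lemma norm_otimes {K : ℕ} (u w : EuclideanSpace ℝ (Fin K × Fin K)) :
    ‖otimes u w‖ = ‖u‖ * ‖w‖ := by
  rw [EuclideanSpace.norm_eq, EuclideanSpace.norm_eq, EuclideanSpace.norm_eq,
    ← Real.sqrt_mul (Finset.sum_nonneg fun _ _ => sq_nonneg _), Finset.sum_mul_sum]
  congr 1
  simp only [Fintype.sum_prod_type, otimes, norm_mul, mul_pow]
  refine Finset.sum_congr rfl fun i _ => ?_
  rw [Finset.sum_comm]

/-- The normalisations by `K ^ 2` are compatible with the quotient. The estimator thus becomes a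
scalar times a tensor product, whose norm is multiplicative. -/
lemma tensorVec_sepEst {K : ℕ} (d : ℕ) (M : Tensor K) :
    tensorVec (sepEst d M) = (dTrace d M / (K : ℝ) ^ 2)⁻¹ • otimes (trace₁Vec d M) (trace₂Vec d M) := by
  ext v
  have hK : (K : ℝ) ≠ 0 := by
    have := v.1.pos
    positivity
  simp only [tensorVec_apply, PiLp.smul_apply, otimes, trace₁Vec_apply, trace₂Vec_apply, sepEst,
    smul_eq_mul]
  field_simp

lemma otimes_sub_sub {K : ℕ} (u w u₀ w₀ : EuclideanSpace ℝ (Fin K × Fin K)) (r r₀ : ℝ) :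
    r • otimes u w - r₀ • otimes u₀ w₀
      = r • otimes (u - u₀) w + r • otimes u₀ (w - w₀) + (r - r₀) • otimes u₀ w₀ := by
  ext v
  simp only [otimes, PiLp.sub_apply, PiLp.add_apply, PiLp.smul_apply, smul_eq_mul]
  ring

/-- The Lipschitz constant of the separable estimator. -/
noncomputable def sepLip (R τ : ℝ) : ℝ := 2 / τ * (R + 1) + 2 / τ * R + 2 / τ ^ 2 * R ^ 2

lemma sepLip_nonneg {R τ : ℝ} (hR : 0 ≤ R) (hτ : 0 < τ) : 0 ≤ sepLip R τ := by
  unfold sepLip; positivity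

/-- Telescoping in the two partial traces and the reciprocal of the trace. A perturbation of at most
`τ / 2` keeps the trace above `τ / 2`, and one of at most `1` keeps the second partial trace below
`R + 1`. -/
lemma norm_sepEst_sub_le {K : ℕ} {d : ℕ} {M M₀ : Tensor K} {R τ : ℝ} (hτ : 0 < τ)
    (hR : bandSeminorm d M₀ ≤ R) (hT : τ ≤ |dTrace d M₀ / (K : ℝ) ^ 2|)
    (h1 : bandSeminorm d (M - M₀) ≤ 1) (h2 : bandSeminorm d (M - M₀) ≤ τ / 2) :
    ‖tensorVec (sepEst d M - sepEst d M₀)‖ ≤ sepLip R τ * bandSeminorm d (M - M₀) := by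
  rw [map_sub, tensorVec_sepEst, tensorVec_sepEst, otimes_sub_sub, ← map_sub, ← map_sub]
  set η := bandSeminorm d (M - M₀) with hη
  have e := bandSeminorm_apply d (M - M₀)
  have e0 := bandSeminorm_apply d M₀
  have hu : ‖trace₁Vec d (M - M₀)‖ ≤ η := by
    linarith [norm_nonneg (starVec (M - M₀)), norm_nonneg (trace₂Vec d (M - M₀)),
      norm_nonneg (traceVec d (M - M₀))]
  have hw : ‖trace₂Vec d (M - M₀)‖ ≤ η := by
    linarith [norm_nonneg (starVec (M - M₀)), norm_nonneg (trace₁Vec d (M - M₀)),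
      norm_nonneg (traceVec d (M - M₀))]
  have ht : ‖traceVec d (M - M₀)‖ ≤ η := by
    linarith [norm_nonneg (starVec (M - M₀)), norm_nonneg (trace₁Vec d (M - M₀)),
      norm_nonneg (trace₂Vec d (M - M₀))]
  have hu0 : ‖trace₁Vec d M₀‖ ≤ R := by
    linarith [norm_nonneg (starVec M₀), norm_nonneg (trace₂Vec d M₀),
      norm_nonneg (traceVec d M₀)]
  have hw0 : ‖trace₂Vec d M₀‖ ≤ R := by
    linarith [norm_nonneg (starVec M₀), norm_nonneg (trace₁Vec d M₀),
      norm_nonneg (traceVec d M₀)]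
  have hη0 : 0 ≤ η := apply_nonneg _ _
  have hR0 : 0 ≤ R := (norm_nonneg _).trans hw0
  have hwM : ‖trace₂Vec d M‖ ≤ R + 1 := by
    have : trace₂Vec d M = trace₂Vec d M₀ + trace₂Vec d (M - M₀) := by
      rw [← map_add]; congr 1; abel
    rw [this]
    exact (norm_add_le _ _).trans (by linarith)
  set t := dTrace d M / (K : ℝ) ^ 2 with htdef
  set t₀ := dTrace d M₀ / (K : ℝ) ^ 2 with ht0def
  have htt : |t - t₀| ≤ η := by
    have : t - t₀ = dTrace d (M - M₀) / (K : ℝ) ^ 2 := by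
      have := congrArg (fun z => z ()) (map_sub (traceVec (K := K) d) M M₀)
      exact this.symm
    rw [this, ← norm_traceVec]
    exact ht
  have htabs : τ / 2 ≤ |t| := by
    have := abs_sub_abs_le_abs_sub t₀ t
    rw [abs_sub_comm] at this
    linarith
  have htpos : 0 < |t| := by linarith
  have ht0pos : 0 < |t₀| := by linarith
  have hinv : |t⁻¹| ≤ 2 / τ := by
    rw [abs_inv, ← inv_div]
    exact inv_anti₀ (by positivity) htabs
  have hdiff : |t⁻¹ - t₀⁻¹| ≤ 2 / τ ^ 2 * η := by
    have htne : t ≠ 0 := abs_pos.1 htpos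
    have ht0ne : t₀ ≠ 0 := abs_pos.1 ht0pos
    have : t⁻¹ - t₀⁻¹ = (t₀ - t) * (t⁻¹ * t₀⁻¹) := by field_simp
    rw [this, abs_mul, abs_mul, abs_sub_comm, abs_inv t₀]
    have h3 : |t₀|⁻¹ ≤ 1 / τ := by
      rw [one_div]; exact inv_anti₀ hτ hT
    calc |t - t₀| * (|t⁻¹| * |t₀|⁻¹) ≤ η * (2 / τ * (1 / τ)) := by gcongr
      _ = 2 / τ ^ 2 * η := by field_simp
  refine (norm_add_le _ _).trans ((add_le_add_left (norm_add_le _ _) _).trans ?_)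
  rw [norm_smul, norm_smul, norm_smul, norm_otimes, norm_otimes, norm_otimes]
  simp only [Real.norm_eq_abs]
  calc |t⁻¹| * (‖trace₁Vec d (M - M₀)‖ * ‖trace₂Vec d M‖)
        + |t⁻¹| * (‖trace₁Vec d M₀‖ * ‖trace₂Vec d (M - M₀)‖)
        + |t⁻¹ - t₀⁻¹| * (‖trace₁Vec d M₀‖ * ‖trace₂Vec d M₀‖)
      ≤ 2 / τ * (η * (R + 1)) + 2 / τ * (R * η) + 2 / τ ^ 2 * η * (R * R) := by gcongr
    _ = sepLip R τ * η := by unfold sepLip; ring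

lemma norm_sepEst_le {K : ℕ} {d : ℕ} {M₀ : Tensor K} {R τ : ℝ} (hτ : 0 < τ)
    (hR : bandSeminorm d M₀ ≤ R) (hT : τ ≤ |dTrace d M₀ / (K : ℝ) ^ 2|) :
    ‖tensorVec (sepEst d M₀)‖ ≤ R ^ 2 / τ := by
  have e0 := bandSeminorm_apply d M₀
  have hu0 : ‖trace₁Vec d M₀‖ ≤ R := by
    linarith [norm_nonneg (starVec M₀), norm_nonneg (trace₂Vec d M₀),
      norm_nonneg (traceVec d M₀)]
  have hw0 : ‖trace₂Vec d M₀‖ ≤ R := by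
    linarith [norm_nonneg (starVec M₀), norm_nonneg (trace₁Vec d M₀),
      norm_nonneg (traceVec d M₀)]
  have hR0 : 0 ≤ R := (norm_nonneg _).trans hw0
  rw [tensorVec_sepEst, norm_smul, norm_otimes, Real.norm_eq_abs, abs_inv]
  have : |dTrace d M₀ / (K : ℝ) ^ 2|⁻¹ ≤ τ⁻¹ := inv_anti₀ hτ hT
  calc _ ≤ τ⁻¹ * (R * R) := by gcongr
    _ = R ^ 2 / τ := by ring

/-! ### Toeplitz averaging is a contraction -/

lemma mem_lagClass {K : ℕ} {i j k l : Fin K} {q : Idx K} : q ∈ lagClass i j k l ↔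
    ((q.1 : ℤ) - (q.2.2.1 : ℤ)).natAbs = ((i : ℤ) - (k : ℤ)).natAbs ∧
      ((q.2.1 : ℤ) - (q.2.2.2 : ℤ)).natAbs = ((j : ℤ) - (l : ℤ)).natAbs := by
  simp [lagClass]

lemma self_mem_lagClass {K : ℕ} (i j k l : Fin K) : (i, j, k, l) ∈ lagClass i j k l := by
  simp [mem_lagClass]

lemma lagClass_card_pos {K : ℕ} (i j k l : Fin K) : 0 < (lagClass i j k l).card :=
  Finset.card_pos.2 ⟨_, self_mem_lagClass i j k l⟩

lemma lagClass_eq_of_mem {K : ℕ} {i j k l : Fin K} {q : Idx K} (h : q ∈ lagClass i j k l) :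
    lagClass q.1 q.2.1 q.2.2.1 q.2.2.2 = lagClass i j k l := by
  ext r
  rw [mem_lagClass] at h
  rw [mem_lagClass, mem_lagClass, h.1, h.2]

lemma mem_lagClass_comm {K : ℕ} {q v : Idx K} :
    q ∈ lagClass v.1 v.2.1 v.2.2.1 v.2.2.2 ↔ v ∈ lagClass q.1 q.2.1 q.2.2.1 q.2.2.2 := by
  rw [mem_lagClass, mem_lagClass, eq_comm, @eq_comm _ (Int.natAbs (_ - (q.2.2.2 : ℤ)))]

/-- Lag classes partition the indices. Within a class the square of the mean is at most the mean of
the squares, and after exchanging the sums each `f q ^ 2` is counted once for every member of its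
class, which cancels the division. -/
lemma sum_avg_sq_le {K : ℕ} (f : Idx K → ℝ) :
    ∑ v : Idx K, ((∑ q ∈ lagClass v.1 v.2.1 v.2.2.1 v.2.2.2, f q)
      / ((lagClass v.1 v.2.1 v.2.2.1 v.2.2.2).card : ℝ)) ^ 2 ≤ ∑ v, f v ^ 2 := by
  set c : Idx K → Finset (Idx K) := fun v => lagClass v.1 v.2.1 v.2.2.1 v.2.2.2 with hc
  have hpos : ∀ v, (0 : ℝ) < (c v).card := fun v => by
    exact_mod_cast lagClass_card_pos v.1 v.2.1 v.2.2.1 v.2.2.2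
  have step : ∀ v, ((∑ q ∈ c v, f q) / ((c v).card : ℝ)) ^ 2
      ≤ ∑ q, if q ∈ c v then f q ^ 2 / (c q).card else 0 := by
    intro v
    have h1 : ∑ q, (if q ∈ c v then f q ^ 2 / (c q).card else 0)
        = ∑ q ∈ c v, f q ^ 2 / (c v).card := by
      rw [← Finset.sum_filter]
      simp only [Finset.filter_mem_eq_inter, Finset.univ_inter]
      refine Finset.sum_congr rfl fun q hq => ?_
      rw [show c q = c v from lagClass_eq_of_mem hq]
    rw [h1, ← Finset.sum_div, div_pow, div_le_div_iff₀ (by have := hpos v; positivity) (hpos v)]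
    have := sq_sum_le_card_mul_sum_sq (s := c v) (f := f)
    have h0 := hpos v
    calc (∑ q ∈ c v, f q) ^ 2 * ((c v).card : ℝ)
        ≤ ((c v).card * ∑ q ∈ c v, f q ^ 2) * ((c v).card : ℝ) := by gcongr
      _ = _ := by ring
  refine (Finset.sum_le_sum fun v _ => step v).trans ?_
  rw [Finset.sum_comm]
  refine Finset.sum_le_sum fun q _ => le_of_eq ?_
  simp only [hc, mem_lagClass_comm (q := q)]
  rw [← Finset.sum_filter]
  simp only [Finset.filter_mem_eq_inter, Finset.univ_inter, Finset.sum_const, nsmul_eq_mul]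
  have := hpos q
  simp only [hc] at this
  field_simp

/-- The class of an off-diagonal entry has a nonzero lag, hence contains no diagonal entry:
averaging never mixes the discarded diagonal into the rest. -/
lemma norm_starVec_dToeplitzAvg_le {K : ℕ} (M : Tensor K) :
    ‖starVec (dToeplitzAvg M)‖ ≤ ‖starVec M‖ := by
  rw [EuclideanSpace.norm_eq, EuclideanSpace.norm_eq]
  refine Real.sqrt_le_sqrt ?_
  refine le_trans (Finset.sum_le_sum fun v _ => ?_) (sum_avg_sq_le (fun v => ‖starVec M v‖))
  rw [starVec_apply]
  split_ifs with h
  · rw [Real.norm_eq_abs, sq_abs, ← sq_abs]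
    refine pow_le_pow_left₀ (abs_nonneg _) ?_ 2
    rw [dToeplitzAvg, div_right_comm, abs_div, Nat.abs_cast]
    refine div_le_div_of_nonneg_right ?_ (Nat.cast_nonneg _)
    rw [Finset.sum_div]
    refine (Finset.abs_sum_le_sum_abs _ _).trans (Finset.sum_le_sum fun q hq => ?_)
    rw [starVec_apply, if_pos, Real.norm_eq_abs]
    rw [mem_lagClass] at hq
    intro h'
    simp only [Prod.mk.injEq] at h'
    simp only [h'.1, h'.2, sub_self, Int.natAbs_zero] at hq
    apply h
    ext <;> simp <;> omega
  · rw [norm_zero, zero_pow two_ne_zero]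
    exact sq_nonneg _

lemma dToeplitzAvg_sub {K : ℕ} (M M' : Tensor K) :
    dToeplitzAvg (M - M') = dToeplitzAvg M - dToeplitzAvg M' := by
  ext i j k l
  simp only [dToeplitzAvg, Pi.sub_apply, Finset.sum_sub_distrib, sub_div]

lemma fullEst_eq {K : ℕ} (d : ℕ) (M : Tensor K) :
    fullEst d M = sepEst d M + dToeplitzAvg (M - sepEst d M) := rfl

/-- The separable part enters twice, directly and inside the Toeplitz average, and the data enter
once; hence `2 * sepLip R τ + 1`. -/
lemma norm_fullEst_sub_le {K : ℕ} {d : ℕ} {M M₀ : Tensor K} {R τ : ℝ} (hτ : 0 < τ)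
    (hR : bandSeminorm d M₀ ≤ R) (hT : τ ≤ |dTrace d M₀ / (K : ℝ) ^ 2|)
    (h1 : bandSeminorm d (M - M₀) ≤ 1) (h2 : bandSeminorm d (M - M₀) ≤ τ / 2) :
    ‖starVec (fullEst d M) - starVec (fullEst d M₀)‖
      ≤ (2 * sepLip R τ + 1) * bandSeminorm d (M - M₀) := by
  have h := norm_sepEst_sub_le hτ hR hT h1 h2
  have h' := (norm_starVec_le (sepEst d M - sepEst d M₀)).trans h
  have e : fullEst d M - fullEst d M₀ = (sepEst d M - sepEst d M₀)
      + dToeplitzAvg ((M - M₀) - (sepEst d M - sepEst d M₀)) := by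
    rw [fullEst_eq, fullEst_eq]
    simp only [dToeplitzAvg_sub]
    abel
  rw [← map_sub, e, map_add]
  refine (norm_add_le _ _).trans ?_
  have h3 := norm_starVec_dToeplitzAvg_le ((M - M₀) - (sepEst d M - sepEst d M₀))
  rw [map_sub starVec (M - M₀)] at h3
  have h4 := norm_sub_le (starVec (M - M₀)) (starVec (sepEst d M - sepEst d M₀))
  have h5 : ‖starVec (M - M₀)‖ ≤ bandSeminorm d (M - M₀) := by
    rw [bandSeminorm_apply]
    linarith [norm_nonneg (trace₁Vec d (M - M₀)), norm_nonneg (trace₂Vec d (M - M₀)),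
      norm_nonneg (traceVec d (M - M₀))]
  linarith

lemma norm_fullEst_le {K : ℕ} {d : ℕ} {M₀ : Tensor K} {R τ : ℝ} (hτ : 0 < τ)
    (hR : bandSeminorm d M₀ ≤ R) (hT : τ ≤ |dTrace d M₀ / (K : ℝ) ^ 2|) :
    ‖starVec (fullEst d M₀)‖ ≤ 2 * (R ^ 2 / τ) + R := by
  have h := (norm_starVec_le _).trans (norm_sepEst_le hτ hR hT)
  have h3 := norm_starVec_dToeplitzAvg_le (M₀ - sepEst d M₀)
  rw [map_sub] at h3
  have h4 := norm_sub_le (starVec M₀) (starVec (sepEst d M₀))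
  have h5 : ‖starVec M₀‖ ≤ R := by
    refine le_trans ?_ hR
    rw [bandSeminorm_apply]
    linarith [norm_nonneg (trace₁Vec d M₀), norm_nonneg (trace₂Vec d M₀),
      norm_nonneg (traceVec d M₀)]
  rw [fullEst_eq, map_add]
  refine (norm_add_le _ _).trans ?_
  linarith

/-! ### The empirical objective -/

lemma empCov_eq {K : ℕ} (x : ℕ → Fin K → Fin K → ℝ) (S : Finset ℕ) :
    empCov x S = (S.card : ℝ)⁻¹ • ∑ n ∈ S, outerSq (x n) := by
  ext i j k l
  simp only [empCov, Pi.smul_apply, Finset.sum_apply, smul_eq_mul]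
  rw [div_eq_inv_mul]

lemma empCov_erase_sub {K : ℕ} (x : ℕ → Fin K → Fin K → ℝ) {N n : ℕ} (hN : 2 ≤ N) (hn : n < N) :
    empCov x ((Finset.range N).erase n) - empCov x (Finset.range N)
      = ((N : ℝ) - 1)⁻¹ • (empCov x (Finset.range N) - outerSq (x n)) := by
  rw [empCov_eq, empCov_eq, Finset.card_erase_of_mem (Finset.mem_range.2 hn), Finset.card_range,
    Finset.sum_erase_eq_sub (Finset.mem_range.2 hn)]
  have h1 : (N : ℝ) - 1 ≠ 0 := by
    have : (2 : ℝ) ≤ N := by exact_mod_cast hN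
    intro h; linarith
  have h2 : (N : ℝ) ≠ 0 := by positivity
  rw [Nat.cast_sub (by omega), Nat.cast_one]
  set s := ∑ n ∈ Finset.range N, outerSq (x n)
  set w := outerSq (x n)
  have : (N : ℝ)⁻¹ = ((N : ℝ) - 1)⁻¹ - ((N : ℝ) - 1)⁻¹ * (N : ℝ)⁻¹ := by
    field_simp
  rw [smul_sub, smul_sub, smul_smul]
  nth_rewrite 1 [this]
  rw [sub_smul]
  abel

/-- The modulus of the empirical objective in terms of the stochastic error. -/
noncomputable def objLip (R R' τ : ℝ) : ℝ :=
  (2 * sepLip R τ + 1) * (2 * (2 * (R ^ 2 / τ) + R) + (2 * sepLip R τ + 1))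
    + 8 * (2 * sepLip R τ + 1) * R' + 2 * (2 * (R ^ 2 / τ) + R)

/-- Removing an observation shifts the mean by `(C - outerSq (x n)) / (N - 1)`. The four multiples
of `η` are: one for the error of the full mean, one for the size `R + 1` of that mean over `N - 1`,
and two for the removed term, since `N / (N - 1) ≤ 2`. -/
lemma bandSeminorm_erase_sub_le {K N d : ℕ} {x : ℕ → Fin K → Fin K → ℝ} {M₀ : Tensor K}
    {R η : ℝ} (hη0 : 0 < η) (hη1 : 4 * η ≤ 1) (hR : bandSeminorm d M₀ ≤ R)
    (hN : 2 ≤ N) (hNR : (R + 1) / ((N : ℝ) - 1) ≤ η)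
    (hC : bandSeminorm d (empCov x (Finset.range N) - M₀) ≤ η)
    (hW : ∀ n < N, bandSeminorm d (outerSq (x n)) ≤ η * N) {n : ℕ} (hn : n < N) :
    bandSeminorm d (empCov x ((Finset.range N).erase n) - M₀) ≤ 4 * η := by
  set C := empCov x (Finset.range N) with hCdef
  have hN1 : (2 : ℝ) ≤ N := by exact_mod_cast hN
  have hCR : bandSeminorm d C ≤ R + 1 := by
    have h := map_add_le_add (bandSeminorm d) (C - M₀) M₀
    rw [sub_add_cancel] at h
    linarith
  have e : empCov x ((Finset.range N).erase n) - M₀ = (C - M₀) + ((N : ℝ) - 1)⁻¹ • (C - outerSq (x n)) := by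
    rw [← empCov_erase_sub x hN hn]
    abel
  have h1 := map_add_le_add (bandSeminorm d) (C - M₀) (((N : ℝ) - 1)⁻¹ • (C - outerSq (x n)))
  rw [← e, map_smul_eq_mul, Real.norm_eq_abs, abs_of_nonneg (by
    apply inv_nonneg.2; linarith)] at h1
  have h2 := map_sub_le_add (bandSeminorm d) C (outerSq (x n))
  have h3 := hW n hn
  have hpos : (0 : ℝ) < (N : ℝ) - 1 := by linarith
  have h4 : ((N : ℝ) - 1)⁻¹ * bandSeminorm d (C - outerSq (x n))
      ≤ ((N : ℝ) - 1)⁻¹ * ((R + 1) + η * N) := by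
    gcongr; linarith
  have h5 : ((N : ℝ) - 1)⁻¹ * (η * N) ≤ 2 * η := by
    rw [inv_mul_le_iff₀ hpos]
    have := mul_nonneg hη0.le (sub_nonneg.2 hN1)
    linarith
  rw [div_eq_inv_mul] at hNR
  linarith

/-- Once all estimators are replaced by the one computed from `M₀`, the objective is `‖F0‖² - 2 ⟨F0,
M₀⟩`, a completed square minus `‖M₀‖²`. The subtracted term does not depend on the bandwidth, so it
has no influence on minimizers. -/
lemma abs_XiHat_sub_le {K N : ℕ} {x : ℕ → Fin K → Fin K → ℝ} {δ : ℝ} {M₀ : Tensor K}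
    {R R' τ η : ℝ} (hτ : 0 < τ) (hη0 : 0 < η) (hη1 : 4 * η ≤ 1) (hη2 : 4 * η ≤ τ / 2)
    (hR : bandSeminorm (discreteBandwidth δ K) M₀ ≤ R)
    (hT : τ ≤ |dTrace (discreteBandwidth δ K) M₀ / (K : ℝ) ^ 2|)
    (hN : 2 ≤ N) (hNR : (R + 1) / ((N : ℝ) - 1) ≤ η)
    (hC : bandSeminorm (discreteBandwidth δ K) (empCov x (Finset.range N) - M₀) ≤ η)
    (hW : ∀ n < N, bandSeminorm (discreteBandwidth δ K) (outerSq (x n)) ≤ η * N)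
    (hWs : (∑ n ∈ Finset.range N, bandSeminorm (discreteBandwidth δ K) (outerSq (x n))) / N ≤ R') :
    |XiHat N x δ - (‖starVec (fullEst (discreteBandwidth δ K) M₀) - starVec M₀‖ ^ 2
      - ‖starVec M₀‖ ^ 2)| ≤ objLip R R' τ * η := by
  set d := discreteBandwidth δ K
  set C := empCov x (Finset.range N) with hCdef
  set Cn : ℕ → Tensor K := fun n => empCov x ((Finset.range N).erase n) with hCn
  have hR0 : 0 ≤ R := (apply_nonneg (bandSeminorm d) M₀).trans hR
  have hN1 : (2 : ℝ) ≤ N := by exact_mod_cast hN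
  set A := 2 * sepLip R τ + 1 with hA
  have hA0 : 0 ≤ A := by have := sepLip_nonneg hR0 hτ; positivity
  set RF := 2 * (R ^ 2 / τ) + R with hRF
  have hRF0 : 0 ≤ RF := by positivity
  have hloo : ∀ n < N, bandSeminorm d (Cn n - M₀) ≤ 4 * η := fun n hn =>
    bandSeminorm_erase_sub_le hη0 hη1 hR hN hNR hC hW hn
  have hF := norm_fullEst_sub_le hτ hR hT (M := C) (by linarith) (by linarith)
  have hF' : ‖starVec (fullEst d C) - starVec (fullEst d M₀)‖ ≤ A * η :=
    hF.trans (by gcongr)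
  have hFn : ∀ n < N, ‖starVec (fullEst d (Cn n)) - starVec (fullEst d M₀)‖ ≤ A * (4 * η) := by
    intro n hn
    have := hloo n hn
    exact (norm_fullEst_sub_le hτ hR hT (M := Cn n) (by linarith) (by linarith)).trans (by gcongr)
  have hF0 : ‖starVec (fullEst d M₀)‖ ≤ RF := norm_fullEst_le hτ hR hT
  set F := starVec (fullEst d C)
  set F0 := starVec (fullEst d M₀)
  have hstar : ∀ M : Tensor K, ‖starVec M‖ ≤ bandSeminorm d M := fun M => by
    rw [bandSeminorm_apply]
    linarith [norm_nonneg (trace₁Vec d M), norm_nonneg (trace₂Vec d M), norm_nonneg (traceVec d M)]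
  have hmean : (inner ℝ F0 (starVec C) : ℝ)
      = (∑ n ∈ Finset.range N, inner ℝ F0 (starVec (outerSq (x n)))) / N := by
    rw [hCdef, empCov_eq, map_smul, map_sum, inner_smul_right, inner_sum, Finset.card_range,
      div_eq_inv_mul]
  -- Splitting `F0` off every leave-one-out estimator leaves an inner product with the empirical
  -- covariance. The remainder is small because all deviations are at most of order `η`, while the
  -- outer products are bounded only on average.
  have hXi : XiHat N x δ = ‖F‖ ^ 2 - 2 * (inner ℝ F0 (starVec C)
      + (∑ n ∈ Finset.range N, inner ℝ (starVec (fullEst d (Cn n)) - F0)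
          (starVec (outerSq (x n)))) / N) := by
    rw [hmean, ← add_div, ← Finset.sum_add_distrib]
    simp only [XiHat, starInner_eq, inner_sub_left, add_sub_cancel]
    rw [real_inner_self_eq_norm_sq]
    ring
  have hdev : |(∑ n ∈ Finset.range N, inner ℝ (starVec (fullEst d (Cn n)) - F0)
          (starVec (outerSq (x n)))) / N| ≤ A * (4 * η) * R' := by
    rw [abs_div, Nat.abs_cast, div_le_iff₀ (by linarith)]
    rw [div_le_iff₀ (by linarith)] at hWs
    calc |∑ n ∈ Finset.range N, inner ℝ (starVec (fullEst d (Cn n)) - F0)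
          (starVec (outerSq (x n)))|
        ≤ ∑ n ∈ Finset.range N, A * (4 * η) * bandSeminorm d (outerSq (x n)) := by
          refine (Finset.abs_sum_le_sum_abs _ _).trans (Finset.sum_le_sum fun n hn => ?_)
          refine (abs_real_inner_le_norm _ _).trans ?_
          exact mul_le_mul (hFn n (Finset.mem_range.1 hn)) (hstar _) (norm_nonneg _) (by positivity)
      _ = A * (4 * η) * ∑ n ∈ Finset.range N, bandSeminorm d (outerSq (x n)) := by
          rw [Finset.mul_sum]
      _ ≤ A * (4 * η) * (R' * N) := by gcongr
      _ = _ := by ring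
  have hin : |inner ℝ F0 (starVec C) - inner ℝ F0 (starVec M₀)| ≤ RF * η := by
    rw [← inner_sub_right, ← map_sub]
    refine (abs_real_inner_le_norm _ _).trans ?_
    exact mul_le_mul hF0 ((hstar _).trans hC) (norm_nonneg _) hRF0
  have hsq : |‖F‖ ^ 2 - ‖F0‖ ^ 2| ≤ A * η * (2 * RF + A) := by
    have e : ‖F‖ ^ 2 - ‖F0‖ ^ 2 = (‖F‖ - ‖F0‖) * (‖F‖ + ‖F0‖) := by ring
    have h1 : |‖F‖ - ‖F0‖| ≤ A * η := (abs_norm_sub_norm_le _ _).trans hF'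
    have h2 : ‖F‖ ≤ RF + A := by
      have h3 : A * η ≤ A * 1 := by gcongr; linarith
      have := (abs_le.1 h1).2
      linarith
    rw [e, abs_mul, abs_of_nonneg (a := ‖F‖ + ‖F0‖) (by positivity)]
    have h4 : ‖F‖ + ‖F0‖ ≤ 2 * RF + A := by linarith
    exact mul_le_mul h1 h4 (by positivity) (by positivity)
  have hns : ‖F0 - starVec M₀‖ ^ 2 = ‖F0‖ ^ 2 - 2 * inner ℝ F0 (starVec M₀) + ‖starVec M₀‖ ^ 2 :=
    norm_sub_sq_real _ _
  rw [hXi, hns]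
  have eobj : objLip R R' τ = A * (2 * RF + A) + 8 * A * R' + 2 * RF := rfl
  rw [eobj]
  rw [abs_le] at hdev hin hsq ⊢
  constructor <;> linarith [hdev.1, hdev.2, hin.1, hin.2, hsq.1, hsq.2]

/-! ### Tame linear images of outer products -/

/-- Linear images of tensors that ignore the diagonal and are controlled both on outer products
and entrywise in mean square. -/
structure IsTame {K : ℕ} {ι : Type*} [Fintype ι] (φ : Tensor K →ₗ[ℝ] EuclideanSpace ℝ ι) :
    Prop where
  outer : ∀ z : Fin K → Fin K → ℝ, ‖φ (outerSq z)‖ ≤ (∑ i, ∑ j, z i j ^ 2) / (K : ℝ) ^ 2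
  weight : ∃ q : Idx K → ℝ, (∀ v, 0 ≤ q v) ∧
    (∀ v : Idx K, (v.1, v.2.1) = (v.2.2.1, v.2.2.2) → q v = 0) ∧ ∑ v, q v ≤ 1 ∧
    ∀ M : Tensor K, ‖φ M‖ ^ 2 ≤ ∑ v, q v * M v.1 v.2.1 v.2.2.1 v.2.2.2 ^ 2

lemma sum_const_idx {K : ℕ} (r : ℝ) : ∑ _v : Idx K, r = (K : ℝ) ^ 4 * r := by
  simp only [Finset.sum_const, Finset.card_univ, Fintype.card_prod, Fintype.card_fin, nsmul_eq_mul]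
  push_cast
  ring

lemma isTame_starVec {K : ℕ} : IsTame (starVec (K := K)) where
  outer z := by
    rw [EuclideanSpace.norm_eq]
    refine Real.sqrt_le_iff.2 ⟨by positivity, ?_⟩
    have e : ((∑ i, ∑ j, z i j ^ 2) / (K : ℝ) ^ 2) ^ 2
        = ∑ v : Idx K, (outerSq z v.1 v.2.1 v.2.2.1 v.2.2.2 / (K : ℝ) ^ 2) ^ 2 := by
      simp only [Fintype.sum_prod_type, outerSq, div_pow, mul_pow, ← Finset.sum_div,
        ← Finset.mul_sum, ← Finset.sum_mul]
      ring
    rw [e]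
    refine Finset.sum_le_sum fun v _ => ?_
    rw [starVec_apply]
    split_ifs
    · rw [Real.norm_eq_abs, sq_abs]
    · rw [norm_zero, zero_pow two_ne_zero]
      exact sq_nonneg _
  weight := by
    refine ⟨fun v => if (v.1, v.2.1) ≠ (v.2.2.1, v.2.2.2) then 1 / (K : ℝ) ^ 4 else 0,
      fun v => by dsimp only; split_ifs <;> positivity, fun v hv => by simp [hv], ?_, fun M => ?_⟩
    · refine (Finset.sum_le_sum (g := fun _ => 1 / (K : ℝ) ^ 4) fun v _ => ?_).trans ?_
      · split_ifs
        · rfl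
        · positivity
      · rw [sum_const_idx, mul_one_div]
        exact div_self_le_one _
    · rw [EuclideanSpace.norm_eq, Real.sq_sqrt (Finset.sum_nonneg fun _ _ => sq_nonneg _)]
      refine Finset.sum_le_sum fun v _ => ?_
      rw [starVec_apply]
      dsimp only
      by_cases h : (v.1, v.2.1) ≠ (v.2.2.1, v.2.2.2)
      · rw [if_pos h, if_pos h, Real.norm_eq_abs, sq_abs]
        apply le_of_eq
        ring
      · rw [if_neg h, if_neg h]
        simp

lemma norm_trace₁Vec_sq {K : ℕ} (d : ℕ) (M : Tensor K) :
    ‖trace₁Vec d M‖ ^ 2 = ∑ i, ∑ k, (shiftSum d (fun j l => M i j k l)) ^ 2 / (K : ℝ) ^ 4 := by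
  rw [EuclideanSpace.norm_eq, Real.sq_sqrt (Finset.sum_nonneg fun _ _ => sq_nonneg _),
    Fintype.sum_prod_type]
  refine Finset.sum_congr rfl fun i _ => Finset.sum_congr rfl fun k _ => ?_
  rw [trace₁Vec_apply, Real.norm_eq_abs, sq_abs, dTrace₁_eq]
  ring

lemma norm_trace₂Vec_sq {K : ℕ} (d : ℕ) (M : Tensor K) :
    ‖trace₂Vec d M‖ ^ 2 = ∑ j, ∑ l, (shiftSum d (fun i k => M i j k l)) ^ 2 / (K : ℝ) ^ 4 := by
  rw [EuclideanSpace.norm_eq, Real.sq_sqrt (Finset.sum_nonneg fun _ _ => sq_nonneg _),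
    Fintype.sum_prod_type]
  refine Finset.sum_congr rfl fun i _ => Finset.sum_congr rfl fun k _ => ?_
  rw [trace₂Vec_apply, Real.norm_eq_abs, sq_abs, dTrace₂_eq]
  ring

lemma shiftSum_one_le {K : ℕ} (d : ℕ) (r : ℝ) (hr : 0 ≤ r) :
    (∑ j : Fin K, ∑ l : Fin K, if (l : ℕ) = j + d then r else 0) ≤ K * r :=
  shiftSum_const_le r hr

lemma mul_sum_four {K : ℕ} (f : Fin K → Fin K → Fin K → Fin K → ℝ) :
    ∑ v : Idx K, f v.1 v.2.1 v.2.2.1 v.2.2.2 = ∑ i, ∑ j, ∑ k, ∑ l, f i j k l := by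
  simp only [Fintype.sum_prod_type]

/-- The weights are `1 / K ^ 3` on the at most `K ^ 3` entries with `l = j + d`. A positive shift
keeps these entries off the diagonal. -/
lemma isTame_trace₁Vec {K : ℕ} {d : ℕ} (hd : 0 < d) : IsTame (trace₁Vec (K := K) d) where
  outer z := by
    refine abs_le_of_sq_le_sq' ?_ (by positivity) |>.2
    rw [norm_trace₁Vec_sq, div_pow, ← pow_mul]
    simp only [← Finset.sum_div]
    refine div_le_div_of_nonneg_right ?_ (by positivity)
    rw [sq (∑ i, ∑ j, z i j ^ 2), Finset.sum_mul_sum]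
    exact Finset.sum_le_sum fun i _ => Finset.sum_le_sum fun k _ =>
      shiftSum_mul_sq_le (fun j => z i j) (fun l => z k l)
  weight := by
    refine ⟨fun v => if (v.2.2.2 : ℕ) = v.2.1 + d then 1 / (K : ℝ) ^ 3 else 0,
      fun v => by dsimp only; split_ifs <;> positivity, fun v hv => ?_, ?_, fun M => ?_⟩
    · simp only [Prod.mk.injEq] at hv
      dsimp only
      rw [if_neg]
      rw [hv.2]
      omega
    · rw [mul_sum_four (fun i j k l => if (l : ℕ) = j + d then 1 / (K : ℝ) ^ 3 else 0)]
      have h : ∀ i : Fin K, ∑ j : Fin K, ∑ _k : Fin K, ∑ l : Fin K,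
          (if (l : ℕ) = j + d then 1 / (K : ℝ) ^ 3 else 0) ≤ K * (K * (1 / (K : ℝ) ^ 3)) := by
        intro i
        simp only [Finset.sum_const, Finset.card_univ, Fintype.card_fin, nsmul_eq_mul]
        rw [← Finset.mul_sum]
        exact mul_le_mul_of_nonneg_left (shiftSum_one_le d _ (by positivity)) (by positivity)
      refine (Finset.sum_le_sum fun i _ => h i).trans ?_
      simp only [Finset.sum_const, Finset.card_univ, Fintype.card_fin, nsmul_eq_mul]
      calc (K : ℝ) * (K * (K * (1 / (K : ℝ) ^ 3))) = (K : ℝ) ^ 3 / (K : ℝ) ^ 3 := by ring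
        _ ≤ 1 := div_self_le_one _
    · rw [norm_trace₁Vec_sq, mul_sum_four (fun i j k l =>
        (if (l : ℕ) = j + d then 1 / (K : ℝ) ^ 3 else 0) * M i j k l ^ 2)]
      refine Finset.sum_le_sum fun i _ => ?_
      rw [Finset.sum_comm]
      refine Finset.sum_le_sum fun k _ => ?_
      have h := shiftSum_sq_le (d := d) (fun j l => M i j k l)
      have hK : (0 : ℝ) < K := by have := i.pos; positivity
      calc shiftSum d (fun j l => M i j k l) ^ 2 / (K : ℝ) ^ 4
          ≤ K * shiftSum d (fun j l => M i j k l ^ 2) / (K : ℝ) ^ 4 := by gcongr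
        _ = (1 / (K : ℝ) ^ 3) * shiftSum d (fun j l => M i j k l ^ 2) := by field_simp
        _ = _ := by
          unfold shiftSum
          simp only [Finset.mul_sum]
          refine Finset.sum_congr rfl fun j _ => Finset.sum_congr rfl fun l _ => ?_
          split_ifs <;> simp

lemma isTame_trace₂Vec {K : ℕ} {d : ℕ} (hd : 0 < d) : IsTame (trace₂Vec (K := K) d) where
  outer z := by
    refine abs_le_of_sq_le_sq' ?_ (by positivity) |>.2
    rw [norm_trace₂Vec_sq, div_pow, ← pow_mul]
    simp only [← Finset.sum_div]
    refine div_le_div_of_nonneg_right ?_ (by positivity)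
    rw [Finset.sum_comm (f := fun i j => z i j ^ 2), sq (∑ j, ∑ i, z i j ^ 2), Finset.sum_mul_sum]
    exact Finset.sum_le_sum fun i _ => Finset.sum_le_sum fun k _ =>
      shiftSum_mul_sq_le (fun j => z j i) (fun l => z l k)
  weight := by
    refine ⟨fun v => if (v.2.2.1 : ℕ) = v.1 + d then 1 / (K : ℝ) ^ 3 else 0,
      fun v => by dsimp only; split_ifs <;> positivity, fun v hv => ?_, ?_, fun M => ?_⟩
    · simp only [Prod.mk.injEq] at hv
      dsimp only
      rw [if_neg]
      rw [hv.1]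
      omega
    · rw [mul_sum_four (fun i j k l => if (k : ℕ) = i + d then 1 / (K : ℝ) ^ 3 else 0)]
      simp only [Finset.sum_const, Finset.card_univ, Fintype.card_fin, nsmul_eq_mul]
      simp only [← Finset.mul_sum]
      calc (K : ℝ) * (K * ∑ i : Fin K, ∑ k : Fin K, if (k : ℕ) = i + d then 1 / (K : ℝ) ^ 3 else 0)
          ≤ (K : ℝ) * (K * (K * (1 / (K : ℝ) ^ 3))) := by
            gcongr
            exact shiftSum_one_le d _ (by positivity)
        _ = (K : ℝ) ^ 3 / (K : ℝ) ^ 3 := by ring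
        _ ≤ 1 := div_self_le_one _
    · rw [norm_trace₂Vec_sq, mul_sum_four (fun i j k l =>
        (if (k : ℕ) = i + d then 1 / (K : ℝ) ^ 3 else 0) * M i j k l ^ 2)]
      rw [Finset.sum_comm (s := (Finset.univ : Finset (Fin K))) (t := Finset.univ)
        (f := fun (i j : Fin K) => ∑ k : Fin K, ∑ l : Fin K,
        (if (k : ℕ) = i + d then 1 / (K : ℝ) ^ 3 else 0) * M i j k l ^ 2)]
      refine Finset.sum_le_sum fun j _ => ?_
      have e : ∑ i : Fin K, ∑ k : Fin K, ∑ l : Fin K,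
          (if (k : ℕ) = i + d then 1 / (K : ℝ) ^ 3 else 0) * M i j k l ^ 2
          = ∑ l : Fin K, ∑ i : Fin K, ∑ k : Fin K,
          (if (k : ℕ) = i + d then 1 / (K : ℝ) ^ 3 else 0) * M i j k l ^ 2 := by
        rw [Finset.sum_comm (s := (Finset.univ : Finset (Fin K))) (t := Finset.univ)
          (f := fun (l i : Fin K) => ∑ k : Fin K,
          (if (k : ℕ) = i + d then 1 / (K : ℝ) ^ 3 else 0) * M i j k l ^ 2)]
        exact Finset.sum_congr rfl fun i _ => Finset.sum_comm
      rw [e]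
      refine Finset.sum_le_sum fun l _ => ?_
      have h := shiftSum_sq_le (d := d) (fun i k => M i j k l)
      have hK : (0 : ℝ) < K := by have := j.pos; positivity
      calc shiftSum d (fun i k => M i j k l) ^ 2 / (K : ℝ) ^ 4
          ≤ K * shiftSum d (fun i k => M i j k l ^ 2) / (K : ℝ) ^ 4 := by gcongr
        _ = (1 / (K : ℝ) ^ 3) * shiftSum d (fun i k => M i j k l ^ 2) := by field_simp
        _ = _ := by
          unfold shiftSum
          simp only [Finset.mul_sum]
          refine Finset.sum_congr rfl fun j _ => Finset.sum_congr rfl fun l _ => ?_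
          split_ifs <;> simp

/-- The shifted trace is an iterated shifted sum, so Cauchy–Schwarz is applied once per coordinate;
the weights are `1 / K ^ 2` on at most `K ^ 2` entries. -/
lemma isTame_traceVec {K : ℕ} {d : ℕ} (hd : 0 < d) : IsTame (traceVec (K := K) d) where
  outer z := by
    rw [norm_traceVec, abs_div, abs_of_nonneg (by positivity : (0 : ℝ) ≤ (K : ℝ) ^ 2)]
    refine div_le_div_of_nonneg_right ?_ (by positivity)
    refine abs_le_of_sq_le_sq ?_ (by positivity)
    rw [dTrace_eq]
    have h1 : ∀ i k : Fin K, |shiftSum d (fun j l => outerSq z i j k l)|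
        ≤ Real.sqrt (∑ j, z i j ^ 2) * Real.sqrt (∑ j, z k j ^ 2) := by
      intro i k
      refine abs_le_of_sq_le_sq ?_ (by positivity)
      rw [mul_pow, Real.sq_sqrt (by positivity), Real.sq_sqrt (by positivity)]
      exact shiftSum_mul_sq_le (fun j => z i j) (fun l => z k l)
    have h2 : |shiftSum d (fun i k => shiftSum d (fun j l => outerSq z i j k l))|
        ≤ shiftSum d (fun i k => Real.sqrt (∑ j, z i j ^ 2) * Real.sqrt (∑ j, z k j ^ 2)) := by
      rw [abs_le]
      constructor
      · rw [neg_le, neg_eq_neg_one_mul, ← shiftSum_mul_left]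
        exact shiftSum_le fun i k _ => by linarith [(abs_le.1 (h1 i k)).1]
      · exact shiftSum_le fun i k _ => (abs_le.1 (h1 i k)).2
    have h3 := shiftSum_mul_sq_le (d := d) (fun i => Real.sqrt (∑ j, z i j ^ 2))
      (fun k => Real.sqrt (∑ j, z k j ^ 2))
    have h4 : ∀ i : Fin K, Real.sqrt (∑ j, z i j ^ 2) ^ 2 = ∑ j, z i j ^ 2 :=
      fun i => Real.sq_sqrt (by positivity)
    simp only [h4] at h3
    rw [← sq_abs]
    refine (pow_le_pow_left₀ (abs_nonneg _) h2 2).trans (h3.trans ?_)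
    rw [sq]
  weight := by
    refine ⟨fun v => if (v.2.2.1 : ℕ) = v.1 + d ∧ (v.2.2.2 : ℕ) = v.2.1 + d then 1 / (K : ℝ) ^ 2
      else 0, fun v => by dsimp only; split_ifs <;> positivity, fun v hv => ?_, ?_, fun M => ?_⟩
    · simp only [Prod.mk.injEq] at hv
      dsimp only
      rw [if_neg]
      rw [hv.1]
      omega
    · have e : ∑ v : Idx K, (if (v.2.2.1 : ℕ) = v.1 + d ∧ (v.2.2.2 : ℕ) = v.2.1 + d then
          1 / (K : ℝ) ^ 2 else 0) = dTrace (K := K) d (fun _ _ _ _ => 1 / (K : ℝ) ^ 2) := by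
        unfold dTrace
        rw [mul_sum_four (fun i j k l => if (k : ℕ) = i + d ∧ (l : ℕ) = j + d then
          1 / (K : ℝ) ^ 2 else 0)]
        exact Finset.sum_congr rfl fun i _ => Finset.sum_comm
      rw [e, dTrace_eq]
      have h0 : (0 : ℝ) ≤ 1 / (K : ℝ) ^ 2 := by positivity
      refine (shiftSum_le (g := fun _ _ => K * (1 / (K : ℝ) ^ 2)) fun i k _ =>
        shiftSum_const_le _ h0).trans ((shiftSum_const_le _ (by positivity)).trans ?_)
      calc (K : ℝ) * (K * (1 / (K : ℝ) ^ 2)) = (K : ℝ) ^ 2 / (K : ℝ) ^ 2 := by ring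
        _ ≤ 1 := div_self_le_one _
    · have e : ∑ v : Idx K, (if (v.2.2.1 : ℕ) = v.1 + d ∧ (v.2.2.2 : ℕ) = v.2.1 + d then
          1 / (K : ℝ) ^ 2 else 0) * M v.1 v.2.1 v.2.2.1 v.2.2.2 ^ 2
          = 1 / (K : ℝ) ^ 2 * dTrace (K := K) d (fun i j k l => M i j k l ^ 2) := by
        unfold dTrace
        rw [mul_sum_four (fun i j k l => (if (k : ℕ) = i + d ∧ (l : ℕ) = j + d then
          1 / (K : ℝ) ^ 2 else 0) * M i j k l ^ 2)]
        simp only [Finset.mul_sum]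
        refine Finset.sum_congr rfl fun i _ => ?_
        rw [Finset.sum_comm]
        refine Finset.sum_congr rfl fun k _ => Finset.sum_congr rfl fun j _ =>
          Finset.sum_congr rfl fun l _ => ?_
        split_ifs <;> simp
      rw [e, norm_traceVec, sq_abs, div_pow, dTrace_eq, dTrace_eq]
      have h1 := shiftSum_sq_le (d := d) (fun i k => shiftSum d (fun j l => M i j k l))
      have h2 : shiftSum d (fun i k => shiftSum d (fun j l => M i j k l) ^ 2)
          ≤ K * shiftSum d (fun i k => shiftSum d (fun j l => M i j k l ^ 2)) := by
        rw [← shiftSum_mul_left]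
        exact shiftSum_le fun i k _ => shiftSum_sq_le _
      rcases Nat.eq_zero_or_pos K with rfl | hK
      · simp [shiftSum]
      have hK' : (0 : ℝ) < K := by exact_mod_cast hK
      rw [div_le_iff₀ (by positivity)]
      calc _ ≤ _ := h1
        _ ≤ K * (K * shiftSum d (fun i k => shiftSum d (fun j l => M i j k l ^ 2))) := by gcongr
        _ = _ := by field_simp

/-- The tensor with a single nonzero entry, equal to one. -/
def unitTensor {K : ℕ} (v : Idx K) : Tensor K := fun i j k l => if v = (i, j, k, l) then 1 else 0

lemma tensor_eq_sum {K : ℕ} (M : Tensor K) :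
    M = ∑ v : Idx K, M v.1 v.2.1 v.2.2.1 v.2.2.2 • unitTensor v := by
  ext i j k l
  simp only [Finset.sum_apply, Pi.smul_apply, unitTensor, smul_eq_mul, mul_ite, mul_one, mul_zero]
  rw [Finset.sum_ite_eq']
  simp

lemma apply_eq_sum {K : ℕ} {ι : Type*} [Fintype ι] (φ : Tensor K →ₗ[ℝ] EuclideanSpace ℝ ι)
    (M : Tensor K) (a : ι) :
    φ M a = ∑ v : Idx K, M v.1 v.2.1 v.2.2.1 v.2.2.2 * φ (unitTensor v) a := by
  conv_lhs => rw [tensor_eq_sum M]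
  simp only [map_sum, map_smul, WithLp.ofLp_sum, WithLp.ofLp_smul, Finset.sum_apply, Pi.smul_apply,
    smul_eq_mul]

lemma apply_outerSq_eq_sum {K : ℕ} {ι : Type*} [Fintype ι]
    (φ : Tensor K →ₗ[ℝ] EuclideanSpace ℝ ι) (z : Fin K → Fin K → ℝ) (a : ι) :
    φ (outerSq z) a
      = ∑ v : Idx K, z v.1 v.2.1 * z v.2.2.1 v.2.2.2 * φ (unitTensor v) a :=
  apply_eq_sum φ (outerSq z) a

lemma norm_sq_eq_sum {ι : Type*} [Fintype ι] (u : EuclideanSpace ℝ ι) :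
    ‖u‖ ^ 2 = ∑ a, (u a) ^ 2 := by
  rw [EuclideanSpace.norm_eq, Real.sq_sqrt (Finset.sum_nonneg fun _ _ => sq_nonneg _)]
  simp [sq_abs]

/-- The weights vanish on the diagonal. For this reason only products of distinct entries need
second moments, and no fourth moment of a single error is required. -/
lemma IsTame.unitTensor_eq_zero {K : ℕ} {ι : Type*} [Fintype ι]
    {φ : Tensor K →ₗ[ℝ] EuclideanSpace ℝ ι} (h : IsTame φ) {v : Idx K}
    (hv : (v.1, v.2.1) = (v.2.2.1, v.2.2.2)) : φ (unitTensor v) = 0 := by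
  obtain ⟨q, -, hq, -, hφ⟩ := h.weight
  have h1 := hφ (unitTensor v)
  rw [Finset.sum_eq_zero] at h1
  · exact norm_eq_zero.1 (pow_eq_zero_iff two_ne_zero |>.1 (le_antisymm h1 (sq_nonneg _)))
  · intro w _
    by_cases hw : v = w
    · rw [← hw, hq v hv, zero_mul]
    · have : unitTensor v w.1 w.2.1 w.2.2.1 w.2.2.2 = 0 := if_neg hw
      rw [this]; simp

/-! ### Mean-square error of the empirical covariance -/

section Moments

variable {Ω : Type*} [MeasurableSpace Ω] {μ : Measure Ω}

lemma integral_sq_mean_sub_le [IsProbabilityMeasure μ] {Y : ℕ → Ω → ℝ} {m v : ℝ} {N : ℕ} (hN : 0 < N)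
    (hL : ∀ n, MemLp (Y n) 2 μ) (hind : Pairwise fun i j => IndepFun (Y i) (Y j) μ)
    (hm : ∀ n, ∫ ω, Y n ω ∂μ = m) (hv : ∀ n, ∫ ω, (Y n ω) ^ 2 ∂μ ≤ v) :
    ∫ ω, ((N : ℝ)⁻¹ * ∑ n ∈ Finset.range N, Y n ω - m) ^ 2 ∂μ ≤ v / N := by
  have hS : MemLp (∑ n ∈ Finset.range N, Y n) 2 μ := memLp_finsetSum' _ fun n _ => hL n
  have hN' : (N : ℝ) ≠ 0 := by positivity
  have hES : ∫ ω, (∑ n ∈ Finset.range N, Y n) ω ∂μ = N * m := by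
    simp only [Finset.sum_apply]
    rw [integral_finsetSum _ fun n _ => (hL n).integrable one_le_two]
    simp [hm]
  have hVar : Var[∑ n ∈ Finset.range N, Y n; μ] ≤ N * v := by
    rw [IndepFun.variance_sum (fun n _ => hL n) fun i _ j _ hij => hind hij]
    calc ∑ n ∈ Finset.range N, Var[Y n; μ] ≤ ∑ n ∈ Finset.range N, v :=
          Finset.sum_le_sum fun n _ =>
            (variance_le_expectation_sq (hL n).aestronglyMeasurable).trans (hv n)
      _ = N * v := by simp
  rw [variance_eq_integral hS.aemeasurable, hES] at hVar
  have e : ∀ ω, ((N : ℝ)⁻¹ * ∑ n ∈ Finset.range N, Y n ω - m) ^ 2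
      = ((N : ℝ) ^ 2)⁻¹ * ((∑ n ∈ Finset.range N, Y n) ω - N * m) ^ 2 := by
    intro ω
    rw [Finset.sum_apply]
    field_simp
  simp only [e]
  rw [integral_const_mul]
  calc ((N : ℝ) ^ 2)⁻¹ * ∫ ω, ((∑ n ∈ Finset.range N, Y n) ω - N * m) ^ 2 ∂μ
      ≤ ((N : ℝ) ^ 2)⁻¹ * (N * v) := by gcongr
    _ = v / N := by field_simp

variable {K : ℕ} {ι : Type*} [Fintype ι] {φ : Tensor K →ₗ[ℝ] EuclideanSpace ℝ ι}

lemma measurable_apply_outerSq (φ : Tensor K →ₗ[ℝ] EuclideanSpace ℝ ι) (a : ι) :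
    Measurable fun z : Fin K → Fin K → ℝ => φ (outerSq z) a := by
  simp only [apply_outerSq_eq_sum φ _ a]
  fun_prop

lemma memLp_apply_outerSq (hφ : IsTame φ) {Z : Ω → Fin K → Fin K → ℝ}
    (hZ : ∀ i j k l, (i, j) ≠ (k, l) → MemLp (fun ω => Z ω i j * Z ω k l) 2 μ) (a : ι) :
    MemLp (fun ω => φ (outerSq (Z ω)) a) 2 μ := by
  simp only [apply_outerSq_eq_sum φ _ a]
  refine memLp_finsetSum _ fun v _ => ?_
  by_cases hv : (v.1, v.2.1) = (v.2.2.1, v.2.2.2)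
  · simp [hφ.unitTensor_eq_zero hv]
  · exact (hZ _ _ _ _ hv).mul_const _

lemma integral_apply_outerSq [IsProbabilityMeasure μ] (hφ : IsTame φ) {Z : Ω → Fin K → Fin K → ℝ} {M₀ : Tensor K}
    (hZ : ∀ i j k l, (i, j) ≠ (k, l) → MemLp (fun ω => Z ω i j * Z ω k l) 2 μ)
    (hM : ∀ i j k l, (i, j) ≠ (k, l) → ∫ ω, Z ω i j * Z ω k l ∂μ = M₀ i j k l) (a : ι) :
    ∫ ω, φ (outerSq (Z ω)) a ∂μ = φ M₀ a := by
  rw [apply_eq_sum φ M₀ a]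
  simp only [apply_outerSq_eq_sum φ _ a]
  rw [integral_finsetSum]
  · refine Finset.sum_congr rfl fun v _ => ?_
    by_cases hv : (v.1, v.2.1) = (v.2.2.1, v.2.2.2)
    · simp [hφ.unitTensor_eq_zero hv]
    · rw [integral_mul_const, hM _ _ _ _ hv]
  · intro v _
    by_cases hv : (v.1, v.2.1) = (v.2.2.1, v.2.2.2)
    · simp [hφ.unitTensor_eq_zero hv]
    · exact ((hZ _ _ _ _ hv).integrable one_le_two).mul_const _

lemma integrable_norm_sq_of_memLp {V : Ω → EuclideanSpace ℝ ι}
    (h : ∀ a, MemLp (fun ω => V ω a) 2 μ) : Integrable (fun ω => ‖V ω‖ ^ 2) μ := by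
  simp only [norm_sq_eq_sum]
  exact integrable_finsetSum _ fun a _ => (h a).integrable_sq

lemma integral_norm_sq_eq_sum {V : Ω → EuclideanSpace ℝ ι}
    (h : ∀ a, MemLp (fun ω => V ω a) 2 μ) :
    ∫ ω, ‖V ω‖ ^ 2 ∂μ = ∑ a, ∫ ω, (V ω a) ^ 2 ∂μ := by
  simp only [norm_sq_eq_sum]
  exact integral_finsetSum _ fun a _ => (h a).integrable_sq

/-- Square integrability off the diagonal and the mean of the outer product of an array. -/
structure HasOuterMean (μ : Measure Ω) (Z : Ω → Fin K → Fin K → ℝ) (M₀ : Tensor K) : Prop where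
  memLp : ∀ i j k l, (i, j) ≠ (k, l) → MemLp (fun ω => Z ω i j * Z ω k l) 2 μ
  mean : ∀ i j k l, (i, j) ≠ (k, l) → ∫ ω, Z ω i j * Z ω k l ∂μ = M₀ i j k l

lemma HasOuterMean.of_identDistrib {Z Z' : Ω → Fin K → Fin K → ℝ} {M₀ : Tensor K}
    (h : HasOuterMean μ Z M₀) (hid : IdentDistrib Z' Z μ μ) : HasOuterMean μ Z' M₀ where
  memLp i j k l hne := by
    have := hid.comp (u := fun z : Fin K → Fin K → ℝ => z i j * z k l) (by fun_prop)
    exact this.memLp_iff.2 (h.memLp i j k l hne)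
  mean i j k l hne := by
    have := hid.comp (u := fun z : Fin K → Fin K → ℝ => z i j * z k l) (by fun_prop)
    rw [← h.mean i j k l hne]
    exact this.integral_eq

lemma integral_norm_sq_outerSq_eq {Z Z' : Ω → Fin K → Fin K → ℝ} (hid : IdentDistrib Z' Z μ μ) :
    ∫ ω, ‖φ (outerSq (Z' ω))‖ ^ 2 ∂μ = ∫ ω, ‖φ (outerSq (Z ω))‖ ^ 2 ∂μ := by
  have hm : Measurable fun z : Fin K → Fin K → ℝ => ‖φ (outerSq z)‖ ^ 2 := by
    simp only [norm_sq_eq_sum]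
    exact Finset.measurable_sum _ fun a _ => (measurable_apply_outerSq φ a).pow_const 2
  exact (hid.comp hm).integral_eq

/-- The variance bound is applied coordinate by coordinate, and the second moments of the
coordinates add up to that of the norm of a single outer product. The dimension therefore never
enters, which is where uniformity in `K` comes from. -/
lemma integral_norm_sq_empCov_sub_le [IsProbabilityMeasure μ] (hφ : IsTame φ) {Z : ℕ → Ω → Fin K → Fin K → ℝ}
    {M₀ : Tensor K} {V : ℝ} (hind : iIndepFun Z μ) (hid : ∀ n, IdentDistrib (Z n) (Z 0) μ μ)
    (h0 : HasOuterMean μ (Z 0) M₀) (hV : ∫ ω, ‖φ (outerSq (Z 0 ω))‖ ^ 2 ∂μ ≤ V)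
    {N : ℕ} (hN : 0 < N) :
    Integrable (fun ω => ‖φ (empCov (fun n => Z n ω) (Finset.range N) - M₀)‖ ^ 2) μ ∧
    ∫ ω, ‖φ (empCov (fun n => Z n ω) (Finset.range N) - M₀)‖ ^ 2 ∂μ ≤ V / N := by
  have hn : ∀ n, HasOuterMean μ (Z n) M₀ := fun n => h0.of_identDistrib (hid n)
  have e : ∀ ω a, φ (empCov (fun n => Z n ω) (Finset.range N) - M₀) a
      = (N : ℝ)⁻¹ * ∑ n ∈ Finset.range N, φ (outerSq (Z n ω)) a - φ M₀ a := by
    intro ω a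
    rw [empCov_eq, map_sub, map_smul, map_sum, Finset.card_range]
    simp only [PiLp.sub_apply, PiLp.smul_apply, WithLp.ofLp_sum, Finset.sum_apply, smul_eq_mul]
  have hL : ∀ n a, MemLp (fun ω => φ (outerSq (Z n ω)) a) 2 μ := fun n a =>
    memLp_apply_outerSq hφ (hn n).memLp a
  have hmem : ∀ a, MemLp (fun ω => φ (empCov (fun n => Z n ω) (Finset.range N) - M₀) a) 2 μ := by
    intro a
    simp only [e]
    exact ((memLp_finsetSum _ fun n _ => hL n a).const_mul _).sub (memLp_const _)
  refine ⟨integrable_norm_sq_of_memLp hmem, ?_⟩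
  rw [integral_norm_sq_eq_sum hmem]
  have hV' : (∑ a, ∫ ω, (φ (outerSq (Z 0 ω)) a) ^ 2 ∂μ) / N ≤ V / N := by
    rw [← integral_norm_sq_eq_sum (hL 0)]
    gcongr
  refine le_trans ?_ hV'
  rw [Finset.sum_div]
  refine Finset.sum_le_sum fun a _ => ?_
  simp only [e]
  have hg := measurable_apply_outerSq φ a
  refine integral_sq_mean_sub_le hN (fun n => hL n a) (fun i j hij => ?_)
    (fun n => integral_apply_outerSq hφ (hn n).memLp (hn n).mean a) (fun n => le_of_eq ?_)
  · exact (hind.indepFun hij).comp hg hg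
  · exact ((hid n).comp (hg.pow_const 2)).integral_eq

end Moments

/-! ### Moment bounds for signal plus measurement error -/

section Noise

variable {Ω : Type*} [MeasurableSpace Ω] {μ : Measure Ω} {K : ℕ}

/-- Moment conditions on a sampled surface. -/
structure HasSignalMoments (μ : Measure Ω) (x : Ω → Fin K → Fin K → ℝ) (M₀ : Tensor K)
    (B m : ℝ) : Prop where
  memLp : ∀ i j, MemLp (fun ω => x ω i j) 4 μ
  mean : ∀ i j k l, ∫ ω, x ω i j * x ω k l ∂μ = M₀ i j k l
  diag_le : ∀ i j, M₀ i j i j ≤ B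
  four : ∫ ω, ((∑ i, ∑ j, x ω i j ^ 2) / (K : ℝ) ^ 2) ^ 2 ∂μ ≤ m

lemma memLp_sq_of_memLp_four {f : Ω → ℝ} (hf : MemLp f 4 μ) : MemLp (fun ω => f ω ^ 2) 2 μ := by
  refine (memLp_two_iff_integrable_sq (hf.aestronglyMeasurable.pow 2)).2 ?_
  have h : Integrable (fun ω => ‖f ω‖ ^ 4) μ := hf.integrable_norm_pow (p := 4) (by norm_num)
  refine h.congr (Filter.Eventually.of_forall fun ω => ?_)
  simp only [Real.norm_eq_abs, Pi.pow_apply]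
  rw [← pow_mul, Even.pow_abs ⟨2, rfl⟩]

lemma memLp_mul_of_memLp_four {f g : Ω → ℝ} (hf : MemLp f 4 μ) (hg : MemLp g 4 μ) :
    MemLp (fun ω => f ω * g ω) 2 μ := by
  refine ((memLp_sq_of_memLp_four hf).add (memLp_sq_of_memLp_four hg)).mono
    (hf.aestronglyMeasurable.mul hg.aestronglyMeasurable)
    (Filter.Eventually.of_forall fun ω => ?_)
  simp only [Pi.add_apply, Real.norm_eq_abs]
  rw [abs_of_nonneg (a := f ω ^ 2 + g ω ^ 2) (by positivity), abs_le]
  constructor <;> nlinarith [sq_nonneg (f ω + g ω), sq_nonneg (f ω - g ω)]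

variable {σ B m : ℝ} {x e : Ω → Fin K → Fin K → ℝ} {M₀ : Tensor K}

lemma HasSignalMoments.memLp_mul (hx : HasSignalMoments μ x M₀ B m) (i j k l : Fin K) :
    MemLp (fun ω => x ω i j * x ω k l) 2 μ :=
  memLp_mul_of_memLp_four (hx.memLp i j) (hx.memLp k l)

/-- The square of the product is a mixed moment with repeated indices. -/
lemma IsNoise.memLp_mul_signal (he : IsNoise μ σ x e) (hx : HasSignalMoments μ x M₀ B m)
    (i j k l : Fin K) : MemLp (fun ω => e ω i j * x ω k l) 2 μ := by
  refine (memLp_two_iff_integrable_sq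
    ((he.memLp i j).aestronglyMeasurable.mul (hx.memLp k l).aestronglyMeasurable)).2 ?_
  refine (he.mixed_integrable i j i j k l k l).congr (Filter.Eventually.of_forall fun ω => ?_)
  simp only [Pi.mul_apply]
  ring

lemma IsNoise.integral_mul_signal_sq_le (he : IsNoise μ σ x e)
    (hx : HasSignalMoments μ x M₀ B m) (i j k l : Fin K) :
    ∫ ω, (e ω i j * x ω k l) ^ 2 ∂μ ≤ σ ^ 2 * B := by
  have h := he.mixed i j i j k l k l
  have e1 : ∀ ω, (e ω i j * x ω k l) ^ 2 = e ω i j * e ω i j * x ω k l * x ω k l := fun ω => by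
    ring
  simp only [e1]
  rw [h, hx.mean]
  have h1 := he.var_le i j
  simp only [sq (e _ i j)] at h1
  refine mul_le_mul h1 (hx.diag_le k l) ?_ (sq_nonneg _)
  rw [← hx.mean]
  exact integral_nonneg fun ω => mul_self_nonneg _

lemma IsNoise.memLp_mul (he : IsNoise μ σ x e) {i j k l : Fin K} (hne : (i, j) ≠ (k, l)) :
    MemLp (fun ω => e ω i j * e ω k l) 2 μ := by
  refine (memLp_two_iff_integrable_sq
    ((he.memLp i j).aestronglyMeasurable.mul (he.memLp k l).aestronglyMeasurable)).2 ?_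
  refine (he.fourth_integrable i j k l hne).congr (Filter.Eventually.of_forall fun ω => ?_)
  simp only [Pi.mul_apply]
  ring

/-- Off the diagonal, both cross terms and the product of errors have mean zero, so the noise leaves
the mean unchanged there. -/
lemma hasOuterMean_add [IsProbabilityMeasure μ] (he : IsNoise μ σ x e)
    (hx : HasSignalMoments μ x M₀ B m) : HasOuterMean μ (fun ω => x ω + e ω) M₀ := by
  have e1 : ∀ i j k l ω, (x ω + e ω) i j * (x ω + e ω) k l
      = x ω i j * x ω k l + (e ω k l * x ω i j + e ω i j * x ω k l + e ω i j * e ω k l) := by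
    intro i j k l ω
    simp only [Pi.add_apply]
    ring
  constructor
  · intro i j k l hne
    simp only [e1]
    exact (hx.memLp_mul i j k l).add (((he.memLp_mul_signal hx k l i j).add
      (he.memLp_mul_signal hx i j k l)).add (he.memLp_mul hne))
  · intro i j k l hne
    simp only [e1]
    have h1 := (hx.memLp_mul i j k l).integrable one_le_two
    have h2 := (he.memLp_mul_signal hx k l i j).integrable one_le_two
    have h3 := (he.memLp_mul_signal hx i j k l).integrable one_le_two
    have h4 := (he.memLp_mul hne).integrable one_le_two
    have h23 : Integrable (fun ω => e ω k l * x ω i j + e ω i j * x ω k l) μ := h2.add h3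
    have h234 : Integrable (fun ω => e ω k l * x ω i j + e ω i j * x ω k l
      + e ω i j * e ω k l) μ := h23.add h4
    rw [integral_add h1 h234, integral_add h23 h4, integral_add h2 h3,
      he.uncorrelated_signal, he.uncorrelated_signal, he.uncorrelated i j k l hne, hx.mean]
    ring

/-- The two halves of `IsTame` serve different terms. The pure signal is bounded through its total
energy, because `HasSignalMoments` gives no entrywise fourth-moment bound. All terms with noise are
bounded entrywise through the weights, because only products of distinct errors have controlled
second moments. -/
lemma integral_norm_sq_outerSq_le [IsProbabilityMeasure μ] {ι : Type*} [Fintype ι]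
    {φ : Tensor K →ₗ[ℝ] EuclideanSpace ℝ ι} (hφ : IsTame φ) (he : IsNoise μ σ x e)
    (hx : HasSignalMoments μ x M₀ B m) (hB : 0 ≤ B) :
    ∫ ω, ‖φ (outerSq (x ω + e ω))‖ ^ 2 ∂μ ≤ 2 * m + 2 * (3 * (2 * (σ ^ 2 * B) + σ ^ 4)) := by
  obtain ⟨q, hq0, hqd, hq1, hq⟩ := hφ.weight
  set w : Ω → Tensor K := fun ω => outerSq (x ω + e ω) - outerSq (x ω) with hw
  have hwe : ∀ ω i j k l, w ω i j k l
      = e ω k l * x ω i j + e ω i j * x ω k l + e ω i j * e ω k l := by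
    intro ω i j k l
    simp only [hw, Pi.sub_apply, outerSq, Pi.add_apply]
    ring
  have hwL : ∀ i j k l, (i, j) ≠ (k, l) → MemLp (fun ω => w ω i j k l) 2 μ := by
    intro i j k l hne
    simp only [hwe]
    exact ((he.memLp_mul_signal hx k l i j).add
      (he.memLp_mul_signal hx i j k l)).add (he.memLp_mul hne)
  have hwI : ∀ i j k l, (i, j) ≠ (k, l) → ∫ ω, w ω i j k l ^ 2 ∂μ
      ≤ 3 * (2 * (σ ^ 2 * B) + σ ^ 4) := by
    intro i j k l hne
    have i1 := (he.memLp_mul_signal hx k l i j).integrable_sq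
    have i2 := (he.memLp_mul_signal hx i j k l).integrable_sq
    have i3 := (he.memLp_mul hne).integrable_sq
    have b1 := he.integral_mul_signal_sq_le hx k l i j
    have b2 := he.integral_mul_signal_sq_le hx i j k l
    have b3 := he.fourth_le i j k l hne
    simp only [← mul_pow] at b3
    calc ∫ ω, w ω i j k l ^ 2 ∂μ
        ≤ ∫ ω, 3 * ((e ω k l * x ω i j) ^ 2 + (e ω i j * x ω k l) ^ 2
            + (e ω i j * e ω k l) ^ 2) ∂μ := by
          refine integral_mono (hwL i j k l hne).integrable_sq
            (((i1.add i2).add i3).const_mul 3) fun ω => ?_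
          simp only [hwe]
          nlinarith [sq_nonneg (e ω k l * x ω i j - e ω i j * x ω k l),
            sq_nonneg (e ω k l * x ω i j - e ω i j * e ω k l),
            sq_nonneg (e ω i j * x ω k l - e ω i j * e ω k l)]
      _ ≤ _ := by
          have i12 : Integrable (fun ω => (e ω k l * x ω i j) ^ 2 + (e ω i j * x ω k l) ^ 2) μ :=
            i1.add i2
          rw [integral_const_mul, integral_add i12 i3, integral_add i1 i2]
          linarith
  have hSI : Integrable (fun ω => ((∑ i, ∑ j, x ω i j ^ 2) / (K : ℝ) ^ 2) ^ 2) μ := by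
    refine MemLp.integrable_sq ?_
    simp only [div_eq_mul_inv]
    exact (memLp_finsetSum _ fun i _ => memLp_finsetSum _ fun j _ =>
      memLp_sq_of_memLp_four (hx.memLp i j)).mul_const _
  have hqI : ∀ v : Idx K, Integrable (fun ω => q v * w ω v.1 v.2.1 v.2.2.1 v.2.2.2 ^ 2) μ := by
    intro v
    by_cases hv : (v.1, v.2.1) = (v.2.2.1, v.2.2.2)
    · simp [hqd v hv]
    · exact (hwL _ _ _ _ hv).integrable_sq.const_mul _
  have hqint : ∀ v : Idx K, ∫ ω, q v * w ω v.1 v.2.1 v.2.2.1 v.2.2.2 ^ 2 ∂μ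
      ≤ q v * (3 * (2 * (σ ^ 2 * B) + σ ^ 4)) := by
    intro v
    by_cases hv : (v.1, v.2.1) = (v.2.2.1, v.2.2.2)
    · simp [hqd v hv]
    · rw [integral_const_mul]
      exact mul_le_mul_of_nonneg_left (hwI _ _ _ _ hv) (hq0 v)
  have hmain := integrable_norm_sq_of_memLp fun a =>
    memLp_apply_outerSq (Z := fun ω => x ω + e ω) hφ (hasOuterMean_add he hx).memLp a
  have hsum : Integrable (fun ω => ∑ v : Idx K, q v * w ω v.1 v.2.1 v.2.2.1 v.2.2.2 ^ 2) μ :=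
    integrable_finsetSum _ fun v _ => hqI v
  calc ∫ ω, ‖φ (outerSq (x ω + e ω))‖ ^ 2 ∂μ
      ≤ ∫ ω, (2 * ((∑ i, ∑ j, x ω i j ^ 2) / (K : ℝ) ^ 2) ^ 2
          + 2 * ∑ v : Idx K, q v * w ω v.1 v.2.1 v.2.2.1 v.2.2.2 ^ 2) ∂μ := by
        refine integral_mono hmain ((hSI.const_mul 2).add (hsum.const_mul 2)) fun ω => ?_
        have h1 : outerSq (x ω + e ω) = outerSq (x ω) + w ω := by simp [hw]
        simp only [h1, map_add]
        have h2 := norm_add_le (φ (outerSq (x ω))) (φ (w ω))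
        have h3 := hφ.outer (x ω)
        have h4 := hq (w ω)
        have h5 : ‖φ (outerSq (x ω))‖ ^ 2 ≤ ((∑ i, ∑ j, x ω i j ^ 2) / (K : ℝ) ^ 2) ^ 2 :=
          pow_le_pow_left₀ (norm_nonneg _) h3 2
        have h6 := pow_le_pow_left₀ (norm_nonneg _) h2 2
        nlinarith [sq_nonneg (‖φ (outerSq (x ω))‖ - ‖φ (w ω)‖)]
    _ = 2 * ∫ ω, ((∑ i, ∑ j, x ω i j ^ 2) / (K : ℝ) ^ 2) ^ 2 ∂μ
          + 2 * ∑ v : Idx K, ∫ ω, q v * w ω v.1 v.2.1 v.2.2.1 v.2.2.2 ^ 2 ∂μ := by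
        rw [integral_add (hSI.const_mul 2) (hsum.const_mul 2), integral_const_mul,
          integral_const_mul, integral_finsetSum _ fun v _ => hqI v]
    _ ≤ _ := by
        have h1 : ∑ v : Idx K, ∫ ω, q v * w ω v.1 v.2.1 v.2.2.1 v.2.2.2 ^ 2 ∂μ
            ≤ 3 * (2 * (σ ^ 2 * B) + σ ^ 4) := by
          refine (Finset.sum_le_sum fun v _ => hqint v).trans ?_
          rw [← Finset.sum_mul]
          refine mul_le_of_le_one_left (by positivity) hq1
        have := hx.four
        linarith

end Noise

/-! ### Probability of a typical sample -/

/-- A quadratic upper bound of the square of `bandSeminorm`. -/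
noncomputable def bandSq {K : ℕ} (d : ℕ) (M : Tensor K) : ℝ :=
  4 * (‖starVec M‖ ^ 2 + ‖trace₁Vec d M‖ ^ 2 + ‖trace₂Vec d M‖ ^ 2 + ‖traceVec d M‖ ^ 2)

lemma bandSeminorm_sq_le {K : ℕ} (d : ℕ) (M : Tensor K) : bandSeminorm d M ^ 2 ≤ bandSq d M := by
  rw [bandSeminorm_apply, bandSq]
  set a := ‖starVec M‖
  set b := ‖trace₁Vec d M‖
  set c := ‖trace₂Vec d M‖
  set e := ‖traceVec d M‖
  nlinarith [sq_nonneg (a - b), sq_nonneg (a - c), sq_nonneg (a - e), sq_nonneg (b - c),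
    sq_nonneg (b - e), sq_nonneg (c - e)]

lemma bandSq_nonneg {K : ℕ} (d : ℕ) (M : Tensor K) : 0 ≤ bandSq d M := by
  unfold bandSq; positivity

section Selection

variable {Ω : Type*} [MeasurableSpace Ω] {μ : Measure Ω}

lemma integral_four_add {f₁ f₂ f₃ f₄ : Ω → ℝ} (h₁ : Integrable f₁ μ) (h₂ : Integrable f₂ μ)
    (h₃ : Integrable f₃ μ) (h₄ : Integrable f₄ μ) :
    Integrable (fun ω => 4 * (f₁ ω + f₂ ω + f₃ ω + f₄ ω)) μ ∧
    ∫ ω, 4 * (f₁ ω + f₂ ω + f₃ ω + f₄ ω) ∂μ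
      = 4 * (∫ ω, f₁ ω ∂μ + ∫ ω, f₂ ω ∂μ + ∫ ω, f₃ ω ∂μ + ∫ ω, f₄ ω ∂μ) := by
  have h12 : Integrable (fun ω => f₁ ω + f₂ ω) μ := h₁.add h₂
  have h123 : Integrable (fun ω => f₁ ω + f₂ ω + f₃ ω) μ := h12.add h₃
  refine ⟨(h123.add h₄).const_mul 4, ?_⟩
  rw [integral_const_mul, integral_add h123 h₄, integral_add h12 h₃, integral_add h₁ h₂]

variable {K : ℕ}

/-- The distributional assumptions on the sample of noisy arrays that the estimators see. -/
structure IsSample (μ : Measure Ω) (Z : ℕ → Ω → Fin K → Fin K → ℝ) (M₀ : Tensor K) (V : ℝ) :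
    Prop where
  indep : iIndepFun Z μ
  ident : ∀ n, IdentDistrib (Z n) (Z 0) μ μ
  mean : HasOuterMean μ (Z 0) M₀
  star_le : ∫ ω, ‖starVec (outerSq (Z 0 ω))‖ ^ 2 ∂μ ≤ V
  trace₁_le : ∀ d, 0 < d → ∫ ω, ‖trace₁Vec d (outerSq (Z 0 ω))‖ ^ 2 ∂μ ≤ V
  trace₂_le : ∀ d, 0 < d → ∫ ω, ‖trace₂Vec d (outerSq (Z 0 ω))‖ ^ 2 ∂μ ≤ V
  trace_le : ∀ d, 0 < d → ∫ ω, ‖traceVec d (outerSq (Z 0 ω))‖ ^ 2 ∂μ ≤ V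

variable {Z : ℕ → Ω → Fin K → Fin K → ℝ} {M₀ : Tensor K} {V : ℝ}

lemma IsSample.bandSq_outerSq (h : IsSample μ Z M₀ V) {d : ℕ} (hd : 0 < d) (n : ℕ) :
    Integrable (fun ω => bandSq d (outerSq (Z n ω))) μ ∧
      ∫ ω, bandSq d (outerSq (Z n ω)) ∂μ ≤ 16 * V := by
  have hn := h.mean.of_identDistrib (h.ident n)
  have h1 := integrable_norm_sq_of_memLp fun a => memLp_apply_outerSq isTame_starVec hn.memLp a
  have h2 := integrable_norm_sq_of_memLp fun a =>
    memLp_apply_outerSq (isTame_trace₁Vec hd) hn.memLp a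
  have h3 := integrable_norm_sq_of_memLp fun a =>
    memLp_apply_outerSq (isTame_trace₂Vec hd) hn.memLp a
  have h4 := integrable_norm_sq_of_memLp fun a =>
    memLp_apply_outerSq (isTame_traceVec hd) hn.memLp a
  obtain ⟨hi, he⟩ := integral_four_add h1 h2 h3 h4
  refine ⟨hi, ?_⟩
  simp only [bandSq]
  rw [he, integral_norm_sq_outerSq_eq (h.ident n), integral_norm_sq_outerSq_eq (h.ident n),
    integral_norm_sq_outerSq_eq (h.ident n), integral_norm_sq_outerSq_eq (h.ident n)]
  linarith [h.star_le, h.trace₁_le d hd, h.trace₂_le d hd, h.trace_le d hd]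

variable [IsProbabilityMeasure μ]

lemma IsSample.bandSq_empCov_sub (h : IsSample μ Z M₀ V) {d : ℕ} (hd : 0 < d) {N : ℕ}
    (hN : 0 < N) :
    Integrable (fun ω => bandSq d (empCov (fun n => Z n ω) (Finset.range N) - M₀)) μ ∧
      ∫ ω, bandSq d (empCov (fun n => Z n ω) (Finset.range N) - M₀) ∂μ ≤ 16 * V / N := by
  obtain ⟨i1, b1⟩ := integral_norm_sq_empCov_sub_le isTame_starVec h.indep h.ident h.mean
    h.star_le hN
  obtain ⟨i2, b2⟩ := integral_norm_sq_empCov_sub_le (isTame_trace₁Vec hd) h.indep h.ident h.mean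
    (h.trace₁_le d hd) hN
  obtain ⟨i3, b3⟩ := integral_norm_sq_empCov_sub_le (isTame_trace₂Vec hd) h.indep h.ident h.mean
    (h.trace₂_le d hd) hN
  obtain ⟨i4, b4⟩ := integral_norm_sq_empCov_sub_le (isTame_traceVec hd) h.indep h.ident h.mean
    (h.trace_le d hd) hN
  obtain ⟨hi, he⟩ := integral_four_add i1 i2 i3 i4
  refine ⟨hi, ?_⟩
  simp only [bandSq]
  rw [he, mul_div_assoc]
  linarith

lemma measure_lt_le_of_integral_le {f : Ω → ℝ} (hf : Integrable f μ) (h0 : ∀ ω, 0 ≤ f ω)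
    {a b : ℝ} (ha : 0 < a) (hb : ∫ ω, f ω ∂μ ≤ b) :
    μ {ω | a < f ω} ≤ ENNReal.ofReal (b / a) := by
  have h := mul_meas_ge_le_integral_of_nonneg (Filter.Eventually.of_forall h0) hf a
  calc μ {ω | a < f ω} ≤ μ {ω | a ≤ f ω} := measure_mono fun ω (hω : a < f ω) => hω.le
    _ = ENNReal.ofReal (μ.real {ω | a ≤ f ω}) := (ofReal_measureReal (measure_ne_top _ _)).symm
    _ ≤ ENNReal.ofReal (b / a) := by
        apply ENNReal.ofReal_le_ofReal
        rw [le_div_iff₀ ha]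
        linarith

/-- The stochastic error is small enough for the empirical objective at bandwidth `d`. -/
structure IsTypical (d N : ℕ) (z : ℕ → Fin K → Fin K → ℝ) (M₀ : Tensor K) (m η R' : ℝ) :
    Prop where
  error_le : bandSeminorm d (empCov z (Finset.range N) - M₀) ^ 2 ≤ m / N
  max_le : ∀ n < N, bandSeminorm d (outerSq (z n)) ≤ η * N
  mean_le : (∑ n ∈ Finset.range N, bandSeminorm d (outerSq (z n))) / N ≤ R'

/-- Markov's inequality for each of the three requirements. The maximum is handled by a union bound:
`N` events of probability at most `16 V / (η N) ^ 2` still have total probability of order `1 / N`.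
-/
lemma IsSample.measure_not_isTypical_le (h : IsSample μ Z M₀ V) (hV : 0 ≤ V) {d N : ℕ}
    (hd : 0 < d) (hN : 0 < N) {m η r : ℝ} (hm : 0 < m) (hη : 0 < η) (hr : 0 < r) :
    μ {ω | ¬ IsTypical d N (fun n => Z n ω) M₀ m η (1 + r)}
      ≤ ENNReal.ofReal (16 * V / m + 16 * V / (η ^ 2 * N) + 16 * V / r) := by
  have hN' : (0 : ℝ) < N := by exact_mod_cast hN
  set S₁ := {ω | m / N < bandSq d (empCov (fun n => Z n ω) (Finset.range N) - M₀)}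
  set S₂ : ℕ → Set Ω := fun n => {ω | (η * N) ^ 2 < bandSq d (outerSq (Z n ω))}
  set S₃ := {ω | N * r < ∑ n ∈ Finset.range N, bandSq d (outerSq (Z n ω))}
  have hsub : {ω | ¬ IsTypical d N (fun n => Z n ω) M₀ m η (1 + r)}
      ⊆ (S₁ ∪ ⋃ n ∈ Finset.range N, S₂ n) ∪ S₃ := by
    intro ω hω
    by_contra hcon
    simp only [mem_union, mem_iUnion, not_or, not_exists, S₁, S₂, S₃, mem_ofPred_eq, not_lt,
      Finset.mem_range] at hcon
    obtain ⟨⟨h1, h2⟩, h3⟩ := hcon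
    refine hω ⟨(bandSeminorm_sq_le _ _).trans h1, fun n hn => ?_, ?_⟩
    · exact le_of_sq_le_sq ((bandSeminorm_sq_le _ _).trans (h2 n hn)) (by positivity)
    · rw [div_le_iff₀ hN']
      calc ∑ n ∈ Finset.range N, bandSeminorm d (outerSq (Z n ω))
          ≤ ∑ n ∈ Finset.range N, (1 + bandSq d (outerSq (Z n ω))) := by
            refine Finset.sum_le_sum fun n _ => ?_
            have := bandSeminorm_sq_le d (outerSq (Z n ω))
            -- The inequality `x ≤ 1 + x ^ 2` is the source of the `1` in `1 + r`.
            nlinarith [sq_nonneg (bandSeminorm d (outerSq (Z n ω)) - 1)]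
        _ ≤ _ := by
            rw [Finset.sum_add_distrib]
            simp only [Finset.sum_const, Finset.card_range, nsmul_eq_mul]
            linarith
  have b1 : μ S₁ ≤ ENNReal.ofReal (16 * V / m) := by
    obtain ⟨hi, hb⟩ := h.bandSq_empCov_sub hd hN
    refine (measure_lt_le_of_integral_le hi (fun ω => bandSq_nonneg _ _) (by positivity) hb).trans
      (ENNReal.ofReal_le_ofReal (le_of_eq ?_))
    field_simp
  have b2 : μ (⋃ n ∈ Finset.range N, S₂ n) ≤ ENNReal.ofReal (16 * V / (η ^ 2 * N)) := by
    refine (measure_biUnion_finset_le _ _).trans ?_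
    calc ∑ n ∈ Finset.range N, μ (S₂ n)
        ≤ ∑ n ∈ Finset.range N, ENNReal.ofReal (16 * V / (η * N) ^ 2) := by
          refine Finset.sum_le_sum fun n _ => ?_
          obtain ⟨hi, hb⟩ := h.bandSq_outerSq hd n
          exact measure_lt_le_of_integral_le hi (fun ω => bandSq_nonneg _ _) (by positivity) hb
      _ = ENNReal.ofReal (16 * V / (η ^ 2 * N)) := by
          rw [Finset.sum_const, Finset.card_range, nsmul_eq_mul, ← ENNReal.ofReal_natCast,
            ← ENNReal.ofReal_mul hN'.le]
          congr 1
          field_simp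
  have b3 : μ S₃ ≤ ENNReal.ofReal (16 * V / r) := by
    have hi : Integrable (fun ω => ∑ n ∈ Finset.range N, bandSq d (outerSq (Z n ω))) μ :=
      integrable_finsetSum _ fun n _ => (h.bandSq_outerSq hd n).1
    have hb : ∫ ω, ∑ n ∈ Finset.range N, bandSq d (outerSq (Z n ω)) ∂μ ≤ N * (16 * V) := by
      rw [integral_finsetSum _ fun n _ => (h.bandSq_outerSq hd n).1]
      refine (Finset.sum_le_sum fun n _ => (h.bandSq_outerSq hd n).2).trans ?_
      simp
    refine (measure_lt_le_of_integral_le hi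
      (fun ω => Finset.sum_nonneg fun n _ => bandSq_nonneg _ _) (by positivity) hb).trans
      (ENNReal.ofReal_le_ofReal (le_of_eq ?_))
    field_simp
  calc _ ≤ μ ((S₁ ∪ ⋃ n ∈ Finset.range N, S₂ n) ∪ S₃) := measure_mono hsub
    _ ≤ (μ S₁ + μ (⋃ n ∈ Finset.range N, S₂ n)) + μ S₃ :=
        (measure_union_le _ _).trans (by gcongr; exact measure_union_le _ _)
    _ ≤ _ := by
        rw [ENNReal.ofReal_add (by positivity) (by positivity),
          ENNReal.ofReal_add (by positivity) (by positivity)]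
        gcongr

end Selection

/-! ### Selection of the bandwidth -/

/-- Deterministic properties of the mean tensors that make the bandwidth selection work: `good`
bandwidths are separated from the other ones by the discrete objective. -/
structure IsSeparated {K : ℕ} (Δ : Finset ℝ) (good : ℝ → Prop) (M₀ : Tensor K) (R τ κ : ℝ) :
    Prop where
  norm_le : ∀ δ ∈ Δ, bandSeminorm (discreteBandwidth δ K) M₀ ≤ R
  trace_le : ∀ δ ∈ Δ, τ ≤ |dTrace (discreteBandwidth δ K) M₀ / (K : ℝ) ^ 2|
  good_le : ∀ δ ∈ Δ, good δ →
    ‖starVec (fullEst (discreteBandwidth δ K) M₀) - starVec M₀‖ ^ 2 ≤ κ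
  le_bad : ∀ δ ∈ Δ, ¬ good δ →
    3 * κ ≤ ‖starVec (fullEst (discreteBandwidth δ K) M₀) - starVec M₀‖ ^ 2

/-- Outside an event of probability at most `ε`, the sample is typical for every candidate at once.
Then all objectives are known up to less than half of the gap between good and bad candidates, so
the minimizer is good, and the error bound holds at the selected bandwidth whichever one it is. -/
theorem exists_rate_of_isSeparated {Ω : Type*} [MeasurableSpace Ω] {μ : Measure Ω}
    [IsProbabilityMeasure μ] {Δ : Finset ℝ} {good : ℝ → Prop} {δ₁ : ℝ} (hδ₁ : δ₁ ∈ Δ)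
    (hgood : good δ₁) {R τ κ V : ℝ} (hτ : 0 < τ) (hκ : 0 < κ) (hV : 0 ≤ V) {K₀ : ℕ}
    {M₀ : (K : ℕ) → Tensor K} (hsep : ∀ K ≥ K₀, IsSeparated Δ good (M₀ K) R τ κ)
    {Z : (K : ℕ) → ℕ → Ω → Fin K → Fin K → ℝ} (hZ : ∀ K ≥ K₀, IsSample μ (Z K) (M₀ K) V)
    {δhat : ℕ → ℕ → Ω → ℝ}
    (hδhat : ∀ N K ω, δhat N K ω ∈ Δ ∧ ∀ δ ∈ Δ,
      XiHat N (fun n => Z K n ω) (δhat N K ω) ≤ XiHat N (fun n => Z K n ω) δ)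
    {ε : ℝ} (hε : 0 < ε) :
    ∃ (m : ℝ) (N₀ : ℕ), ∀ N ≥ N₀, ∀ K ≥ K₀,
      0 < N ∧
      μ {ω | ¬ (good (δhat N K ω) ∧
        bandSeminorm (discreteBandwidth (δhat N K ω) K)
          (empCov (fun n => Z K n ω) (Finset.range N) - M₀ K) ^ 2 ≤ m / N ∧
        bandSeminorm (discreteBandwidth (δhat N K ω) K)
          (empCov (fun n => Z K n ω) (Finset.range N) - M₀ K) ≤ min 1 (τ / 2))}
        ≤ ENNReal.ofReal ε := by
  have hcard : (0 : ℝ) < Δ.card := by exact_mod_cast Finset.card_pos.2 ⟨δ₁, hδ₁⟩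
  have hR : 0 ≤ R := (apply_nonneg _ _).trans ((hsep K₀ le_rfl).norm_le δ₁ hδ₁)
  -- Each of the three Markov bounds for each candidate receives the share `ε / (3 * Δ.card)`; the
  -- `+ 1` keeps `m` positive when `V = 0`. The same `m` also serves as the bound `r` for the mean.
  set m : ℝ := (16 * V + 1) * (3 * Δ.card) / ε with hm
  have hm0 : 0 < m := by positivity
  have hVm : 16 * V / m ≤ ε / (3 * Δ.card) := by
    rw [hm, div_div_eq_mul_div, div_le_div_iff₀ (by positivity) (by positivity)]
    have : 0 ≤ ε * (3 * Δ.card) := by positivity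
    nlinarith
  have hobj : 0 ≤ objLip R (1 + m) τ := by
    have := sepLip_nonneg hR hτ
    unfold objLip
    positivity
  -- The factor `4` is the loss in passing to leave-one-out means, which must stay in the region
  -- where the estimator is Lipschitz. The last condition makes the objective accurate to `κ / 2`.
  obtain ⟨η, hη0, hη1, hη2, hη3⟩ : ∃ η : ℝ, 0 < η ∧ 4 * η ≤ 1 ∧ 4 * η ≤ τ / 2 ∧
      objLip R (1 + m) τ * η ≤ κ / 2 := by
    refine ⟨min (min (1 / 4) (τ / 8)) (κ / 2 / (objLip R (1 + m) τ + 1)), by positivity, ?_, ?_, ?_⟩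
    · have := (min_le_left (min (1 / 4) (τ / 8)) (κ / 2 / (objLip R (1 + m) τ + 1))).trans
        (min_le_left _ _)
      linarith
    · have := (min_le_left (min (1 / 4) (τ / 8)) (κ / 2 / (objLip R (1 + m) τ + 1))).trans
        (min_le_right _ _)
      linarith
    · have := min_le_right (min (1 / 4) (τ / 8)) (κ / 2 / (objLip R (1 + m) τ + 1))
      calc objLip R (1 + m) τ * _ ≤ (objLip R (1 + m) τ + 1)
            * (κ / 2 / (objLip R (1 + m) τ + 1)) := by gcongr; linarith
        _ = κ / 2 := by field_simp
  -- The four lower bounds on `N` allow leaving one observation out, make `(R + 1) / (N - 1)` at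
  -- most `η`, make `m / N` at most `η ^ 2`, and make the union bound for the maximum at most its
  -- share of `ε`.
  obtain ⟨N₀, hN₀⟩ := exists_nat_ge (max (max 2 ((R + 1) / η + 1))
    (max (m / η ^ 2) (16 * V * (3 * Δ.card) / (η ^ 2 * ε))))
  refine ⟨m, N₀, fun N hN K hK => ?_⟩
  have hNN : max (max 2 ((R + 1) / η + 1)) (max (m / η ^ 2)
      (16 * V * (3 * Δ.card) / (η ^ 2 * ε))) ≤ (N : ℝ) := hN₀.trans (by exact_mod_cast hN)
  simp only [max_le_iff] at hNN
  obtain ⟨⟨hN2, hNR⟩, hNm, hNV⟩ := hNN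
  have hN2' : 2 ≤ N := by exact_mod_cast hN2
  have hNpos : (0 : ℝ) < N := by linarith
  refine ⟨by omega, ?_⟩
  have hsp := hsep K hK
  set T : ℝ → Set Ω := fun δ =>
    {ω | ¬ IsTypical (discreteBandwidth δ K) N (fun n => Z K n ω) (M₀ K) m η (1 + m)}
  have hT : ∀ δ, μ (T δ) ≤ ENNReal.ofReal (ε / Δ.card) := by
    intro δ
    refine ((hZ K hK).measure_not_isTypical_le hV (Nat.succ_pos _) (by omega) hm0 hη0 hm0).trans
      (ENNReal.ofReal_le_ofReal ?_)
    have h1 : 16 * V / (η ^ 2 * N) ≤ ε / (3 * Δ.card) := by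
      rw [div_le_iff₀ (by positivity)] at hNV
      rw [div_le_div_iff₀ (by positivity) (by positivity)]
      linarith
    have h2 : ε / (3 * Δ.card) + ε / (3 * Δ.card) + ε / (3 * Δ.card) = ε / Δ.card := by
      field_simp
      norm_num
    linarith
  have hsub : {ω | ¬ (good (δhat N K ω) ∧
        bandSeminorm (discreteBandwidth (δhat N K ω) K)
          (empCov (fun n => Z K n ω) (Finset.range N) - M₀ K) ^ 2 ≤ m / N ∧
        bandSeminorm (discreteBandwidth (δhat N K ω) K)
          (empCov (fun n => Z K n ω) (Finset.range N) - M₀ K) ≤ min 1 (τ / 2))}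
      ⊆ ⋃ δ ∈ Δ, T δ := by
    intro ω hω
    by_contra hcon
    simp only [mem_iUnion, not_exists, T, mem_ofPred_eq, not_not] at hcon
    have hη : ∀ δ ∈ Δ, bandSeminorm (discreteBandwidth δ K)
          (empCov (fun n => Z K n ω) (Finset.range N) - M₀ K) ≤ η := by
      intro δ hδ
      refine le_of_sq_le_sq ((hcon δ hδ).error_le.trans ?_) hη0.le
      rw [div_le_iff₀ hNpos]
      rw [div_le_iff₀ (by positivity)] at hNm
      linarith
    have hXi : ∀ δ ∈ Δ, |XiHat N (fun n => Z K n ω) δ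
        - (‖starVec (fullEst (discreteBandwidth δ K) (M₀ K)) - starVec (M₀ K)‖ ^ 2
          - ‖starVec (M₀ K)‖ ^ 2)| ≤ κ / 2 := by
      intro δ hδ
      refine (abs_XiHat_sub_le hτ hη0 hη1 hη2 (hsp.norm_le δ hδ) (hsp.trace_le δ hδ) hN2' ?_
        (hη δ hδ) (hcon δ hδ).max_le (hcon δ hδ).mean_le).trans hη3
      rw [div_le_iff₀ (by linarith), mul_comm, ← div_le_iff₀ hη0]
      linarith
    obtain ⟨hmem, hmin⟩ := hδhat N K ω
    refine hω ⟨?_, (hcon _ hmem).error_le, (hη _ hmem).trans ?_⟩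
    -- Relative to the common constant, a bad choice has objective at least `3 κ - κ / 2`, whereas
    -- `δ₁` has at most `κ + κ / 2`.
    · by_contra hbad
      have h1 := (abs_le.1 (hXi _ hmem)).1
      have h2 := (abs_le.1 (hXi _ hδ₁)).2
      have h3 := hsp.good_le _ hδ₁ hgood
      have h4 := hsp.le_bad _ hmem hbad
      have h5 := hmin δ₁ hδ₁
      linarith
    · exact le_min (by linarith) (by linarith)
  calc _ ≤ μ (⋃ δ ∈ Δ, T δ) := measure_mono hsub
    _ ≤ ∑ δ ∈ Δ, μ (T δ) := measure_biUnion_finset_le _ _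
    _ ≤ ∑ δ ∈ Δ, ENNReal.ofReal (ε / Δ.card) := Finset.sum_le_sum fun δ _ => hT δ
    _ = ENNReal.ofReal ε := by
        rw [Finset.sum_const, nsmul_eq_mul, ← ENNReal.ofReal_natCast,
          ← ENNReal.ofReal_mul hcard.le]
        congr 1
        field_simp

/-! ### Uniform approximation of kernels by tensors -/

/-- Joint continuity of a kernel. -/
def IsContKernel (c : Kernel4) : Prop :=
  Continuous fun z : (ℝ × ℝ) × (ℝ × ℝ) => c z.1.1 z.1.2 z.2.1 z.2.2

lemma IsContKernel.comp {c : Kernel4} (hc : IsContKernel c) {X : Type*} [TopologicalSpace X]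
    {f₁ f₂ f₃ f₄ : X → ℝ} (h₁ : Continuous f₁) (h₂ : Continuous f₂) (h₃ : Continuous f₃)
    (h₄ : Continuous f₄) : Continuous fun x => c (f₁ x) (f₂ x) (f₃ x) (f₄ x) :=
  Continuous.comp (g := fun z : (ℝ × ℝ) × (ℝ × ℝ) => c z.1.1 z.1.2 z.2.1 z.2.2) hc
    ((h₁.prodMk h₂).prodMk (h₃.prodMk h₄))

/-- The unit four-cube. -/
def cube : Set ((ℝ × ℝ) × (ℝ × ℝ)) :=
  (Icc (0 : ℝ) 1 ×ˢ Icc (0 : ℝ) 1) ×ˢ (Icc (0 : ℝ) 1 ×ˢ Icc (0 : ℝ) 1)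

lemma isCompact_cube : IsCompact cube :=
  (isCompact_Icc.prod isCompact_Icc).prod (isCompact_Icc.prod isCompact_Icc)

lemma IsContKernel.exists_modulus {c : Kernel4} (hc : IsContKernel c) {ε : ℝ} (hε : 0 < ε) :
    ∃ ρ > 0, ∀ z ∈ cube, ∀ w ∈ cube, dist z w < ρ →
      |c z.1.1 z.1.2 z.2.1 z.2.2 - c w.1.1 w.1.2 w.2.1 w.2.2| < ε := by
  have h := isCompact_cube.uniformContinuousOn_of_continuous hc.continuousOn
  rw [Metric.uniformContinuousOn_iff] at h
  exact h ε hε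

lemma IsContKernel.exists_bound {c : Kernel4} (hc : IsContKernel c) :
    ∃ B, 0 ≤ B ∧ ∀ t ∈ Icc (0 : ℝ) 1, ∀ s ∈ Icc (0 : ℝ) 1, ∀ t' ∈ Icc (0 : ℝ) 1,
      ∀ s' ∈ Icc (0 : ℝ) 1, |c t s t' s'| ≤ B := by
  obtain ⟨B, hB⟩ := isCompact_cube.exists_bound_of_continuousOn hc.continuousOn
  refine ⟨max B 0, le_max_right _ _, fun t ht s hs t' ht' s' hs' => ?_⟩
  exact (hB ((t, s), (t', s')) ⟨⟨ht, hs⟩, ⟨ht', hs'⟩⟩).trans (le_max_left _ _)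

/-- The point `t` of the unit interval is close to the grid index `i`. -/
def IsNear {K : ℕ} (i : Fin K) (t : ℝ) : Prop := t ∈ Icc (0 : ℝ) 1 ∧ |t - i / K| ≤ 3 / K

/-- The tensors `F K` approximate the kernel `f` uniformly on the unit cube. -/
def Approximates (F : (K : ℕ) → Tensor K) (f : Kernel4) : Prop :=
  ∀ ε > 0, ∃ K₀ : ℕ, ∀ K ≥ K₀, ∀ i j k l : Fin K, ∀ t s t' s' : ℝ,
    IsNear i t → IsNear j s → IsNear k t' → IsNear l s' → |F K i j k l - f t s t' s'| ≤ ε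

lemma isNear_left {K : ℕ} (i : Fin K) : IsNear i ((i : ℝ) / K) := by
  have hK : (0 : ℝ) < K := by have := i.pos; positivity
  refine ⟨⟨by positivity, ?_⟩, by rw [sub_self, abs_zero]; positivity⟩
  rw [div_le_one hK]
  exact_mod_cast i.2.le

lemma isNear_of_mem {K : ℕ} {i : Fin K} {t : ℝ} (ht : t ∈ Icc ((i : ℝ) / K) (((i : ℝ) + 1) / K)) :
    IsNear i t := by
  have hK : (0 : ℝ) < K := by have := i.pos; positivity
  have h1 : ((i : ℝ) + 1) / K ≤ 1 := by
    rw [div_le_one hK]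
    exact_mod_cast i.2
  have h0 : 0 ≤ (i : ℝ) / K := by positivity
  have h2 : ((i : ℝ) + 1) / K = (i : ℝ) / K + 1 / K := by ring
  have h3 : (3 : ℝ) / K = 3 * (1 / K) := by ring
  have h4 : (0 : ℝ) < 1 / K := by positivity
  refine ⟨⟨h0.trans ht.1, ht.2.trans h1⟩, ?_⟩
  rw [abs_le]
  constructor <;> linarith [ht.1, ht.2]

lemma Approximates.sub {F G : (K : ℕ) → Tensor K} {f g : Kernel4} (hF : Approximates F f)
    (hG : Approximates G g) : Approximates (fun K => F K - G K)
      (fun t s t' s' => f t s t' s' - g t s t' s') := by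
  intro ε hε
  obtain ⟨K₁, h₁⟩ := hF (ε / 2) (by positivity)
  obtain ⟨K₂, h₂⟩ := hG (ε / 2) (by positivity)
  refine ⟨max K₁ K₂, fun K hK i j k l t s t' s' hi hj hk hl => ?_⟩
  have a := h₁ K (le_of_max_le_left hK) i j k l t s t' s' hi hj hk hl
  have b := h₂ K (le_of_max_le_right hK) i j k l t s t' s' hi hj hk hl
  simp only [Pi.sub_apply]
  rw [abs_le] at *
  constructor <;> linarith [a.1, a.2, b.1, b.2]

/-- Exchange the two coordinates of both points. -/
def swapKernel (c : Kernel4) : Kernel4 := fun s t s' t' => c t s t' s'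

/-- Exchange the two coordinates of both indices. -/
def swapTensor {K : ℕ} (M : Tensor K) : Tensor K := fun j i l k => M i j k l

lemma Approximates.swap {F : (K : ℕ) → Tensor K} {f : Kernel4} (hF : Approximates F f) :
    Approximates (fun K => swapTensor (F K)) (swapKernel f) := by
  intro ε hε
  obtain ⟨K₁, h₁⟩ := hF ε hε
  exact ⟨K₁, fun K hK i j k l t s t' s' hi hj hk hl => h₁ K hK j i l k s t s' t' hj hi hl hk⟩

lemma IsContKernel.swap {c : Kernel4} (hc : IsContKernel c) : IsContKernel (swapKernel c) :=
  hc.comp (by fun_prop) (by fun_prop) (by fun_prop) (by fun_prop)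

/-! ### Shifted sums as Riemann sums -/

lemma discreteBandwidth_bounds {δ : ℝ} (hδ : 0 ≤ δ) (K : ℕ) :
    δ * K + 1 ≤ discreteBandwidth δ K ∧ (discreteBandwidth δ K : ℝ) ≤ δ * K + 2 := by
  unfold discreteBandwidth
  push_cast
  have h1 := Nat.le_ceil (δ * K)
  have h2 := (Nat.ceil_lt_add_one (by positivity : 0 ≤ δ * K)).le
  constructor <;> linarith

lemma shiftSum_eq_sum_range {K d : ℕ} (f : Fin K → Fin K → ℝ) :
    shiftSum d f = ∑ j ∈ Finset.range (K - d),
      if h : j + d < K then f ⟨j, by omega⟩ ⟨j + d, h⟩ else 0 := by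
  have h1 : shiftSum d f = ∑ j : Fin K, if h : (j : ℕ) + d < K then f j ⟨j + d, h⟩ else 0 := by
    unfold shiftSum
    refine Finset.sum_congr rfl fun j _ => ?_
    split_ifs with h
    · rw [Finset.sum_eq_single (⟨j + d, h⟩ : Fin K)]
      · simp
      · intro l _ hl
        rw [if_neg]
        intro h'
        exact hl (Fin.ext h')
      · simp
    · refine Finset.sum_eq_zero fun l _ => if_neg ?_
      have := l.2
      omega
  have h2 := Fin.sum_univ_eq_sum_range
    (fun j => if h : j + d < K then f ⟨j, by omega⟩ ⟨j + d, h⟩ else 0) K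
  rw [h1]
  refine Eq.trans ?_ (h2.trans ?_)
  · rfl
  · symm
    refine Finset.sum_subset (Finset.range_mono (Nat.sub_le _ _)) fun j _ hj => dif_neg ?_
    simp only [Finset.mem_range] at hj
    omega

/-- A Riemann sum over the first `K - d` cells, with error at most `ε / K` on each. The part of `[0,
1 - δ]` left uncovered has length at most `2 / K` because `d ≤ δ K + 2`; this remains true when `d`
exceeds `K` and no cell is left. -/
lemma abs_shiftSum_div_sub_integral_le {K : ℕ} (hK : 0 < K) {δ : ℝ} (hδ : δ ∈ Ico (0 : ℝ) 1)
    {f : Fin K → Fin K → ℝ} {g : ℝ → ℝ} (hg : Continuous g) {B ε : ℝ} (hε : 0 ≤ ε)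
    (hB : ∀ s ∈ Icc (0 : ℝ) (1 - δ), |g s| ≤ B)
    (hfg : ∀ j l : Fin K, ∀ s ∈ Icc (0 : ℝ) (1 - δ), IsNear j s → IsNear l (s + δ) →
      |f j l - g s| ≤ ε) :
    |shiftSum (discreteBandwidth δ K) f / K - ∫ s in (0 : ℝ)..(1 - δ), g s| ≤ ε + 2 * B / K := by
  obtain ⟨hd1, hd2⟩ := discreteBandwidth_bounds hδ.1 K
  set d := discreteBandwidth δ K
  have hK' : (0 : ℝ) < K := by exact_mod_cast hK
  have hB0 : 0 ≤ B := (abs_nonneg _).trans (hB 0 ⟨le_rfl, by linarith [hδ.2]⟩)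
  set n := K - d with hn
  have hn1 : (n : ℝ) / K ≤ 1 - δ ∧ 1 - δ - n / K ≤ 2 / K := by
    by_cases h : d ≤ K
    · have e : (n : ℝ) = K - d := by rw [hn, Nat.cast_sub h]
      constructor
      · rw [div_le_iff₀ hK', e]; nlinarith
      · rw [e, sub_le_iff_le_add, ← add_div, le_div_iff₀ hK']; nlinarith
    · have e : n = 0 := by omega
      have h' : (K : ℝ) ≤ d := by exact_mod_cast (not_le.1 h).le
      rw [e]
      simp only [Nat.cast_zero, zero_div, sub_zero]
      refine ⟨by linarith [hδ.2], ?_⟩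
      rw [le_div_iff₀ hK']; nlinarith
  have hsplit : ∫ s in (0 : ℝ)..(1 - δ), g s
      = (∑ j ∈ Finset.range n, ∫ s in ((j : ℕ) : ℝ) / K..((j + 1 : ℕ) : ℝ) / K, g s)
        + ∫ s in (n : ℝ) / K..(1 - δ), g s := by
    rw [intervalIntegral.sum_integral_adjacent_intervals (a := fun j : ℕ => (j : ℝ) / K)
      fun k _ => hg.intervalIntegrable _ _]
    simp only [Nat.cast_zero, zero_div]
    exact (intervalIntegral.integral_add_adjacent_intervals (hg.intervalIntegrable _ _)
      (hg.intervalIntegrable _ _)).symm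
  have hrem : |∫ s in (n : ℝ) / K..(1 - δ), g s| ≤ B * (2 / K) := by
    have h := intervalIntegral.norm_integral_le_of_norm_le_const (a := (n : ℝ) / K) (b := 1 - δ)
      (f := g) (C := B) fun s hs => by
        rw [uIoc_of_le hn1.1] at hs
        exact hB s ⟨by have : 0 ≤ (n : ℝ) / K := by positivity
                       linarith [hs.1], hs.2⟩
    rw [Real.norm_eq_abs] at h
    refine h.trans ?_
    rw [abs_of_nonneg (by linarith [hn1.1])]
    exact mul_le_mul_of_nonneg_left hn1.2 hB0
  have hterm : ∀ j ∈ Finset.range n,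
      |(if h : j + d < K then f ⟨j, by omega⟩ ⟨j + d, h⟩ else 0) / K
        - ∫ s in ((j : ℕ) : ℝ) / K..((j + 1 : ℕ) : ℝ) / K, g s| ≤ ε / K := by
    intro j hj
    rw [Finset.mem_range] at hj
    have hjd : j + d < K := by omega
    rw [dif_pos hjd]
    set r := f ⟨j, by omega⟩ ⟨j + d, hjd⟩
    have hlen : ((j + 1 : ℕ) : ℝ) / K - (j : ℝ) / K = 1 / K := by push_cast; ring
    have hc : r / K = ∫ s in ((j : ℕ) : ℝ) / K..((j + 1 : ℕ) : ℝ) / K, r := by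
      rw [intervalIntegral.integral_const, hlen, smul_eq_mul]; ring
    rw [hc, ← intervalIntegral.integral_sub intervalIntegrable_const (hg.intervalIntegrable _ _)]
    have hle : (j : ℝ) / K ≤ ((j + 1 : ℕ) : ℝ) / K := by
      have : (0 : ℝ) < 1 / K := by positivity
      linarith
    have h := intervalIntegral.norm_integral_le_of_norm_le_const (a := (j : ℝ) / K)
      (b := ((j + 1 : ℕ) : ℝ) / K) (f := fun s => r - g s) (C := ε) fun s hs => by
        rw [uIoc_of_le hle] at hs
        have hsmem : s ∈ Icc ((j : ℝ) / K) (((j : ℝ) + 1) / K) := by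
          push_cast at hs
          exact ⟨hs.1.le, hs.2⟩
        have hnear : IsNear (⟨j, by omega⟩ : Fin K) s := isNear_of_mem hsmem
        have hs1 : s ≤ 1 - δ := by
          refine le_trans (hs.2.trans ?_) hn1.1
          gcongr
          exact hj
        -- Rounding makes `d` exceed `δ K` by between `1` and `2`, so `s + δ` need not lie in the
        -- cell `j + d`. It is still within the tolerance `3 / K` of `IsNear`.
        refine hfg _ _ s ⟨hnear.1.1, hs1⟩ hnear ⟨⟨by linarith [hnear.1.1, hδ.1], by linarith⟩, ?_⟩
        have e1 : ((j : ℝ) + 1) / K = (j : ℝ) / K + 1 / K := by ring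
        have e2 : (((⟨j + d, hjd⟩ : Fin K) : ℕ) : ℝ) / K = (j : ℝ) / K + (d : ℝ) / K := by
          push_cast; ring
        have e3 : δ + 1 / K ≤ (d : ℝ) / K := by
          rw [le_div_iff₀ hK', add_mul, one_div, inv_mul_cancel₀ hK'.ne']; linarith
        have e4 : (d : ℝ) / K ≤ δ + 2 * (1 / K) := by
          rw [div_le_iff₀ hK', add_mul, mul_assoc, one_div, inv_mul_cancel₀ hK'.ne']; linarith
        have e5 : (3 : ℝ) / K = 3 * (1 / K) := by ring
        have e6 : (0 : ℝ) < 1 / K := by positivity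
        rw [e2, e5, abs_le]
        constructor <;> linarith [hsmem.1, hsmem.2]
    rw [hlen, abs_of_pos (by positivity), Real.norm_eq_abs] at h
    rw [mul_one_div] at h
    exact h
  rw [hsplit, shiftSum_eq_sum_range, Finset.sum_div, ← sub_sub, ← Finset.sum_sub_distrib]
  refine (abs_sub _ _).trans (add_le_add ?_ (hrem.trans (le_of_eq (by ring))))
  refine (Finset.abs_sum_le_sum_abs _ _).trans ((Finset.sum_le_sum hterm).trans ?_)
  rw [Finset.sum_const, Finset.card_range, nsmul_eq_mul]
  have : (n : ℝ) ≤ K := by exact_mod_cast Nat.sub_le _ _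
  calc (n : ℝ) * (ε / K) ≤ K * (ε / K) := by gcongr
    _ = ε := by field_simp

lemma exists_nat_forall_div_le (B : ℝ) {ε : ℝ} (hε : 0 < ε) :
    ∃ K₀ : ℕ, ∀ K ≥ K₀, 0 < K ∧ B / (K : ℝ) ≤ ε := by
  obtain ⟨n, hn⟩ := exists_nat_ge (B / ε)
  refine ⟨n + 1, fun K hK => ⟨by omega, ?_⟩⟩
  have hK' : (n : ℝ) + 1 ≤ K := by exact_mod_cast hK
  have hn0 : (0 : ℝ) ≤ n := Nat.cast_nonneg n
  rw [div_le_iff₀ hε] at hn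
  rw [div_le_iff₀ (by linarith)]
  nlinarith

section Traces

variable {F : (K : ℕ) → Tensor K} {c : Kernel4} {δ : ℝ}

lemma Approximates.dTrace₁ (hF : Approximates F c) (hc : IsContKernel c)
    (hδ : δ ∈ Ico (0 : ℝ) 1) {ε : ℝ} (hε : 0 < ε) :
    ∃ K₀ : ℕ, ∀ K ≥ K₀, ∀ i k : Fin K, ∀ t t' : ℝ, IsNear i t → IsNear k t' →
      |dTrace₁ (discreteBandwidth δ K) (F K) i k / K - shiftTrace₁ δ c t t'| ≤ ε := by
  obtain ⟨B, hB0, hB⟩ := hc.exists_bound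
  obtain ⟨K₁, h₁⟩ := hF (ε / 2) (by positivity)
  obtain ⟨K₂, h₂⟩ := exists_nat_forall_div_le (2 * B) (half_pos hε)
  refine ⟨max K₁ K₂, fun K hK i k t t' ht ht' => ?_⟩
  obtain ⟨hK0, hKB⟩ := h₂ K (le_of_max_le_right hK)
  have h := abs_shiftSum_div_sub_integral_le hK0 hδ (f := fun j l => F K i j k l)
    (g := fun s => c t s t' (s + δ))
    (hc.comp (by fun_prop) (by fun_prop) (by fun_prop) (by fun_prop)) (half_pos hε).le
    (fun s hs => hB t ht.1 s ⟨hs.1, by linarith [hs.2, hδ.1]⟩ t' ht'.1 (s + δ)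
      ⟨by linarith [hs.1, hδ.1], by linarith [hs.2]⟩)
    fun j l s _ hj hl => h₁ K (le_of_max_le_left hK) i j k l t s t' (s + δ) ht hj ht' hl
  rw [dTrace₁_eq]
  exact h.trans (by linarith)

lemma Approximates.dTrace₂ (hF : Approximates F c) (hc : IsContKernel c)
    (hδ : δ ∈ Ico (0 : ℝ) 1) {ε : ℝ} (hε : 0 < ε) :
    ∃ K₀ : ℕ, ∀ K ≥ K₀, ∀ j l : Fin K, ∀ s s' : ℝ, IsNear j s → IsNear l s' →
      |dTrace₂ (discreteBandwidth δ K) (F K) j l / K - shiftTrace₂ δ c s s'| ≤ ε :=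
  hF.swap.dTrace₁ hc.swap hδ hε

/-- The Riemann-sum bound is used twice: the accuracy of the inner sum becomes the tolerance between
summand and integrand of the outer one. -/
lemma Approximates.dTrace (hF : Approximates F c) (hc : IsContKernel c)
    (hδ : δ ∈ Ico (0 : ℝ) 1) {ε : ℝ} (hε : 0 < ε) :
    ∃ K₀ : ℕ, ∀ K ≥ K₀,
      |dTrace (discreteBandwidth δ K) (F K) / (K : ℝ) ^ 2 - shiftTrace δ c| ≤ ε := by
  obtain ⟨B, hB0, hB⟩ := hc.exists_bound
  obtain ⟨K₁, h₁⟩ := hF (ε / 3) (by positivity)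
  obtain ⟨K₂, h₂⟩ := exists_nat_forall_div_le (2 * B) (by positivity : 0 < ε / 3)
  refine ⟨max K₁ K₂, fun K hK => ?_⟩
  obtain ⟨hK0, hKB⟩ := h₂ K (le_of_max_le_right hK)
  have hcont : Continuous fun z : ℝ × ℝ => c z.1 z.2 (z.1 + δ) (z.2 + δ) :=
    hc.comp (by fun_prop) (by fun_prop) (by fun_prop) (by fun_prop)
  have hb : ∀ t ∈ Icc (0 : ℝ) (1 - δ), ∀ s ∈ Icc (0 : ℝ) (1 - δ),
      |c t s (t + δ) (s + δ)| ≤ B := fun t ht s hs =>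
    hB t ⟨ht.1, by linarith [ht.2, hδ.1]⟩ s ⟨hs.1, by linarith [hs.2, hδ.1]⟩ (t + δ)
      ⟨by linarith [ht.1, hδ.1], by linarith [ht.2]⟩ (s + δ)
      ⟨by linarith [hs.1, hδ.1], by linarith [hs.2]⟩
  have hinner : ∀ i k : Fin K, ∀ t ∈ Icc (0 : ℝ) (1 - δ), IsNear i t → IsNear k (t + δ) →
      |shiftSum (discreteBandwidth δ K) (fun j l => F K i j k l) / K
        - ∫ s in (0 : ℝ)..(1 - δ), c t s (t + δ) (s + δ)| ≤ ε / 3 + ε / 3 := by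
    intro i k t ht hi hk
    have h := abs_shiftSum_div_sub_integral_le hK0 hδ (f := fun j l => F K i j k l)
      (g := fun s => c t s (t + δ) (s + δ))
      (hc.comp (by fun_prop) (by fun_prop) (by fun_prop) (by fun_prop))
      (by positivity : 0 ≤ ε / 3) (hb t ht)
      fun j l s _ hj hl => h₁ K (le_of_max_le_left hK) i j k l t s (t + δ) (s + δ) hi hj hk hl
    linarith
  have hgcont : Continuous fun t => ∫ s in (0 : ℝ)..(1 - δ), c t s (t + δ) (s + δ) :=
    intervalIntegral.continuous_parametric_intervalIntegral_of_continuous' hcont _ _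
  have hgB : ∀ t ∈ Icc (0 : ℝ) (1 - δ), |∫ s in (0 : ℝ)..(1 - δ), c t s (t + δ) (s + δ)| ≤ B := by
    intro t ht
    have h := intervalIntegral.norm_integral_le_of_norm_le_const (a := (0 : ℝ)) (b := 1 - δ)
      (f := fun s => c t s (t + δ) (s + δ)) (C := B) fun s hs => by
        rw [uIoc_of_le (by linarith [hδ.2])] at hs
        exact hb t ht s ⟨hs.1.le, hs.2⟩
    rw [Real.norm_eq_abs, sub_zero, abs_of_nonneg (by linarith [hδ.2] : 0 ≤ 1 - δ)] at h
    refine h.trans (mul_le_of_le_one_right hB0 (by linarith [hδ.1]))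
  have h := abs_shiftSum_div_sub_integral_le hK0 hδ
    (f := fun i k => shiftSum (discreteBandwidth δ K) (fun j l => F K i j k l) / K) hgcont
    (by positivity : 0 ≤ ε / 3 + ε / 3) hgB hinner
  have e : SPT.dTrace (discreteBandwidth δ K) (F K) / (K : ℝ) ^ 2
      = shiftSum (discreteBandwidth δ K) (fun i k =>
          shiftSum (discreteBandwidth δ K) (fun j l => F K i j k l) / K) / K := by
    simp only [div_eq_mul_inv _ (K : ℝ), shiftSum_mul_right]
    rw [dTrace_eq]
    ring
  rw [e]
  unfold shiftTrace
  linarith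

lemma continuous_shiftTrace₁ (hc : IsContKernel c) (δ : ℝ) :
    Continuous fun z : ℝ × ℝ => shiftTrace₁ δ c z.1 z.2 :=
  intervalIntegral.continuous_parametric_intervalIntegral_of_continuous'
    (f := fun (z : ℝ × ℝ) s => c z.1 s z.2 (s + δ))
    (hc.comp (by fun_prop) (by fun_prop) (by fun_prop) (by fun_prop)) _ _

lemma continuous_shiftTrace₂ (hc : IsContKernel c) (δ : ℝ) :
    Continuous fun z : ℝ × ℝ => shiftTrace₂ δ c z.1 z.2 :=
  continuous_shiftTrace₁ hc.swap δ

lemma isContKernel_sepProxy (hc : IsContKernel c) (δ : ℝ) : IsContKernel (sepProxy δ c) := by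
  have h1 := (continuous_shiftTrace₁ hc δ).comp
    (f := fun z : (ℝ × ℝ) × (ℝ × ℝ) => (z.1.1, z.2.1)) (by fun_prop)
  have h2 := (continuous_shiftTrace₂ hc δ).comp
    (f := fun z : (ℝ × ℝ) × (ℝ × ℝ) => (z.1.2, z.2.2)) (by fun_prop)
  exact h1.mul (h2.div_const _)

/-- The scalar analogue of the telescoping in `norm_sepEst_sub_le`, for uniform rather than
mean-square approximation. -/
lemma abs_mul_div_sub_le {x y z x₀ y₀ z₀ B τ η : ℝ} (hτ : 0 < τ) (hη1 : η ≤ 1) (hη2 : η ≤ τ / 2)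
    (hx₀ : |x₀| ≤ B) (hy₀ : |y₀| ≤ B) (hz₀ : τ ≤ |z₀|) (hx : |x - x₀| ≤ η) (hy : |y - y₀| ≤ η)
    (hz : |z - z₀| ≤ η) :
    |x * (y / z) - x₀ * (y₀ / z₀)|
      ≤ (2 / τ * (B + 1) + 2 / τ * B + 2 / τ ^ 2 * B ^ 2) * η := by
  have hz' : τ / 2 ≤ |z| := by
    have := abs_sub_abs_le_abs_sub z₀ z
    rw [abs_sub_comm] at this
    linarith
  have hB : 0 ≤ B := (abs_nonneg _).trans hx₀
  have hη : 0 ≤ η := (abs_nonneg _).trans hx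
  have hzne : z ≠ 0 := abs_pos.1 (by linarith)
  have hz0ne : z₀ ≠ 0 := abs_pos.1 (by linarith)
  have hinv : |z⁻¹| ≤ 2 / τ := by
    rw [abs_inv, ← inv_div]
    exact inv_anti₀ (by positivity) hz'
  have hinv0 : |z₀⁻¹| ≤ 1 / τ := by
    rw [abs_inv, one_div]
    exact inv_anti₀ (by positivity) hz₀
  have hyB : |y| ≤ B + 1 := by
    have := abs_sub_abs_le_abs_sub y y₀
    linarith
  have e : x * (y / z) - x₀ * (y₀ / z₀)
      = z⁻¹ * ((x - x₀) * y) + z⁻¹ * (x₀ * (y - y₀)) + (z₀ - z) * (z⁻¹ * z₀⁻¹) * (x₀ * y₀) := by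
    field_simp
    ring
  rw [e]
  refine (abs_add_le _ _).trans ((add_le_add_left (abs_add_le _ _) _).trans ?_)
  simp only [abs_mul]
  rw [abs_sub_comm z₀ z]
  calc |z⁻¹| * (|x - x₀| * |y|) + |z⁻¹| * (|x₀| * |y - y₀|)
        + |z - z₀| * (|z⁻¹| * |z₀⁻¹|) * (|x₀| * |y₀|)
      ≤ 2 / τ * (η * (B + 1)) + 2 / τ * (B * η) + η * (2 / τ * (1 / τ)) * (B * B) := by gcongr
    _ = _ := by field_simp

/-- The traces divided by `K`, `K` and `K ^ 2` converge uniformly, and these powers cancel in the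
quotient, whose denominator has a nonzero limit. -/
lemma Approximates.sepEst (hF : Approximates F c) (hc : IsContKernel c)
    (hδ : δ ∈ Ico (0 : ℝ) 1) (hT : shiftTrace δ c ≠ 0) :
    Approximates (fun K => sepEst (discreteBandwidth δ K) (F K)) (sepProxy δ c) := by
  intro ε hε
  obtain ⟨B₁, hB₁⟩ := (isCompact_Icc.prod isCompact_Icc).exists_bound_of_continuousOn
    (s := Icc (0 : ℝ) 1 ×ˢ Icc (0 : ℝ) 1) (continuous_shiftTrace₁ hc δ).continuousOn
  obtain ⟨B₂, hB₂⟩ := (isCompact_Icc.prod isCompact_Icc).exists_bound_of_continuousOn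
    (s := Icc (0 : ℝ) 1 ×ˢ Icc (0 : ℝ) 1) (continuous_shiftTrace₂ hc δ).continuousOn
  set B := max (max B₁ B₂) 0
  set τ := |shiftTrace δ c| with hτdef
  have hτ : 0 < τ := abs_pos.2 hT
  have hB0 : 0 ≤ B := le_max_right _ _
  set Λ := 2 / τ * (B + 1) + 2 / τ * B + 2 / τ ^ 2 * B ^ 2
  have hΛ : 0 ≤ Λ := by positivity
  set η := min (min 1 (τ / 2)) (ε / (Λ + 1)) with hη
  have hη0 : 0 < η := by positivity
  have hη1 : η ≤ 1 := (min_le_left _ _).trans (min_le_left _ _)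
  have hη2 : η ≤ τ / 2 := (min_le_left _ _).trans (min_le_right _ _)
  have hη3 : Λ * η ≤ ε := by
    calc Λ * η ≤ (Λ + 1) * (ε / (Λ + 1)) := by
          gcongr
          · linarith
          · exact min_le_right _ _
      _ = ε := by field_simp
  obtain ⟨K₁, h₁⟩ := hF.dTrace₁ hc hδ hη0
  obtain ⟨K₂, h₂⟩ := hF.dTrace₂ hc hδ hη0
  obtain ⟨K₃, h₃⟩ := hF.dTrace hc hδ hη0
  refine ⟨max (max K₁ K₂) K₃, fun K hK i j k l t s t' s' hi hj hk hl => ?_⟩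
  simp only [ge_iff_le, max_le_iff] at hK
  have hK0 : (0 : ℝ) < K := by have := i.pos; positivity
  have e : SPT.sepEst (discreteBandwidth δ K) (F K) i j k l
      = SPT.dTrace₁ (discreteBandwidth δ K) (F K) i k / K
        * (SPT.dTrace₂ (discreteBandwidth δ K) (F K) j l / K
          / (SPT.dTrace (discreteBandwidth δ K) (F K) / (K : ℝ) ^ 2)) := by
    unfold SPT.sepEst
    field_simp
  dsimp only
  rw [e]
  refine le_trans (abs_mul_div_sub_le hτ hη1 hη2 (B := B) ?_ ?_ hτdef.le
    (h₁ K hK.1.1 i k t t' hi hk) (h₂ K hK.1.2 j l s s' hj hl) (h₃ K hK.2)) hη3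
  · exact (hB₁ (t, t') ⟨hi.1, hk.1⟩).trans ((le_max_left _ _).trans (le_max_left _ _))
  · exact (hB₂ (s, s') ⟨hj.1, hl.1⟩).trans ((le_max_right _ _).trans (le_max_left _ _))

end Traces

/-! ### Distance of the discretisation of a non-stationary kernel to the stationary tensors -/

/-- Boxes of index pairs with prescribed lags near a given pair of points. -/
lemma exists_index_box {K m : ℕ} (hK : 0 < K) (hm : m ≤ K) (h : ℝ) :
    ∃ lag : Fin m × Fin m → ℕ, ∀ t ∈ Icc (0 : ℝ) 1, ∀ t' ∈ Icc (0 : ℝ) 1, |t - t'| = h →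
      ∃ I : Fin m × Fin m → Fin K × Fin K, Function.Injective I ∧
        (∀ a, (((I a).1 : ℤ) - ((I a).2 : ℤ)).natAbs = lag a) ∧
        ∀ a, |t - ((I a).1 : ℝ) / K| ≤ (m + 2) / K ∧ |t' - ((I a).2 : ℝ) / K| ≤ (m + 2) / K := by
  have hK' : (0 : ℝ) < K := by exact_mod_cast hK
  -- Scaling the unit interval by `K - m` instead of `K` leaves room for `m` consecutive indices
  -- beyond every base index and displaces points by at most `m / K`.
  set P : ℝ := ((K - m : ℕ) : ℝ) with hP
  have hPe : P = K - m := by rw [hP, Nat.cast_sub hm]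
  have hP0 : 0 ≤ P := Nat.cast_nonneg _
  -- The offset is rounded from the distance `h` alone, not from the points. Two pairs of points at
  -- the same distance thus receive boxes with identical lags.
  set g : ℕ := ⌊P * h⌋₊ with hg
  refine ⟨fun a => ((g : ℤ) + (a.2 : ℤ) - (a.1 : ℤ)).natAbs, ?_⟩
  -- the case of ordered points
  have key : ∀ t ∈ Icc (0 : ℝ) 1, ∀ t' ∈ Icc (0 : ℝ) 1, t ≤ t' → t' - t = h →
      ∃ u w : Fin m → Fin K, Function.Injective u ∧ Function.Injective w ∧
        (∀ a b, ((w b : ℤ) - (u a : ℤ)) = (g : ℤ) + (b : ℤ) - (a : ℤ)) ∧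
        (∀ a, |t - (u a : ℝ) / K| ≤ (m + 2) / K) ∧ ∀ b, |t' - (w b : ℝ) / K| ≤ (m + 2) / K := by
    intro t ht t' ht' htt hh
    have hh0 : 0 ≤ h := by linarith
    set base : ℕ := ⌊P * t⌋₊ with hbase
    have b1 : (base : ℝ) ≤ P * t := Nat.floor_le (mul_nonneg hP0 ht.1)
    have b2 : P * t < base + 1 := Nat.lt_floor_add_one _
    have g1 : (g : ℝ) ≤ P * h := Nat.floor_le (mul_nonneg hP0 hh0)
    have g2 : P * h < g + 1 := Nat.lt_floor_add_one _
    have hPt : P * t + P * h = P * t' := by rw [← hh]; ring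
    have hPt' : P * t' ≤ P := mul_le_of_le_one_right hP0 ht'.2
    -- Rounding base and offset down separately is harmless: their sum is at most `P * t'`, hence at
    -- most `K - m`.
    have hbg : base + g + m ≤ K := by
      have : ((base + g + m : ℕ) : ℝ) ≤ K := by push_cast; linarith
      exact_mod_cast this
    have hmt : 0 ≤ (m : ℝ) * t := mul_nonneg (Nat.cast_nonneg _) ht.1
    have hmt1 : (m : ℝ) * t ≤ m := mul_le_of_le_one_right (Nat.cast_nonneg _) ht.2
    have hmt' : 0 ≤ (m : ℝ) * t' := mul_nonneg (Nat.cast_nonneg _) ht'.1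
    have hmt1' : (m : ℝ) * t' ≤ m := mul_le_of_le_one_right (Nat.cast_nonneg _) ht'.2
    refine ⟨fun a => ⟨base + a, by omega⟩, fun b => ⟨base + g + b, by omega⟩, ?_, ?_, ?_, ?_, ?_⟩
    · intro a a' h'
      simp only [Fin.mk.injEq] at h'
      exact Fin.ext (by omega)
    · intro a a' h'
      simp only [Fin.mk.injEq] at h'
      exact Fin.ext (by omega)
    · intro a b
      push_cast
      ring
    · intro a
      have ha : ((a : ℕ) : ℝ) ≤ m := by exact_mod_cast a.2.le
      have ha0 : (0 : ℝ) ≤ ((a : ℕ) : ℝ) := Nat.cast_nonneg _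
      have : t - (((⟨base + a, by omega⟩ : Fin K) : ℕ) : ℝ) / K = (K * t - (base + a)) / K := by
        push_cast; field_simp
      rw [this, abs_div, abs_of_pos hK']
      refine div_le_div_of_nonneg_right ?_ hK'.le
      have hKt : (K : ℝ) * t = P * t + m * t := by rw [hPe]; ring
      rw [abs_le, hKt]
      constructor <;> linarith
    · intro b
      have ha : ((b : ℕ) : ℝ) ≤ m := by exact_mod_cast b.2.le
      have ha0 : (0 : ℝ) ≤ ((b : ℕ) : ℝ) := Nat.cast_nonneg _
      have : t' - (((⟨base + g + b, by omega⟩ : Fin K) : ℕ) : ℝ) / K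
          = (K * t' - (base + g + b)) / K := by
        push_cast; field_simp
      rw [this, abs_div, abs_of_pos hK']
      refine div_le_div_of_nonneg_right ?_ hK'.le
      have hKt : (K : ℝ) * t' = P * t + P * h + m * t' := by rw [hPt, hPe]; ring
      rw [abs_le, hKt]
      constructor <;> linarith
  intro t ht t' ht' hh
  rcases le_total t t' with htt | htt
  · obtain ⟨u, w, hu, hw, hlag, h1, h2⟩ := key t ht t' ht' htt
      (by rw [← hh, abs_sub_comm, abs_of_nonneg (by linarith)])
    refine ⟨fun a => (u a.1, w a.2), ?_, fun a => ?_, fun a => ⟨h1 a.1, h2 a.2⟩⟩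
    · intro a a' h'
      simp only [Prod.mk.injEq] at h'
      exact Prod.ext (hu h'.1) (hw h'.2)
    · dsimp only
      rw [← hlag, ← Int.natAbs_neg, neg_sub]
  · obtain ⟨u, w, hu, hw, hlag, h1, h2⟩ := key t' ht' t ht htt
      (by rw [← hh, abs_of_nonneg (by linarith)])
    refine ⟨fun a => (w a.2, u a.1), ?_, fun a => ?_, fun a => ⟨h2 a.2, h1 a.1⟩⟩
    · intro a a' h'
      simp only [Prod.mk.injEq] at h'
      exact Prod.ext (hu h'.2) (hw h'.1)
    · dsimp only
      rw [← hlag]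

lemma norm_tensorVec_sq {K : ℕ} (M : Tensor K) :
    ‖tensorVec M‖ ^ 2 = (∑ v : Idx K, M v.1 v.2.1 v.2.2.1 v.2.2.2 ^ 2) / (K : ℝ) ^ 4 := by
  rw [norm_sq_eq_sum, Finset.sum_div]
  refine Finset.sum_congr rfl fun v _ => ?_
  rw [tensorVec_apply]
  ring

/-- Only `K ^ 2` of the `K ^ 4` entries are diagonal, so restoring the diagonal of a bounded tensor
costs a vanishing amount. -/
lemma norm_tensorVec_sq_le_starVec {K : ℕ} (hK : 0 < K) {M : Tensor K} {B : ℝ}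
    (hB : ∀ i j k l, |M i j k l| ≤ B) :
    ‖tensorVec M‖ ^ 2 ≤ ‖starVec M‖ ^ 2 + B ^ 2 / K := by
  have hK' : (1 : ℝ) ≤ K := by exact_mod_cast hK
  rw [norm_sq_eq_sum, norm_sq_eq_sum]
  have h1 : ∀ v : Idx K, tensorVec M v ^ 2 ≤ starVec M v ^ 2
      + if (v.1, v.2.1) = (v.2.2.1, v.2.2.2) then B ^ 2 / (K : ℝ) ^ 4 else 0 := by
    intro v
    rw [tensorVec_apply, starVec_apply]
    by_cases hv : (v.1, v.2.1) = (v.2.2.1, v.2.2.2)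
    · rw [if_neg (by simpa using hv), if_pos hv]
      have h2 : M v.1 v.2.1 v.2.2.1 v.2.2.2 ^ 2 ≤ B ^ 2 := by
        rw [← sq_abs]
        exact pow_le_pow_left₀ (abs_nonneg _) (hB _ _ _ _) 2
      rw [div_pow, ← pow_mul, zero_pow two_ne_zero, zero_add]
      gcongr
    · rw [if_pos hv, if_neg hv, add_zero]
  refine (Finset.sum_le_sum fun v _ => h1 v).trans ?_
  rw [Finset.sum_add_distrib]
  refine add_le_add_right ?_ _
  have e : ∑ v : Idx K, (if (v.1, v.2.1) = (v.2.2.1, v.2.2.2) then B ^ 2 / (K : ℝ) ^ 4 else 0)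
      = (K : ℝ) ^ 2 * (B ^ 2 / (K : ℝ) ^ 4) := by
    rw [mul_sum_four (fun i j k l => if (i, j) = (k, l) then B ^ 2 / (K : ℝ) ^ 4 else 0)]
    simp only [Prod.mk.injEq, ite_and, Finset.sum_ite_irrel, Finset.sum_const_zero,
      Finset.sum_ite_eq, Finset.mem_univ, if_true, Finset.sum_const, Finset.card_univ,
      Fintype.card_fin, nsmul_eq_mul]
    ring
  rw [e]
  rw [mul_div_assoc', div_le_div_iff₀ (by positivity) (by positivity)]
  have h3 : (K : ℝ) ^ 2 * K ≤ (K : ℝ) ^ 4 := by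
    calc (K : ℝ) ^ 2 * K = (K : ℝ) ^ 3 := by ring
      _ ≤ (K : ℝ) ^ 4 := pow_le_pow_right₀ hK' (by norm_num)
  nlinarith [sq_nonneg B]

lemma abs_dToeplitzAvg_le {K : ℕ} {M : Tensor K} {B : ℝ} (hB : ∀ i j k l, |M i j k l| ≤ B)
    (i j k l : Fin K) : |dToeplitzAvg M i j k l| ≤ B := by
  have hpos : (0 : ℝ) < (lagClass i j k l).card := by exact_mod_cast lagClass_card_pos i j k l
  rw [dToeplitzAvg, abs_div, Nat.abs_cast, div_le_iff₀ hpos]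
  refine (Finset.abs_sum_le_sum_abs _ _).trans ((Finset.sum_le_sum fun q _ => hB _ _ _ _).trans ?_)
  rw [Finset.sum_const, nsmul_eq_mul, mul_comm]

lemma dToeplitzAvg_eq_of_mem {K : ℕ} (M : Tensor K) {i j k l : Fin K} {q : Idx K}
    (h : q ∈ lagClass i j k l) :
    dToeplitzAvg M q.1 q.2.1 q.2.2.1 q.2.2.2 = dToeplitzAvg M i j k l := by
  unfold dToeplitzAvg
  rw [lagClass_eq_of_mem h]

/-- A box of indices of side `m` on which the tensor changes by at least `η` within the lag
classes forces a distance to the stationary tensors. -/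
lemma le_norm_tensorVec_of_boxes {K m : ℕ} {M : Tensor K} {η : ℝ} (hη : 0 ≤ η)
    {J J' : (Fin m × Fin m) × (Fin m × Fin m) → Idx K} (hJ : Function.Injective J)
    (hJ' : Function.Injective J')
    (hlag : ∀ a, J a ∈ lagClass (J' a).1 (J' a).2.1 (J' a).2.2.1 (J' a).2.2.2)
    (hM : ∀ a, η ≤ |M (J a).1 (J a).2.1 (J a).2.2.1 (J a).2.2.2
      - M (J' a).1 (J' a).2.1 (J' a).2.2.1 (J' a).2.2.2|) :
    η ^ 2 / 4 * (m / K : ℝ) ^ 4 ≤ ‖tensorVec (dToeplitzAvg M - M)‖ ^ 2 := by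
  rw [norm_tensorVec_sq]
  set E : Idx K → ℝ := fun v => (dToeplitzAvg M - M) v.1 v.2.1 v.2.2.1 v.2.2.2 ^ 2 with hE
  have h1 : ∀ a, η ^ 2 / 2 ≤ E (J a) + E (J' a) := by
    intro a
    have e := dToeplitzAvg_eq_of_mem M (hlag a)
    simp only [hE, Pi.sub_apply]
    rw [e]
    set x := M (J a).1 (J a).2.1 (J a).2.2.1 (J a).2.2.2
    set y := M (J' a).1 (J' a).2.1 (J' a).2.2.1 (J' a).2.2.2
    set z := dToeplitzAvg M (J' a).1 (J' a).2.1 (J' a).2.2.1 (J' a).2.2.2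
    have h2 : η ^ 2 ≤ (x - y) ^ 2 := by
      rw [← sq_abs (x - y)]
      exact pow_le_pow_left₀ hη (hM a) 2
    -- The average takes one value `z` at both entries, and `2 ((z - x)² + (z - y)²) = (x - y)² + (2
    -- z - x - y)²`.
    nlinarith [sq_nonneg ((z - x) + (z - y))]
  have hle : ∀ J : (Fin m × Fin m) × (Fin m × Fin m) → Idx K, Function.Injective J →
      ∑ a, E (J a) ≤ ∑ v, E v := by
    intro J hJ
    rw [← Finset.sum_image (f := E) (s := Finset.univ) (g := J) fun a _ b _ h => hJ h]
    exact Finset.sum_le_sum_of_subset_of_nonneg (Finset.subset_univ _) fun v _ _ => sq_nonneg _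
  have h3 : (m : ℝ) ^ 4 * (η ^ 2 / 2) ≤ 2 * ∑ v, E v := by
    calc (m : ℝ) ^ 4 * (η ^ 2 / 2)
        = ∑ _a : (Fin m × Fin m) × (Fin m × Fin m), η ^ 2 / 2 := by
          simp only [Finset.sum_const, Finset.card_univ, Fintype.card_prod, Fintype.card_fin,
            nsmul_eq_mul]
          push_cast
          ring
      _ ≤ ∑ a, (E (J a) + E (J' a)) := Finset.sum_le_sum fun a _ => h1 a
      _ ≤ 2 * ∑ v, E v := by
          rw [Finset.sum_add_distrib]
          linarith [hle J hJ, hle J' hJ']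
  rw [div_pow, mul_div_assoc']
  gcongr
  linarith

lemma Approximates.exists_bound {F : (K : ℕ) → Tensor K} {f : Kernel4} (hF : Approximates F f)
    (hf : IsContKernel f) : ∃ B, 0 ≤ B ∧ ∃ K₀ : ℕ, ∀ K ≥ K₀, ∀ i j k l, |F K i j k l| ≤ B := by
  obtain ⟨B, hB0, hB⟩ := hf.exists_bound
  obtain ⟨K₀, h⟩ := hF 1 one_pos
  refine ⟨B + 1, by positivity, K₀, fun K hK i j k l => ?_⟩
  have h1 := h K hK i j k l _ _ _ _ (isNear_left i) (isNear_left j) (isNear_left k) (isNear_left l)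
  have h2 := hB _ (isNear_left i).1 _ (isNear_left j).1 _ (isNear_left k).1 _ (isNear_left l).1
  have h3 := abs_sub_abs_le_abs_sub (F K i j k l) (f (i / K) (j / K) (k / K) (l / K))
  linarith

/-- Two points of the cube have the same absolute lags. -/
def SameLags (z w : (ℝ × ℝ) × (ℝ × ℝ)) : Prop :=
  |z.1.1 - z.2.1| = |w.1.1 - w.2.1| ∧ |z.1.2 - z.2.2| = |w.1.2 - w.2.2|

/-- A kernel is a function of the absolute lags on the cube. -/
def IsStationaryOnCube (f : Kernel4) : Prop :=
  ∀ z ∈ cube, ∀ w ∈ cube, SameLags z w → f z.1.1 z.1.2 z.2.1 z.2.2 = f w.1.1 w.1.2 w.2.1 w.2.2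

/-- One box per coordinate. The lag functions depend only on the distances shared by `z` and `w`, so
corresponding entries fall into the same lag class. -/
lemma exists_boxes {K m : ℕ} (hK : 0 < K) (hm : m ≤ K) {z w : (ℝ × ℝ) × (ℝ × ℝ)} (hz : z ∈ cube)
    (hw : w ∈ cube) (hzw : SameLags z w) :
    ∃ J J' : (Fin m × Fin m) × (Fin m × Fin m) → Idx K, Function.Injective J ∧
      Function.Injective J' ∧
      (∀ a, J a ∈ lagClass (J' a).1 (J' a).2.1 (J' a).2.2.1 (J' a).2.2.2) ∧
      (∀ a, dist z ((((J a).1 : ℝ) / K, ((J a).2.1 : ℝ) / K),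
        (((J a).2.2.1 : ℝ) / K, ((J a).2.2.2 : ℝ) / K)) ≤ (m + 2) / K) ∧
      ∀ a, dist w ((((J' a).1 : ℝ) / K, ((J' a).2.1 : ℝ) / K),
        (((J' a).2.2.1 : ℝ) / K, ((J' a).2.2.2 : ℝ) / K)) ≤ (m + 2) / K := by
  obtain ⟨lag₁, h₁⟩ := exists_index_box hK hm |z.1.1 - z.2.1|
  obtain ⟨lag₂, h₂⟩ := exists_index_box hK hm |z.1.2 - z.2.2|
  obtain ⟨I₁, hI₁, l₁, n₁⟩ := h₁ _ hz.1.1 _ hz.2.1 rfl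
  obtain ⟨I₂, hI₂, l₂, n₂⟩ := h₂ _ hz.1.2 _ hz.2.2 rfl
  obtain ⟨I₁', hI₁', l₁', n₁'⟩ := h₁ _ hw.1.1 _ hw.2.1 hzw.1.symm
  obtain ⟨I₂', hI₂', l₂', n₂'⟩ := h₂ _ hw.1.2 _ hw.2.2 hzw.2.symm
  have hinj : ∀ I I' : Fin m × Fin m → Fin K × Fin K, Function.Injective I →
      Function.Injective I' → Function.Injective fun a : (Fin m × Fin m) × (Fin m × Fin m) =>
        (((I a.1).1, (I' a.2).1, (I a.1).2, (I' a.2).2) : Idx K) := by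
    intro I I' hI hI' a b hab
    simp only [Prod.mk.injEq] at hab
    exact Prod.ext (hI (Prod.ext hab.1 hab.2.2.1)) (hI' (Prod.ext hab.2.1 hab.2.2.2))
  refine ⟨fun a => ((I₁ a.1).1, (I₂ a.2).1, (I₁ a.1).2, (I₂ a.2).2),
    fun a => ((I₁' a.1).1, (I₂' a.2).1, (I₁' a.1).2, (I₂' a.2).2), hinj _ _ hI₁ hI₂,
    hinj _ _ hI₁' hI₂', fun a => ?_, fun a => ?_, fun a => ?_⟩
  · rw [mem_lagClass]
    exact ⟨(l₁ a.1).trans (l₁' a.1).symm, (l₂ a.2).trans (l₂' a.2).symm⟩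
  · simp only [Prod.dist_eq, Real.dist_eq, max_le_iff]
    exact ⟨⟨(n₁ a.1).1, (n₂ a.2).1⟩, (n₁ a.1).2, (n₂ a.2).2⟩
  · simp only [Prod.dist_eq, Real.dist_eq, max_le_iff]
    exact ⟨⟨(n₁' a.1).1, (n₂' a.2).1⟩, (n₁' a.1).2, (n₂' a.2).2⟩

/-- Two points with equal lags but different values of `f` are surrounded by boxes on which the
discretised values still differ by a fixed amount. Matched entries share a lag class and the boxes
fill a fixed fraction of all indices, so the distance to the stationary tensors does not vanish as
`K` grows. -/
theorem Approximates.exists_le_of_not_stationary {F : (K : ℕ) → Tensor K} {f : Kernel4}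
    (hF : Approximates F f) (hf : IsContKernel f) (hns : ¬ IsStationaryOnCube f) :
    ∃ κ > 0, ∃ K₀ : ℕ, ∀ K ≥ K₀, κ ≤ ‖starVec (dToeplitzAvg (F K) - F K)‖ ^ 2 := by
  unfold IsStationaryOnCube at hns
  push Not at hns
  obtain ⟨z, hz, w, hw, hzw, hne⟩ := hns
  set η := |f z.1.1 z.1.2 z.2.1 z.2.2 - f w.1.1 w.1.2 w.2.1 w.2.2| with hη
  have hη0 : 0 < η := abs_pos.2 (sub_ne_zero.2 hne)
  obtain ⟨ρ, hρ, hmod⟩ := hf.exists_modulus (by positivity : 0 < η / 8)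
  obtain ⟨B, hB0, K₁, hB⟩ := hF.exists_bound hf
  obtain ⟨K₂, h₂⟩ := hF (η / 8) (by positivity)
  -- One quarter of `ρ` is for the side of the box and another for the rounding error `2 / K`; the
  -- bound `1` makes the box fit into the grid.
  set r := min (ρ / 4) 1 with hr
  have hr0 : 0 < r := by positivity
  -- The constant of `le_norm_tensorVec_of_boxes` for values at least `η / 2` apart and boxes of
  -- side at least `r K / 2`. Half of it is given up below to remove the diagonal.
  set κ := (η / 2) ^ 2 / 4 * (r / 2) ^ 4 with hκ
  have hκ0 : 0 < κ := by positivity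
  obtain ⟨K₃, h₃⟩ := exists_nat_forall_div_le ((2 * B) ^ 2) (half_pos hκ0)
  obtain ⟨K₄, h₄⟩ := exists_nat_forall_div_le 2 (by positivity : 0 < ρ / 4)
  obtain ⟨K₅, h₅⟩ := exists_nat_forall_div_le 1 (by positivity : 0 < r / 2)
  refine ⟨κ / 2, half_pos hκ0, max (max K₁ K₂) (max K₃ (max K₄ K₅)), fun K hK => ?_⟩
  simp only [ge_iff_le, max_le_iff] at hK
  obtain ⟨⟨hK1, hK2⟩, hK3, hK4, hK5⟩ := hK
  obtain ⟨hK0, hKB⟩ := h₃ K hK3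
  have hK' : (0 : ℝ) < K := by exact_mod_cast hK0
  set m : ℕ := ⌊r * K⌋₊ with hm
  have hm1 : (m : ℝ) ≤ r * K := Nat.floor_le (by positivity)
  have hm2 : r * K < m + 1 := Nat.lt_floor_add_one _
  have hmK : m ≤ K := by
    have : (m : ℝ) ≤ K := hm1.trans (mul_le_of_le_one_left hK'.le (min_le_right _ _))
    exact_mod_cast this
  have hmr : r / 2 ≤ m / K := by
    have := (h₅ K hK5).2
    rw [div_le_iff₀ hK'] at this
    rw [le_div_iff₀ hK']
    linarith
  have hclose : ((m : ℝ) + 2) / K < ρ := by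
    have h1 := (h₄ K hK4).2
    have h2 : (m : ℝ) / K ≤ r := by rwa [div_le_iff₀ hK']
    have h3 : r ≤ ρ / 4 := min_le_left _ _
    rw [add_div]
    linarith
  obtain ⟨J, J', hJ, hJ', hlag, hd, hd'⟩ := exists_boxes hK0 hmK hz hw hzw
  have hpt : ∀ (x : (ℝ × ℝ) × (ℝ × ℝ)) (v : Idx K), x ∈ cube →
      dist x (((v.1 : ℝ) / K, (v.2.1 : ℝ) / K), ((v.2.2.1 : ℝ) / K, (v.2.2.2 : ℝ) / K))
        ≤ (m + 2) / K →
      |F K v.1 v.2.1 v.2.2.1 v.2.2.2 - f x.1.1 x.1.2 x.2.1 x.2.2| ≤ η / 4 := by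
    intro x v hx hxv
    have n1 := isNear_left v.1
    have n2 := isNear_left v.2.1
    have n3 := isNear_left v.2.2.1
    have n4 := isNear_left v.2.2.2
    have a := h₂ K hK2 v.1 v.2.1 v.2.2.1 v.2.2.2 _ _ _ _ n1 n2 n3 n4
    have b := hmod x hx (((v.1 : ℝ) / K, (v.2.1 : ℝ) / K), ((v.2.2.1 : ℝ) / K, (v.2.2.2 : ℝ) / K))
      ⟨⟨n1.1, n2.1⟩, n3.1, n4.1⟩ (hxv.trans_lt hclose)
    simp only at b
    rw [abs_sub_comm] at b
    calc _ ≤ _ := abs_sub_le _ (f (v.1 / K) (v.2.1 / K) (v.2.2.1 / K) (v.2.2.2 / K)) _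
      _ ≤ η / 4 := by linarith
  have hbox := le_norm_tensorVec_of_boxes (M := F K) (η := η / 2) (by positivity) hJ hJ' hlag
    fun a => by
      have a1 := hpt z (J a) hz (hd a)
      have a2 := hpt w (J' a) hw (hd' a)
      have e : η = |f z.1.1 z.1.2 z.2.1 z.2.2 - f w.1.1 w.1.2 w.2.1 w.2.2| := hη
      set x := F K (J a).1 (J a).2.1 (J a).2.2.1 (J a).2.2.2
      set y := F K (J' a).1 (J' a).2.1 (J' a).2.2.1 (J' a).2.2.2
      set u := f z.1.1 z.1.2 z.2.1 z.2.2
      set v := f w.1.1 w.1.2 w.2.1 w.2.2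
      have t1 := abs_sub_le u x v
      have t2 := abs_sub_le x y v
      rw [abs_sub_comm u x] at t1
      linarith
  have hκle : κ ≤ ‖tensorVec (dToeplitzAvg (F K) - F K)‖ ^ 2 := by
    refine le_trans ?_ hbox
    rw [hκ]
    gcongr
  have hfin := norm_tensorVec_sq_le_starVec hK0 (M := dToeplitzAvg (F K) - F K) (B := 2 * B)
    fun i j k l => by
      simp only [Pi.sub_apply]
      refine (abs_sub _ _).trans ?_
      linarith [abs_dToeplitzAvg_le (hB K hK1) i j k l, hB K hK1 i j k l]
  linarith

/-! ### Separation of the candidate bandwidths -/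

lemma exists_uniform_of_forall_mem {Δ : Finset ℝ} {P : ℝ → ℝ → ℕ → Prop}
    (hmono : ∀ δ κ κ' K, 0 < κ' → κ' ≤ κ → P δ κ K → P δ κ' K)
    (h : ∀ δ ∈ Δ, ∃ κ > 0, ∃ K₀ : ℕ, ∀ K ≥ K₀, P δ κ K) :
    ∃ κ > 0, ∃ K₀ : ℕ, ∀ K ≥ K₀, ∀ δ ∈ Δ, P δ κ K := by
  induction Δ using Finset.induction_on with
  | empty => exact ⟨1, one_pos, 0, fun K _ δ hδ => by simp at hδ⟩
  | insert δ₀ Δ hδ₀ ih =>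
    obtain ⟨κ₁, hκ₁, K₁, h₁⟩ := h δ₀ (Finset.mem_insert_self _ _)
    obtain ⟨κ₂, hκ₂, K₂, h₂⟩ := ih fun δ hδ => h δ (Finset.mem_insert_of_mem hδ)
    refine ⟨min κ₁ κ₂, by positivity, max K₁ K₂, fun K hK δ hδ => ?_⟩
    rw [ge_iff_le, max_le_iff] at hK
    rcases Finset.mem_insert.1 hδ with rfl | hδ
    · exact hmono _ _ _ _ (by positivity) (min_le_left _ _) (h₁ K hK.1)
    · exact hmono _ _ _ _ (by positivity) (min_le_right _ _) (h₂ K hK.2 δ hδ)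

lemma IsTame.norm_le {K : ℕ} {ι : Type*} [Fintype ι] {φ : Tensor K →ₗ[ℝ] EuclideanSpace ℝ ι}
    (hφ : IsTame φ) {M : Tensor K} {B : ℝ} (hB0 : 0 ≤ B) (hB : ∀ i j k l, |M i j k l| ≤ B) :
    ‖φ M‖ ≤ B := by
  obtain ⟨q, hq0, -, hq1, hq⟩ := hφ.weight
  refine le_of_sq_le_sq ((hq M).trans ?_) hB0
  calc ∑ v : Idx K, q v * M v.1 v.2.1 v.2.2.1 v.2.2.2 ^ 2 ≤ ∑ v : Idx K, q v * B ^ 2 := by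
        refine Finset.sum_le_sum fun v _ => mul_le_mul_of_nonneg_left ?_ (hq0 v)
        rw [← sq_abs]
        exact pow_le_pow_left₀ (abs_nonneg _) (hB _ _ _ _) 2
    _ = (∑ v, q v) * B ^ 2 := by rw [Finset.sum_mul]
    _ ≤ B ^ 2 := mul_le_of_le_one_left (sq_nonneg _) hq1

lemma bandSeminorm_le {K d : ℕ} (hd : 0 < d) {M : Tensor K} {B : ℝ} (hB0 : 0 ≤ B)
    (hB : ∀ i j k l, |M i j k l| ≤ B) : bandSeminorm d M ≤ 4 * B := by
  rw [bandSeminorm_apply]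
  linarith [isTame_starVec.norm_le hB0 hB, (isTame_trace₁Vec hd).norm_le hB0 hB,
    (isTame_trace₂Vec hd).norm_le hB0 hB, (isTame_traceVec hd).norm_le hB0 hB]

/-- The traces involve only entries with a lag equal to `d`, where `M` factorises. Each partial
trace is one factor times the shifted sum of the other, and the product of the two shifted sums is
the trace, which cancels. -/
lemma sepEst_eq_of_product {K d : ℕ} {M : Tensor K} {α₁ α₂ : Fin K → Fin K → ℝ}
    (hM : ∀ i j k l : Fin K, (k : ℕ) = i + d ∨ (l : ℕ) = j + d → M i j k l = α₁ i k * α₂ j l)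
    (hT : dTrace d M ≠ 0) : sepEst d M = fun i j k l => α₁ i k * α₂ j l := by
  have h1 : ∀ i k, dTrace₁ d M i k = α₁ i k * shiftSum d α₂ := by
    intro i k
    rw [dTrace₁_eq, ← shiftSum_mul_left]
    exact shiftSum_congr fun j l hl => hM i j k l (Or.inr hl)
  have h2 : ∀ j l, dTrace₂ d M j l = shiftSum d α₁ * α₂ j l := by
    intro j l
    rw [dTrace₂_eq, ← shiftSum_mul_right]
    exact shiftSum_congr fun i k hk => hM i j k l (Or.inl hk)
  have h3 : dTrace d M = shiftSum d α₁ * shiftSum d α₂ := by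
    rw [dTrace_eq, ← shiftSum_mul_right]
    exact shiftSum_congr fun i k _ => h1 i k
  ext i j k l
  rw [h3] at hT
  rw [sepEst, h1, h2, h3]
  have := left_ne_zero_of_mul hT
  have := right_ne_zero_of_mul hT
  field_simp

lemma abs_dToeplitzAvg_sub_le {K : ℕ} {M : Tensor K} {ε : ℝ} {i j k l : Fin K}
    (h : ∀ q ∈ lagClass i j k l, |M q.1 q.2.1 q.2.2.1 q.2.2.2 - M i j k l| ≤ ε) :
    |dToeplitzAvg M i j k l - M i j k l| ≤ ε := by
  have hpos : (0 : ℝ) < (lagClass i j k l).card := by exact_mod_cast lagClass_card_pos i j k l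
  have e : dToeplitzAvg M i j k l - M i j k l
      = (∑ q ∈ lagClass i j k l, (M q.1 q.2.1 q.2.2.1 q.2.2.2 - M i j k l))
        / ((lagClass i j k l).card : ℝ) := by
    rw [Finset.sum_sub_distrib, Finset.sum_const, nsmul_eq_mul, sub_div, dToeplitzAvg]
    field_simp
  rw [e, abs_div, Nat.abs_cast, div_le_iff₀ hpos]
  refine (Finset.abs_sum_le_sum_abs _ _).trans ((Finset.sum_le_sum h).trans ?_)
  rw [Finset.sum_const, nsmul_eq_mul, mul_comm]

/-- The left ends of cells whose indices share a lag class have exactly equal lags, so `f` agrees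
there and the entries of a class differ only by approximation errors. -/
lemma Approximates.exists_dToeplitzAvg_sub_le {F : (K : ℕ) → Tensor K} {f : Kernel4}
    (hF : Approximates F f) (hf : IsStationaryOnCube f) {ε : ℝ} (hε : 0 < ε) :
    ∃ K₀ : ℕ, ∀ K ≥ K₀, ‖starVec (dToeplitzAvg (F K) - F K)‖ ≤ ε := by
  obtain ⟨K₀, h⟩ := hF (ε / 2) (by positivity)
  refine ⟨K₀, fun K hK => isTame_starVec.norm_le hε.le fun i j k l => ?_⟩
  refine abs_dToeplitzAvg_sub_le fun q hq => ?_
  have hK' : (0 : ℝ) < K := by have := i.pos; positivity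
  have n : ∀ i : Fin K, IsNear i ((i : ℝ) / K) := isNear_left
  have a := h K hK q.1 q.2.1 q.2.2.1 q.2.2.2 _ _ _ _ (n _) (n _) (n _) (n _)
  have b := h K hK i j k l _ _ _ _ (n _) (n _) (n _) (n _)
  have hlag : ∀ x y u v : Fin K, ((x : ℤ) - (y : ℤ)).natAbs = ((u : ℤ) - (v : ℤ)).natAbs →
      |(x : ℝ) / K - (y : ℝ) / K| = |(u : ℝ) / K - (v : ℝ) / K| := by
    intro x y u v hxy
    rw [← sub_div, ← sub_div, abs_div, abs_div]
    congr 1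
    have := Int.natAbs_eq_natAbs_iff.1 hxy
    rcases this with h' | h'
    · have h'' : ((x : ℕ) : ℝ) - (y : ℕ) = (u : ℕ) - (v : ℕ) := by exact_mod_cast h'
      rw [h'']
    · have h'' : ((x : ℕ) : ℝ) - (y : ℕ) = -((u : ℕ) - (v : ℕ)) := by exact_mod_cast h'
      rw [h'', abs_neg]
  rw [mem_lagClass] at hq
  have e := hf (((q.1 : ℝ) / K, (q.2.1 : ℝ) / K), ((q.2.2.1 : ℝ) / K, (q.2.2.2 : ℝ) / K))
    ⟨⟨(n _).1, (n _).1⟩, (n _).1, (n _).1⟩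
    (((i : ℝ) / K, (j : ℝ) / K), ((k : ℝ) / K, (l : ℝ) / K)) ⟨⟨(n _).1, (n _).1⟩, (n _).1, (n _).1⟩
    ⟨hlag _ _ _ _ hq.1, hlag _ _ _ _ hq.2⟩
  simp only at e
  rw [e] at a
  rw [abs_le] at *
  constructor <;> linarith [a.1, a.2, b.1, b.2]

/-- For good bandwidths the separable part is recovered exactly and the residual approximates a
stationary kernel; for bad ones the residual approximates a kernel that is not stationary.
Finiteness of `Δ` makes all constants uniform. -/
theorem exists_isSeparated {Δ : Finset ℝ} (hΔ : ∀ δ ∈ Δ, δ ∈ Ico (0 : ℝ) 1) {good : ℝ → Prop}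
    {c a : Kernel4} (hc : IsContKernel c) (hTr : ∀ δ ∈ Δ, shiftTrace δ c ≠ 0)
    (hstat : IsStationaryOnCube fun t s t' s' => c t s t' s' - a t s t' s')
    (hbad : ∀ δ ∈ Δ, ¬ good δ →
      ¬ IsStationaryOnCube fun t s t' s' => c t s t' s' - sepProxy δ c t s t' s')
    {C : (K : ℕ) → Tensor K} {α₁ α₂ : (K : ℕ) → Fin K → Fin K → ℝ} (hC : Approximates C c)
    (hα : Approximates (fun K i j k l => α₁ K i k * α₂ K j l) a)
    (hgood : ∀ δ ∈ Δ, good δ → ∀ (K : ℕ) (i j k l : Fin K),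
      (k : ℕ) = i + discreteBandwidth δ K ∨ (l : ℕ) = j + discreteBandwidth δ K →
        C K i j k l = α₁ K i k * α₂ K j l) :
    ∃ R τ κ : ℝ, 0 < τ ∧ 0 < κ ∧ ∃ K₀ : ℕ, ∀ K ≥ K₀, IsSeparated Δ good (C K) R τ κ ∧
      ∀ δ ∈ Δ, good δ → sepEst (discreteBandwidth δ K) (C K)
        = fun i j k l => α₁ K i k * α₂ K j l := by
  obtain ⟨B, hB0, K₁, hB⟩ := hC.exists_bound hc
  obtain ⟨τ, hτ, K₂, h₂⟩ := exists_uniform_of_forall_mem (Δ := Δ)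
    (P := fun δ τ K => τ ≤ |dTrace (discreteBandwidth δ K) (C K) / (K : ℝ) ^ 2|)
    (fun _ _ _ _ _ h h' => h.trans h') fun δ hδ => by
      have hpos : 0 < |shiftTrace δ c| := abs_pos.2 (hTr δ hδ)
      obtain ⟨K₀, h⟩ := hC.dTrace hc (hΔ δ hδ) (half_pos hpos)
      refine ⟨|shiftTrace δ c| / 2, half_pos hpos, K₀, fun K hK => ?_⟩
      have h1 := h K hK
      have h2 := abs_sub_abs_le_abs_sub (shiftTrace δ c)
        (dTrace (discreteBandwidth δ K) (C K) / (K : ℝ) ^ 2)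
      rw [abs_sub_comm] at h2
      linarith
  -- The error of the full estimator is exactly the failure of Toeplitz averaging to reproduce the
  -- residual, that is, the distance of the residual to stationarity.
  have hfull : ∀ δ K, starVec (fullEst (discreteBandwidth δ K) (C K)) - starVec (C K)
      = starVec (dToeplitzAvg (C K - sepEst (discreteBandwidth δ K) (C K))
        - (C K - sepEst (discreteBandwidth δ K) (C K))) := by
    intro δ K
    rw [← map_sub, fullEst_eq]
    congr 1
    abel
  obtain ⟨κ, hκ, K₃, h₃⟩ := exists_uniform_of_forall_mem (Δ := Δ)
    (P := fun δ κ K => ¬ good δ →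
      κ ≤ ‖starVec (fullEst (discreteBandwidth δ K) (C K)) - starVec (C K)‖ ^ 2)
    (fun _ _ _ _ _ h h' hg => h.trans (h' hg)) fun δ hδ => by
      by_cases hg : good δ
      · exact ⟨1, one_pos, 0, fun K _ h => absurd hg h⟩
      · have happ := hC.sub (hC.sepEst hc (hΔ δ hδ) (hTr δ hδ))
        have hcont : IsContKernel fun t s t' s' => c t s t' s' - sepProxy δ c t s t' s' :=
          Continuous.sub hc (isContKernel_sepProxy hc δ)
        obtain ⟨κ, hκ, K₀, h⟩ := happ.exists_le_of_not_stationary hcont (hbad δ hδ hg)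
        refine ⟨κ, hκ, K₀, fun K hK _ => ?_⟩
        rw [hfull]
        exact h K hK
  have hres : ∀ K ≥ K₂, ∀ δ ∈ Δ, good δ → sepEst (discreteBandwidth δ K) (C K)
        = fun i j k l => α₁ K i k * α₂ K j l := by
    intro K hK δ hδ hg
    refine sepEst_eq_of_product (hgood δ hδ hg K) fun h0 => ?_
    have := h₂ K hK δ hδ
    rw [h0, zero_div, abs_zero] at this
    linarith
  obtain ⟨K₄, h₄⟩ := (hC.sub hα).exists_dToeplitzAvg_sub_le hstat
    (Real.sqrt_pos.2 (by positivity : 0 < κ / 3))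
  -- The seminorm has four parts, each at most `B`. Dividing by three turns the lower bound `κ` for
  -- bad bandwidths into the gap that `IsSeparated` asks for.
  refine ⟨4 * B, τ, κ / 3, hτ, by positivity, max (max K₁ K₂) (max K₃ K₄), fun K hK => ?_⟩
  simp only [ge_iff_le, max_le_iff] at hK
  refine ⟨⟨fun δ _ => bandSeminorm_le (Nat.succ_pos _) hB0 (hB K hK.1.1), h₂ K hK.1.2,
    fun δ hδ hg => ?_, fun δ hδ hg => ?_⟩, hres K hK.1.2⟩
  · rw [hfull, hres K hK.1.2 δ hδ hg]
    have := pow_le_pow_left₀ (norm_nonneg _) (h₄ K hK.2.2) 2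
    rwa [Real.sq_sqrt (by positivity)] at this
  · have := h₃ K hK.2.1 δ hδ hg
    linarith

/-! ### Local means of kernels -/

section FourFold

variable {α₁ α₂ α₃ α₄ : Type*} [MeasurableSpace α₁] [MeasurableSpace α₂] [MeasurableSpace α₃]
  [MeasurableSpace α₄] {ν₁ : Measure α₁} {ν₂ : Measure α₂} {ν₃ : Measure α₃} {ν₄ : Measure α₄}

lemma integral_mul_four [SFinite ν₁] [SFinite ν₂] [SFinite ν₃] [SFinite ν₄] {u₁ : α₁ → ℝ}
    {u₂ : α₂ → ℝ} {u₃ : α₃ → ℝ} {u₄ : α₄ → ℝ} :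
    ∫ z : (α₁ × α₂) × (α₃ × α₄), u₁ z.1.1 * u₂ z.1.2 * (u₃ z.2.1 * u₄ z.2.2)
        ∂((ν₁.prod ν₂).prod (ν₃.prod ν₄))
      = (∫ x, u₁ x ∂ν₁) * (∫ x, u₂ x ∂ν₂) * ((∫ x, u₃ x ∂ν₃) * ∫ x, u₄ x ∂ν₄) := by
  rw [integral_prod_mul (fun p : α₁ × α₂ => u₁ p.1 * u₂ p.2) (fun q : α₃ × α₄ => u₃ q.1 * u₄ q.2),
    integral_prod_mul, integral_prod_mul]

lemma integrable_mul_four [SFinite ν₁] [SFinite ν₂] [SFinite ν₃] [SFinite ν₄] {u₁ : α₁ → ℝ}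
    {u₂ : α₂ → ℝ} {u₃ : α₃ → ℝ} {u₄ : α₄ → ℝ} (h₁ : Integrable u₁ ν₁) (h₂ : Integrable u₂ ν₂)
    (h₃ : Integrable u₃ ν₃) (h₄ : Integrable u₄ ν₄) :
    Integrable (fun z : (α₁ × α₂) × (α₃ × α₄) => u₁ z.1.1 * u₂ z.1.2 * (u₃ z.2.1 * u₄ z.2.2))
      ((ν₁.prod ν₂).prod (ν₃.prod ν₄)) :=
  (h₁.mul_prod h₂).mul_prod (h₃.mul_prod h₄)

lemma ae_prod_and [SFinite ν₂] [SFinite ν₁] {p₁ : α₁ → Prop} {p₂ : α₂ → Prop}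
    (h₁ : ∀ᵐ x ∂ν₁, p₁ x) (h₂ : ∀ᵐ x ∂ν₂, p₂ x) : ∀ᵐ z ∂(ν₁.prod ν₂), p₁ z.1 ∧ p₂ z.2 :=
  (Measure.quasiMeasurePreserving_fst.ae h₁).and (Measure.quasiMeasurePreserving_snd.ae h₂)

lemma integrable_sum_four [IsProbabilityMeasure ν₁] [IsProbabilityMeasure ν₂]
    [IsProbabilityMeasure ν₃] [IsProbabilityMeasure ν₄] {u₁ : α₁ → ℝ}
    {u₂ : α₂ → ℝ} {u₃ : α₃ → ℝ} {u₄ : α₄ → ℝ} (h₁ : Integrable u₁ ν₁) (h₂ : Integrable u₂ ν₂)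
    (h₃ : Integrable u₃ ν₃) (h₄ : Integrable u₄ ν₄) :
    Integrable (fun z : (α₁ × α₂) × (α₃ × α₄) => u₁ z.1.1 + u₂ z.1.2 + u₃ z.2.1 + u₄ z.2.2)
      ((ν₁.prod ν₂).prod (ν₃.prod ν₄)) ∧
    ∫ z : (α₁ × α₂) × (α₃ × α₄), (u₁ z.1.1 + u₂ z.1.2 + u₃ z.2.1 + u₄ z.2.2)
        ∂((ν₁.prod ν₂).prod (ν₃.prod ν₄))
      = ∫ x, u₁ x ∂ν₁ + ∫ x, u₂ x ∂ν₂ + ∫ x, u₃ x ∂ν₃ + ∫ x, u₄ x ∂ν₄ := by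
  have i1 : Integrable (fun z : (α₁ × α₂) × (α₃ × α₄) => u₁ z.1.1)
      ((ν₁.prod ν₂).prod (ν₃.prod ν₄)) := (h₁.comp_fst ν₂).comp_fst _
  have i2 : Integrable (fun z : (α₁ × α₂) × (α₃ × α₄) => u₂ z.1.2)
      ((ν₁.prod ν₂).prod (ν₃.prod ν₄)) := (h₂.comp_snd ν₁).comp_fst _
  have i3 : Integrable (fun z : (α₁ × α₂) × (α₃ × α₄) => u₃ z.2.1)
      ((ν₁.prod ν₂).prod (ν₃.prod ν₄)) := (h₃.comp_fst ν₄).comp_snd _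
  have i4 : Integrable (fun z : (α₁ × α₂) × (α₃ × α₄) => u₄ z.2.2)
      ((ν₁.prod ν₂).prod (ν₃.prod ν₄)) := (h₄.comp_snd ν₃).comp_snd _
  have i12 : Integrable (fun z : (α₁ × α₂) × (α₃ × α₄) => u₁ z.1.1 + u₂ z.1.2)
      ((ν₁.prod ν₂).prod (ν₃.prod ν₄)) := i1.add i2
  have i123 : Integrable (fun z : (α₁ × α₂) × (α₃ × α₄) => u₁ z.1.1 + u₂ z.1.2 + u₃ z.2.1)
      ((ν₁.prod ν₂).prod (ν₃.prod ν₄)) := i12.add i3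
  refine ⟨i123.add i4, ?_⟩
  rw [integral_add i123 i4, integral_add i12 i3, integral_add i1 i2]
  have e1 := integral_mul_four (ν₁ := ν₁) (ν₂ := ν₂) (ν₃ := ν₃) (ν₄ := ν₄) (u₁ := u₁)
    (u₂ := fun _ => 1) (u₃ := fun _ => 1) (u₄ := fun _ => 1)
  have e2 := integral_mul_four (ν₁ := ν₁) (ν₂ := ν₂) (ν₃ := ν₃) (ν₄ := ν₄) (u₁ := fun _ => 1)
    (u₂ := u₂) (u₃ := fun _ => 1) (u₄ := fun _ => 1)
  have e3 := integral_mul_four (ν₁ := ν₁) (ν₂ := ν₂) (ν₃ := ν₃) (ν₄ := ν₄) (u₁ := fun _ => 1)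
    (u₂ := fun _ => 1) (u₃ := u₃) (u₄ := fun _ => 1)
  have e4 := integral_mul_four (ν₁ := ν₁) (ν₂ := ν₂) (ν₃ := ν₃) (ν₄ := ν₄) (u₁ := fun _ => 1)
    (u₂ := fun _ => 1) (u₃ := fun _ => 1) (u₄ := u₄)
  simp only [mul_one, one_mul, integral_const, probReal_univ, smul_eq_mul] at e1 e2 e3 e4
  rw [e1, e2, e3, e4]

end FourFold

/-- A family of probability measures carried by the closed cells of the unit interval. -/
structure IsCellFamily {K : ℕ} (ν : Fin K → Measure ℝ) : Prop where
  prob : ∀ i, IsProbabilityMeasure (ν i)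
  mem : ∀ i : Fin K, ∀ᵐ t ∂(ν i), t ∈ Icc ((i : ℝ) / K) (((i : ℝ) + 1) / K)

/-- The product of four cell measures. -/
noncomputable def boxMeasure {K : ℕ} (ν ν' : Fin K → Measure ℝ) (i j k l : Fin K) :
    Measure ((ℝ × ℝ) × (ℝ × ℝ)) :=
  ((ν i).prod (ν' j)).prod ((ν k).prod (ν' l))

/-- The tensor of local means of a kernel. -/
noncomputable def meanTensor {K : ℕ} (ν ν' : Fin K → Measure ℝ) (f : Kernel4) : Tensor K :=
  fun i j k l => ∫ z, f z.1.1 z.1.2 z.2.1 z.2.2 ∂(boxMeasure ν ν' i j k l)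

/-- The matrix of local means of a function of two variables. -/
noncomputable def meanMatrix {K : ℕ} (ν : Fin K → Measure ℝ) (f : ℝ → ℝ → ℝ) (i k : Fin K) : ℝ :=
  ∫ t, ∫ t', f t t' ∂(ν k) ∂(ν i)

section Means

variable {K : ℕ} {ν ν' : Fin K → Measure ℝ}

lemma isProbabilityMeasure_boxMeasure (hν : IsCellFamily ν) (hν' : IsCellFamily ν')
    (i j k l : Fin K) : IsProbabilityMeasure (boxMeasure ν ν' i j k l) := by
  have := hν.prob
  have := hν'.prob
  unfold boxMeasure
  infer_instance

lemma ae_boxMeasure (hν : IsCellFamily ν) (hν' : IsCellFamily ν') (i j k l : Fin K) :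
    ∀ᵐ z ∂(boxMeasure ν ν' i j k l),
      (z.1.1 ∈ Icc ((i : ℝ) / K) (((i : ℝ) + 1) / K) ∧
        z.1.2 ∈ Icc ((j : ℝ) / K) (((j : ℝ) + 1) / K)) ∧
      z.2.1 ∈ Icc ((k : ℝ) / K) (((k : ℝ) + 1) / K) ∧
        z.2.2 ∈ Icc ((l : ℝ) / K) (((l : ℝ) + 1) / K) := by
  have := hν.prob
  have := hν'.prob
  exact ae_prod_and (ae_prod_and (hν.mem i) (hν'.mem j)) (ae_prod_and (hν.mem k) (hν'.mem l))

lemma ae_mem_cube (hν : IsCellFamily ν) (hν' : IsCellFamily ν') (i j k l : Fin K) :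
    ∀ᵐ z ∂(boxMeasure ν ν' i j k l), z ∈ cube := by
  filter_upwards [ae_boxMeasure hν hν' i j k l] with z hz
  exact ⟨⟨(isNear_of_mem hz.1.1).1, (isNear_of_mem hz.1.2).1⟩, (isNear_of_mem hz.2.1).1,
    (isNear_of_mem hz.2.2).1⟩

lemma memLp_boxMeasure (hν : IsCellFamily ν) (hν' : IsCellFamily ν') {f : Kernel4}
    (hf : IsContKernel f) (i j k l : Fin K) (p : ENNReal) :
    MemLp (fun z : (ℝ × ℝ) × (ℝ × ℝ) => f z.1.1 z.1.2 z.2.1 z.2.2) p (boxMeasure ν ν' i j k l) := by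
  have := isProbabilityMeasure_boxMeasure hν hν' i j k l
  obtain ⟨B, -, hB⟩ := hf.exists_bound
  refine MemLp.of_bound (Continuous.aestronglyMeasurable hf) B ?_
  filter_upwards [ae_mem_cube hν hν' i j k l] with z hz
  exact hB _ hz.1.1 _ hz.1.2 _ hz.2.1 _ hz.2.2

lemma integrable_boxMeasure (hν : IsCellFamily ν) (hν' : IsCellFamily ν') {f : Kernel4}
    (hf : IsContKernel f) (i j k l : Fin K) :
    Integrable (fun z : (ℝ × ℝ) × (ℝ × ℝ) => f z.1.1 z.1.2 z.2.1 z.2.2)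
      (boxMeasure ν ν' i j k l) :=
  memLp_one_iff_integrable.1 (memLp_boxMeasure hν hν' hf i j k l 1)

lemma abs_integral_sub_le {Ω : Type*} [MeasurableSpace Ω] {μ : Measure Ω} [IsProbabilityMeasure μ]
    {f : Ω → ℝ} (hf : Integrable f μ) {r ε : ℝ} (h : ∀ᵐ ω ∂μ, |f ω - r| ≤ ε) :
    |∫ ω, f ω ∂μ - r| ≤ ε := by
  have e : ∫ ω, f ω ∂μ - r = ∫ ω, (f ω - r) ∂μ := by
    rw [integral_sub hf (integrable_const _)]
    simp
  rw [e, ← Real.norm_eq_abs]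
  have h' : ∀ᵐ ω ∂μ, ‖f ω - r‖ ≤ ε := h
  simpa using norm_integral_le_of_norm_le_const h'

/-- Uniform continuity: a point of a cell and a point near its index differ by at most `1 / K + 3 /
K` in each coordinate. -/
lemma approximates_meanTensor {ν ν' : (K : ℕ) → Fin K → Measure ℝ}
    (hν : ∀ K, IsCellFamily (ν K)) (hν' : ∀ K, IsCellFamily (ν' K)) {f : Kernel4}
    (hf : IsContKernel f) : Approximates (fun K => meanTensor (ν K) (ν' K) f) f := by
  intro ε hε
  obtain ⟨ρ, hρ, hmod⟩ := hf.exists_modulus hε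
  obtain ⟨K₀, h₀⟩ := exists_nat_forall_div_le 4 (half_pos hρ)
  refine ⟨K₀, fun K hK i j k l t s t' s' hi hj hk hl => ?_⟩
  obtain ⟨hK0, hK4⟩ := h₀ K hK
  have hK' : (0 : ℝ) < K := by exact_mod_cast hK0
  have := isProbabilityMeasure_boxMeasure (hν K) (hν' K) i j k l
  refine abs_integral_sub_le (integrable_boxMeasure (hν K) (hν' K) hf i j k l) ?_
  filter_upwards [ae_boxMeasure (hν K) (hν' K) i j k l, ae_mem_cube (hν K) (hν' K) i j k l]
    with z hz hzc
  refine (hmod z hzc ((t, s), (t', s')) ⟨⟨hi.1, hj.1⟩, hk.1, hl.1⟩ ?_).le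
  have key : ∀ (m : Fin K) (x y : ℝ), x ∈ Icc ((m : ℝ) / K) (((m : ℝ) + 1) / K) → IsNear m y →
      dist x y < ρ := by
    intro m x y hx hy
    have h1 := hy.2
    have e1 : ((m : ℝ) + 1) / K = (m : ℝ) / K + 1 / K := by ring
    have e2 : (4 : ℝ) / K = 4 * (1 / K) := by ring
    have e3 : (3 : ℝ) / K = 3 * (1 / K) := by ring
    rw [e2] at hK4
    rw [abs_le, e3] at h1
    rw [Real.dist_eq, abs_lt]
    have e4 : (0 : ℝ) < 1 / K := by positivity
    rw [e1] at hx
    constructor <;> linarith [hx.1, hx.2, h1.1, h1.2]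
  simp only [Prod.dist_eq, max_lt_iff]
  exact ⟨⟨key i _ _ hz.1.1 hi, key j _ _ hz.1.2 hj⟩, key k _ _ hz.2.1 hk, key l _ _ hz.2.2 hl⟩

/-- Fubini. Continuity is needed for the product kernel only: `integral_prod_mul` asks for no
integrability, so nothing is required of `a₁` and `a₂` separately. -/
lemma meanTensor_sepKernel (hν : IsCellFamily ν) (hν' : IsCellFamily ν') {a₁ a₂ : ℝ → ℝ → ℝ}
    (ha : IsContKernel (sepKernel a₁ a₂)) (i j k l : Fin K) :
    meanTensor ν ν' (sepKernel a₁ a₂) i j k l = meanMatrix ν a₁ i k * meanMatrix ν' a₂ j l := by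
  have := hν.prob
  have := hν'.prob
  have h := integrable_boxMeasure hν hν' ha i j k l
  unfold meanTensor
  unfold boxMeasure at h ⊢
  rw [integral_prod _ h]
  simp only [sepKernel]
  have e : ∀ p : ℝ × ℝ, ∫ q : ℝ × ℝ, a₁ p.1 q.1 * a₂ p.2 q.2 ∂((ν k).prod (ν' l))
      = (∫ t', a₁ p.1 t' ∂(ν k)) * ∫ s', a₂ p.2 s' ∂(ν' l) := fun p =>
    integral_prod_mul (fun t' => a₁ p.1 t') (fun s' => a₂ p.2 s')
  simp only [e]
  exact integral_prod_mul (fun t => ∫ t', a₁ t t' ∂(ν k)) (fun s => ∫ s', a₂ s s' ∂(ν' l))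

/-- The reason for the extra one in the discrete bandwidth `d`: closed cells whose indices differ by
`d` are at least `(d - 1) / K ≥ δ` apart, so the whole box lies where `f` and `g` agree. -/
lemma meanTensor_congr_of_lag_le (hν : IsCellFamily ν) (hν' : IsCellFamily ν') {δ : ℝ}
    (hδ : 0 ≤ δ) {f g : Kernel4}
    (hfg : ∀ z ∈ cube, δ ≤ max |z.1.1 - z.2.1| |z.1.2 - z.2.2| →
      f z.1.1 z.1.2 z.2.1 z.2.2 = g z.1.1 z.1.2 z.2.1 z.2.2) {i j k l : Fin K}
    (hlag : (k : ℕ) = i + discreteBandwidth δ K ∨ (l : ℕ) = j + discreteBandwidth δ K) :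
    meanTensor ν ν' f i j k l = meanTensor ν ν' g i j k l := by
  refine integral_congr_ae ?_
  have hK' : (0 : ℝ) < K := by have := i.pos; positivity
  filter_upwards [ae_boxMeasure hν hν' i j k l, ae_mem_cube hν hν' i j k l] with z hz hzc
  refine hfg z hzc ?_
  have key : ∀ (m n : Fin K) (x y : ℝ), x ∈ Icc ((m : ℝ) / K) (((m : ℝ) + 1) / K) →
      y ∈ Icc ((n : ℝ) / K) (((n : ℝ) + 1) / K) → (n : ℕ) = m + discreteBandwidth δ K →
      δ ≤ |x - y| := by
    intro m n x y hx hy hmn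
    have h1 := (discreteBandwidth_bounds hδ K).1
    have e1 : ((n : ℕ) : ℝ) = m + discreteBandwidth δ K := by exact_mod_cast hmn
    have h2 : δ + ((m : ℝ) + 1) / K ≤ (n : ℝ) / K := by
      rw [e1, ← sub_nonneg]
      have : ((m : ℝ) + discreteBandwidth δ K) / K - (δ + ((m : ℝ) + 1) / K)
          = (discreteBandwidth δ K - (δ * K + 1)) / K := by field_simp; ring
      rw [this]
      exact div_nonneg (by linarith) hK'.le
    rw [abs_sub_comm]
    exact le_trans (by linarith [hx.2, hy.1]) (le_abs_self _)
  rcases hlag with h | h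
  · exact (key i k _ _ hz.1.1 hz.2.1 h).trans (le_max_left _ _)
  · exact (key j l _ _ hz.1.2 hz.2.2 h).trans (le_max_right _ _)

end Means

/-! ### The discretisation bias -/

section Bias

variable {K : ℕ} {ν ν' : Fin K → Measure ℝ}

lemma IsCellFamily.memLp (hν : IsCellFamily ν) (i : Fin K) (p : ENNReal) :
    MemLp (fun y : ℝ => y) p (ν i) := by
  have := hν.prob i
  refine MemLp.of_bound (by fun_prop) 1 ?_
  filter_upwards [hν.mem i] with y hy
  have := (isNear_of_mem hy).1
  rw [Real.norm_eq_abs, abs_of_nonneg this.1]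
  exact this.2

lemma IsCellFamily.integral_sub_sq (hν : IsCellFamily ν) (i : Fin K) (t : ℝ) :
    ∫ y, (y - t) ^ 2 ∂(ν i) = ∫ y, y ^ 2 ∂(ν i) - 2 * t * ∫ y, y ∂(ν i) + t ^ 2 := by
  have := hν.prob i
  have h1 : Integrable (fun y : ℝ => y) (ν i) := (hν.memLp i 2).integrable one_le_two
  have h2 : Integrable (fun y : ℝ => y ^ 2) (ν i) := (hν.memLp i 2).integrable_sq
  have e : ∀ y : ℝ, (y - t) ^ 2 = y ^ 2 - 2 * t * y + t ^ 2 := fun y => by ring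
  simp only [e]
  have h3 : Integrable (fun y : ℝ => y ^ 2 - 2 * t * y) (ν i) := h2.sub (h1.const_mul _)
  rw [integral_add h3 (integrable_const _), integral_sub h2 (h1.const_mul _), integral_const_mul]
  simp

lemma IsCellFamily.integrable_sub_sq (hν : IsCellFamily ν) (i : Fin K) (t : ℝ) :
    Integrable (fun y : ℝ => (y - t) ^ 2) (ν i) := by
  have := hν.prob i
  exact ((hν.memLp i 2).sub (memLp_const t)).integrable_sq

/-- The mean squared distance to the sampling location. -/
noncomputable def spread (ν : Fin K → Measure ℝ) (t : ℝ) : ℝ :=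
  ∑ i, (cell K i).indicator (fun t => ∫ y, (y - t) ^ 2 ∂(ν i)) t

lemma measurableSet_cell (i : Fin K) : MeasurableSet (cell K i) := measurableSet_Ico

lemma cell_subset_Ico (i : Fin K) : cell K i ⊆ Ico 0 1 := by
  have hK' : (0 : ℝ) < K := by have := i.pos; positivity
  intro t ht
  have h1 : ((i : ℝ) + 1) / K ≤ 1 := by
    rw [div_le_one hK']
    exact_mod_cast i.2
  exact ⟨le_trans (by positivity) ht.1, ht.2.trans_le h1⟩

lemma volume_cell (i : Fin K) : volume.real (cell K i) = 1 / K := by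
  have hK' : (0 : ℝ) < K := by have := i.pos; positivity
  rw [cell, Real.volume_real_Ico_of_le (by gcongr; linarith)]
  ring

/-- Integrating over `t` first gives `((y - lo)³ + (lo + w - y)³) / 3`, which is at most `w³ / 3`.
The worst case is a sampling point at an end of the cell. -/
lemma IsCellFamily.setIntegral_sub_sq_le (hν : IsCellFamily ν) (i : Fin K) :
    ∫ t in cell K i, (∫ y, (y - t) ^ 2 ∂(ν i)) ≤ 1 / (3 * (K : ℝ) ^ 3) := by
  have := hν.prob i
  have hK' : (0 : ℝ) < K := by have := i.pos; positivity
  simp only [hν.integral_sub_sq]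
  set A := ∫ y, y ∂(ν i) with hA
  set Q := ∫ y, y ^ 2 ∂(ν i) with hQ
  set lo : ℝ := (i : ℝ) / K
  set w : ℝ := 1 / K
  have hw : 0 < w := by positivity
  have hhi : ((i : ℝ) + 1) / K = lo + w := by ring
  have h1 : Integrable (fun y : ℝ => y) (ν i) := (hν.memLp i 2).integrable one_le_two
  have h2 : Integrable (fun y : ℝ => y ^ 2) (ν i) := (hν.memLp i 2).integrable_sq
  have hint : ∫ t in cell K i, (Q - 2 * t * A + t ^ 2)
      = w * Q - A * ((lo + w) ^ 2 - lo ^ 2) + ((lo + w) ^ 3 - lo ^ 3) / 3 := by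
    rw [cell, hhi, integral_Ico_eq_integral_Ioc,
      ← intervalIntegral.integral_of_le (by linarith)]
    have e : ∀ t : ℝ, Q - 2 * t * A + t ^ 2 = Q + (-2 * A) * t + t ^ 2 := fun t => by ring
    simp only [e]
    rw [intervalIntegral.integral_add (Continuous.intervalIntegrable (by fun_prop) _ _)
      (Continuous.intervalIntegrable (by fun_prop) _ _),
      intervalIntegral.integral_add (Continuous.intervalIntegrable (by fun_prop) _ _)
      (Continuous.intervalIntegrable (by fun_prop) _ _), intervalIntegral.integral_const_mul,
      integral_id, integral_pow, intervalIntegral.integral_const]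
    simp only [smul_eq_mul]
    norm_num
    ring
  -- The integrals are exchanged by hand, since only the first two moments of `ν i` are involved.
  have hback : w * Q - A * ((lo + w) ^ 2 - lo ^ 2) + ((lo + w) ^ 3 - lo ^ 3) / 3
      = ∫ y, (w * y ^ 2 - y * ((lo + w) ^ 2 - lo ^ 2) + ((lo + w) ^ 3 - lo ^ 3) / 3) ∂(ν i) := by
    have h3 : Integrable (fun y : ℝ => w * y ^ 2 - y * ((lo + w) ^ 2 - lo ^ 2)) (ν i) :=
      (h2.const_mul _).sub (h1.mul_const _)
    rw [integral_add h3 (integrable_const _), integral_sub (h2.const_mul _) (h1.mul_const _),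
      integral_const_mul, integral_mul_const]
    simp [hA, hQ]
  rw [hint, hback]
  have hb : ∀ᵐ y ∂(ν i), w * y ^ 2 - y * ((lo + w) ^ 2 - lo ^ 2) + ((lo + w) ^ 3 - lo ^ 3) / 3
      ≤ w ^ 3 / 3 := by
    filter_upwards [hν.mem i] with y hy
    rw [hhi] at hy
    have ha : 0 ≤ y - lo := by linarith [hy.1]
    have hb : 0 ≤ lo + w - y := by linarith [hy.2]
    -- For `α + β = w` one has `w³ - α³ - β³ = 3 α β w`.
    have hab : 0 ≤ (y - lo) * (lo + w - y) * w := by positivity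
    nlinarith
  have h4 : Integrable (fun y : ℝ => w * y ^ 2 - y * ((lo + w) ^ 2 - lo ^ 2)
      + ((lo + w) ^ 3 - lo ^ 3) / 3) (ν i) :=
    ((h2.const_mul _).sub (h1.mul_const _)).add (integrable_const _)
  refine (integral_mono_ae h4 (integrable_const _) hb).trans (le_of_eq ?_)
  simp only [integral_const, probReal_univ, smul_eq_mul, one_mul]
  simp only [w]
  field_simp

/-- Lebesgue measure on the unit interval. -/
noncomputable def unitMeasure : Measure ℝ := volume.restrict (Icc (0 : ℝ) 1)

instance : IsProbabilityMeasure unitMeasure := ⟨by simp [unitMeasure]⟩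

lemma sqMeasure_eq : sqMeasure = unitMeasure.prod unitMeasure := by
  rw [sqMeasure, unitMeasure, Measure.prod_restrict]
  rfl

lemma unitMeasure_restrict_cell (i : Fin K) :
    unitMeasure.restrict (cell K i) = volume.restrict (cell K i) := by
  rw [unitMeasure, Measure.restrict_restrict (measurableSet_cell i),
    inter_eq_left.2 ((cell_subset_Ico i).trans Ico_subset_Icc_self)]

lemma ae_unitMeasure_mem_Ico : ∀ᵐ t ∂unitMeasure, t ∈ Ico (0 : ℝ) 1 := by
  rw [unitMeasure, ← restrict_Ico_eq_restrict_Icc]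
  exact ae_restrict_mem measurableSet_Ico

lemma IsCellFamily.spread_integral (hν : IsCellFamily ν) :
    Integrable (spread ν) unitMeasure ∧ ∫ t, spread ν t ∂unitMeasure ≤ 1 / (3 * (K : ℝ) ^ 2) := by
  have hI : ∀ i, Integrable ((cell K i).indicator fun t => ∫ y, (y - t) ^ 2 ∂(ν i))
      unitMeasure := by
    intro i
    rw [integrable_indicator_iff (measurableSet_cell i)]
    simp only [hν.integral_sub_sq, unitMeasure, IntegrableOn]
    refine Integrable.restrict (s := cell K i) ?_
    exact (Continuous.continuousOn (by fun_prop)).integrableOn_compact isCompact_Icc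
  refine ⟨integrable_finsetSum _ fun i _ => hI i, ?_⟩
  unfold spread
  rw [integral_finsetSum _ fun i _ => hI i]
  calc ∑ i, ∫ t, (cell K i).indicator (fun t => ∫ y, (y - t) ^ 2 ∂(ν i)) t ∂unitMeasure
      ≤ ∑ _i : Fin K, 1 / (3 * (K : ℝ) ^ 3) := by
        refine Finset.sum_le_sum fun i _ => ?_
        rw [integral_indicator (measurableSet_cell i), unitMeasure_restrict_cell]
        exact hν.setIntegral_sub_sq_le i
    _ ≤ 1 / (3 * (K : ℝ) ^ 2) := by
        simp only [Finset.sum_const, Finset.card_univ, Fintype.card_fin, nsmul_eq_mul]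
        rcases Nat.eq_zero_or_pos K with rfl | hK
        · simp
        · have : (0 : ℝ) < K := by exact_mod_cast hK
          apply le_of_eq
          field_simp

lemma sq_integral_le {Ω : Type*} [MeasurableSpace Ω] {μ : Measure Ω} [IsProbabilityMeasure μ]
    {f : Ω → ℝ} (hf : MemLp f 2 μ) : (∫ ω, f ω ∂μ) ^ 2 ≤ ∫ ω, f ω ^ 2 ∂μ := by
  have h := variance_nonneg f μ
  rw [variance_eq_sub hf] at h
  simpa using h

/-- Jensen's inequality moves the square inside the local mean. The squared Euclidean distance then
splits into one integral per coordinate. -/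
lemma sq_meanTensor_sub_le (hν : IsCellFamily ν) (hν' : IsCellFamily ν') {a : Kernel4}
    (ha : IsContKernel a) {L : ℝ} (hL : IsLipschitzOnCube L a) (i j k l : Fin K) {t s t' s' : ℝ}
    (ht : t ∈ Icc (0 : ℝ) 1) (hs : s ∈ Icc (0 : ℝ) 1) (ht' : t' ∈ Icc (0 : ℝ) 1)
    (hs' : s' ∈ Icc (0 : ℝ) 1) :
    (meanTensor ν ν' a i j k l - a t s t' s') ^ 2
      ≤ L ^ 2 * (∫ y, (y - t) ^ 2 ∂(ν i) + ∫ y, (y - s) ^ 2 ∂(ν' j)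
        + ∫ y, (y - t') ^ 2 ∂(ν k) + ∫ y, (y - s') ^ 2 ∂(ν' l)) := by
  have := hν.prob
  have := hν'.prob
  have hP := isProbabilityMeasure_boxMeasure hν hν' i j k l
  have hm := memLp_boxMeasure hν hν' ha i j k l 2
  have hd := hm.sub (memLp_const (a t s t' s'))
  have e : meanTensor ν ν' a i j k l - a t s t' s'
      = ∫ z, (a z.1.1 z.1.2 z.2.1 z.2.2 - a t s t' s') ∂(boxMeasure ν ν' i j k l) := by
    rw [integral_sub (hm.integrable one_le_two) (integrable_const _)]
    simp [meanTensor]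
  obtain ⟨hi, he⟩ := integrable_sum_four (hν.integrable_sub_sq i t) (hν'.integrable_sub_sq j s)
    (hν.integrable_sub_sq k t') (hν'.integrable_sub_sq l s')
  rw [← he, e, ← integral_const_mul]
  refine (sq_integral_le hd).trans (integral_mono_ae hd.integrable_sq (hi.const_mul _) ?_)
  filter_upwards [ae_mem_cube hν hν' i j k l] with z hz
  have h := hL _ hz.1.1 _ hz.1.2 _ hz.2.1 _ hz.2.2 t ht s hs t' ht' s' hs'
  have h2 := pow_le_pow_left₀ (abs_nonneg _) h 2
  rw [sq_abs, mul_pow, Real.sq_sqrt (by positivity)] at h2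
  exact h2

lemma indicator_cell_eq_ite {i : Fin K} {t : ℝ} (ht : t ∈ cell K i) :
    ∀ m, (cell K m).indicator (1 : ℝ → ℝ) t = if m = i then 1 else 0 := by
  have hK' : (0 : ℝ) < K := by have := i.pos; positivity
  intro m
  split_ifs with h
  · rw [h, indicator_of_mem ht, Pi.one_apply]
  · refine indicator_of_notMem (fun hm => h ?_) _
    have h1 : (m : ℝ) < i + 1 := by
      have := hm.1.trans_lt ht.2
      rwa [div_lt_div_iff_of_pos_right hK'] at this
    have h2 : (i : ℝ) < m + 1 := by
      have := ht.1.trans_lt hm.2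
      rwa [div_lt_div_iff_of_pos_right hK'] at this
    have h3 : (m : ℕ) < i + 1 := by exact_mod_cast h1
    have h4 : (i : ℕ) < m + 1 := by exact_mod_cast h2
    exact Fin.ext (by omega)

lemma continuation_apply (M : Tensor K) {i j k l : Fin K} {t s t' s' : ℝ} (hi : t ∈ cell K i)
    (hj : s ∈ cell K j) (hk : t' ∈ cell K k) (hl : s' ∈ cell K l) :
    continuation M t s t' s' = M i j k l := by
  unfold continuation
  simp only [indicator_cell_eq_ite hi, indicator_cell_eq_ite hj,
    indicator_cell_eq_ite hk, indicator_cell_eq_ite hl]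
  simp [Finset.sum_ite_eq']

lemma spread_apply {i : Fin K} {t : ℝ} (hi : t ∈ cell K i) :
    spread ν t = ∫ y, (y - t) ^ 2 ∂(ν i) := by
  unfold spread
  have e : ∀ m, (cell K m).indicator (fun t => ∫ y, (y - t) ^ 2 ∂(ν m)) t
      = (if m = i then 1 else 0) * ∫ y, (y - t) ^ 2 ∂(ν m) := by
    intro m
    rw [← indicator_cell_eq_ite hi m]
    by_cases h : t ∈ cell K m <;> simp [h]
  simp [e]

lemma exists_mem_cell (hK : 0 < K) {t : ℝ} (ht : t ∈ Ico (0 : ℝ) 1) : ∃ i, t ∈ cell K i := by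
  have hK' : (0 : ℝ) < K := by exact_mod_cast hK
  have h0 : 0 ≤ t * K := mul_nonneg ht.1 hK'.le
  have h1 : t * K < K := mul_lt_of_lt_one_left hK' ht.2
  refine ⟨⟨⌊t * K⌋₊, (Nat.floor_lt h0).2 h1⟩, ?_, ?_⟩
  · rw [div_le_iff₀ hK']
    exact Nat.floor_le h0
  · rw [lt_div_iff₀ hK']
    exact Nat.lt_floor_add_one _

lemma integral_continuation (M : Tensor K) :
    Integrable (fun z : (ℝ × ℝ) × (ℝ × ℝ) => continuation M z.1.1 z.1.2 z.2.1 z.2.2)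
      ((unitMeasure.prod unitMeasure).prod (unitMeasure.prod unitMeasure)) ∧
    ∫ z, continuation M z.1.1 z.1.2 z.2.1 z.2.2
      ∂((unitMeasure.prod unitMeasure).prod (unitMeasure.prod unitMeasure))
      = (∑ v : Idx K, M v.1 v.2.1 v.2.2.1 v.2.2.2) / (K : ℝ) ^ 4 := by
  have hI : ∀ i, Integrable ((cell K i).indicator (1 : ℝ → ℝ)) unitMeasure := fun i =>
    (integrable_indicator_iff (measurableSet_cell i)).2 (integrable_const (1 : ℝ)).integrableOn
  have hint : ∀ i, ∫ t, (cell K i).indicator (1 : ℝ → ℝ) t ∂unitMeasure = 1 / K := by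
    intro i
    rw [integral_indicator (measurableSet_cell i), unitMeasure_restrict_cell]
    simp [volume_cell]
  have hterm : ∀ v : Idx K, Integrable (fun z : (ℝ × ℝ) × (ℝ × ℝ) => M v.1 v.2.1 v.2.2.1 v.2.2.2 *
      ((cell K v.1).indicator (1 : ℝ → ℝ) z.1.1 * (cell K v.2.1).indicator (1 : ℝ → ℝ) z.1.2 *
      ((cell K v.2.2.1).indicator (1 : ℝ → ℝ) z.2.1
        * (cell K v.2.2.2).indicator (1 : ℝ → ℝ) z.2.2)))
      ((unitMeasure.prod unitMeasure).prod (unitMeasure.prod unitMeasure)) := fun v =>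
    (integrable_mul_four (hI _) (hI _) (hI _) (hI _)).const_mul _
  have e : ∀ z : (ℝ × ℝ) × (ℝ × ℝ), continuation M z.1.1 z.1.2 z.2.1 z.2.2
      = ∑ v : Idx K, M v.1 v.2.1 v.2.2.1 v.2.2.2 *
      ((cell K v.1).indicator (1 : ℝ → ℝ) z.1.1 * (cell K v.2.1).indicator (1 : ℝ → ℝ) z.1.2 *
      ((cell K v.2.2.1).indicator (1 : ℝ → ℝ) z.2.1
        * (cell K v.2.2.2).indicator (1 : ℝ → ℝ) z.2.2)) := by
    intro z
    rw [mul_sum_four (fun i j k l => M i j k l *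
      ((cell K i).indicator (1 : ℝ → ℝ) z.1.1 * (cell K j).indicator (1 : ℝ → ℝ) z.1.2 *
      ((cell K k).indicator (1 : ℝ → ℝ) z.2.1 * (cell K l).indicator (1 : ℝ → ℝ) z.2.2)))]
    unfold continuation
    simp only [mul_assoc]
  simp only [e]
  refine ⟨integrable_finsetSum _ fun v _ => hterm v, ?_⟩
  rw [integral_finsetSum _ fun v _ => hterm v, Finset.sum_div]
  refine Finset.sum_congr rfl fun v _ => ?_
  rw [integral_const_mul, integral_mul_four, hint, hint, hint, hint]
  ring

/-- Young's inequality with conjugate weights `3` and `3 / 2`. Four coordinates contribute `1 / (3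
K²)` each to the Lipschitz part, and `3 / 2 * 4 / 3 = 2` is the constant in front of `K⁻² L²`. -/
theorem hsNormSq_continuation_sub_le (hK : 0 < K) (hν : IsCellFamily ν) (hν' : IsCellFamily ν')
    {a : Kernel4} (ha : IsContKernel a) {L : ℝ} (hL : IsLipschitzOnCube L a) (M : Tensor K) :
    hsNormSq (fun t s t' s' => continuation M t s t' s' - a t s t' s')
      ≤ 3 * ‖tensorVec (M - meanTensor ν ν' a)‖ ^ 2 + 2 * ((K : ℝ) ^ 2)⁻¹ * L ^ 2 := by
  have hK' : (0 : ℝ) < K := by exact_mod_cast hK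
  set E : Tensor K := fun i j k l => (M i j k l - meanTensor ν ν' a i j k l) ^ 2 with hE
  obtain ⟨hEi, hEe⟩ := integral_continuation E
  obtain ⟨hg, hgl⟩ := hν.spread_integral
  obtain ⟨hg', hgl'⟩ := hν'.spread_integral
  obtain ⟨hsi, hse⟩ := integrable_sum_four hg hg' hg hg'
  set Q := (unitMeasure.prod unitMeasure).prod (unitMeasure.prod unitMeasure) with hQ
  set G : (ℝ × ℝ) × (ℝ × ℝ) → ℝ := fun z => 3 * continuation E z.1.1 z.1.2 z.2.1 z.2.2
    + 3 / 2 * L ^ 2 * (spread ν z.1.1 + spread ν' z.1.2 + spread ν z.2.1 + spread ν' z.2.2) with hG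
  have hGi : Integrable G Q := (hEi.const_mul 3).add (hsi.const_mul _)
  have hGint : ∫ z, G z ∂Q ≤ 3 * ‖tensorVec (M - meanTensor ν ν' a)‖ ^ 2
      + 2 * ((K : ℝ) ^ 2)⁻¹ * L ^ 2 := by
    rw [hG, integral_add (hEi.const_mul 3) (hsi.const_mul _), integral_const_mul,
      integral_const_mul, hse, hEe, norm_tensorVec_sq]
    refine add_le_add (le_of_eq rfl) ?_
    have h1 : ∫ x, spread ν x ∂unitMeasure + ∫ x, spread ν' x ∂unitMeasure
        + ∫ x, spread ν x ∂unitMeasure + ∫ x, spread ν' x ∂unitMeasure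
        ≤ 4 * (1 / (3 * (K : ℝ) ^ 2)) := by linarith
    calc 3 / 2 * L ^ 2 * (∫ x, spread ν x ∂unitMeasure + ∫ x, spread ν' x ∂unitMeasure
        + ∫ x, spread ν x ∂unitMeasure + ∫ x, spread ν' x ∂unitMeasure)
        ≤ 3 / 2 * L ^ 2 * (4 * (1 / (3 * (K : ℝ) ^ 2))) := by gcongr
      _ = 2 * ((K : ℝ) ^ 2)⁻¹ * L ^ 2 := by field_simp; ring
  have hpt : ∀ᵐ z ∂Q, (continuation M z.1.1 z.1.2 z.2.1 z.2.2 - a z.1.1 z.1.2 z.2.1 z.2.2) ^ 2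
      ≤ G z := by
    filter_upwards [ae_prod_and (ae_prod_and ae_unitMeasure_mem_Ico ae_unitMeasure_mem_Ico)
      (ae_prod_and ae_unitMeasure_mem_Ico ae_unitMeasure_mem_Ico)] with z hz
    obtain ⟨i, hi⟩ := exists_mem_cell hK hz.1.1
    obtain ⟨j, hj⟩ := exists_mem_cell hK hz.1.2
    obtain ⟨k, hk⟩ := exists_mem_cell hK hz.2.1
    obtain ⟨l, hl⟩ := exists_mem_cell hK hz.2.2
    have h := sq_meanTensor_sub_le hν hν' ha hL i j k l (Ico_subset_Icc_self hz.1.1)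
      (Ico_subset_Icc_self hz.1.2) (Ico_subset_Icc_self hz.2.1) (Ico_subset_Icc_self hz.2.2)
    simp only [hG]
    rw [continuation_apply M hi hj hk hl, continuation_apply E hi hj hk hl, spread_apply hi,
      spread_apply hj, spread_apply hk, spread_apply hl]
    simp only [hE]
    -- The identity behind this is `3 x² + 3 y² / 2 - (x + y)² = (2 x - y)² / 2`.
    nlinarith [sq_nonneg (2 * (M i j k l - meanTensor ν ν' a i j k l)
      - (meanTensor ν ν' a i j k l - a z.1.1 z.1.2 z.2.1 z.2.2))]
  rw [hsNormSq, sqMeasure_eq]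
  refine le_trans ?_ hGint
  rw [integral_prod _ hGi]
  refine integral_mono_of_nonneg (Filter.Eventually.of_forall fun p =>
    integral_nonneg fun q => sq_nonneg _) hGi.integral_prod_left ?_
  filter_upwards [Measure.ae_ae_of_ae_prod hpt, hGi.prod_right_ae] with p hp hpi
  exact integral_mono_of_nonneg (Filter.Eventually.of_forall fun q => sq_nonneg _) hpi hp

end Bias

/-! ### Local averages of a random surface -/

instance : IsProbabilityMeasure sqMeasure := by
  rw [sqMeasure_eq]
  infer_instance

/-- The normalised indicator function, which represents the average over a set. -/
noncomputable def avgVec {S : Set (ℝ × ℝ)} (hS : MeasurableSet S) : L2Square :=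
  (sqMeasure.real S)⁻¹ • indicatorConstLp 2 hS (measure_ne_top sqMeasure S) (1 : ℝ)

lemma integral_cond_eq (S : Set (ℝ × ℝ)) (g : ℝ × ℝ → ℝ) :
    ∫ p, g p ∂(sqMeasure[|S]) = (sqMeasure.real S)⁻¹ * ∫ p in S, g p ∂sqMeasure := by
  rw [ProbabilityTheory.cond, integral_smul_measure, ENNReal.toReal_inv, smul_eq_mul]
  rfl

lemma inner_avgVec {S : Set (ℝ × ℝ)} (hS : MeasurableSet S) (f : L2Square) :
    inner ℝ f (avgVec hS) = ∫ p, f p ∂(sqMeasure[|S]) := by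
  rw [avgVec, inner_smul_right, real_inner_comm, L2.inner_indicatorConstLp_one, integral_cond_eq]

lemma integral_mul_avgVec {S : Set (ℝ × ℝ)} (hS : MeasurableSet S) (g : ℝ × ℝ → ℝ) :
    ∫ p, g p * avgVec hS p ∂sqMeasure = ∫ p, g p ∂(sqMeasure[|S]) := by
  rw [integral_cond_eq, ← integral_indicator hS, ← integral_const_mul]
  refine integral_congr_ae ?_
  filter_upwards [Lp.coeFn_smul (sqMeasure.real S)⁻¹
      (indicatorConstLp 2 hS (measure_ne_top sqMeasure S) (1 : ℝ)),
    indicatorConstLp_coeFn (p := 2) (hs := hS) (hμs := measure_ne_top sqMeasure S) (c := (1 : ℝ))]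
    with p h1 h2
  rw [avgVec, h1, Pi.smul_apply, h2, smul_eq_mul]
  by_cases hp : p ∈ S
  · simp only [indicator_of_mem hp]
    ring
  · simp [indicator_of_notMem hp]

section Moments

variable {Ω : Type*} [MeasurableSpace Ω] {μ : Measure Ω} {X : Ω → L2Square} {c : Kernel4}

lemma memLp_inner {p : ENNReal} (hX : MemLp X p μ) (f : L2Square) :
    MemLp (fun ω => inner ℝ (X ω) f) p μ :=
  MemLp.of_le_mul (c := ‖f‖) hX (hX.aestronglyMeasurable.inner aestronglyMeasurable_const)
    (Filter.Eventually.of_forall fun ω => by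
      rw [mul_comm]
      exact norm_inner_le_norm _ _)

lemma IsCenteredWithCov.integral_inner_mul_inner [IsProbabilityMeasure μ]
    (hcov : IsCenteredWithCov μ X c) (hX : MemLp X 2 μ) (f g : L2Square) :
    ∫ ω, inner ℝ (X ω) f * inner ℝ (X ω) g ∂μ
      = ∫ p, ∫ q, c p.1 p.2 q.1 q.2 * f p * g q ∂sqMeasure ∂sqMeasure := by
  rw [← hcov.2 f g, covariance_eq_sub (memLp_inner hX f) (memLp_inner hX g)]
  have h : ∀ f : L2Square, ∫ ω, inner ℝ (X ω) f ∂μ = 0 := by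
    intro f
    simp only [real_inner_comm f]
    rw [integral_inner (hX.integrable one_le_two), hcov.1, inner_zero_right]
  rw [h f, zero_mul, sub_zero]
  rfl

lemma IsCenteredWithCov.integral_avg_mul_avg [IsProbabilityMeasure μ]
    (hcov : IsCenteredWithCov μ X c) (hX : MemLp X 2 μ) {S T : Set (ℝ × ℝ)} (hS : MeasurableSet S) (hT : MeasurableSet T) :
    ∫ ω, inner ℝ (X ω) (avgVec hS) * inner ℝ (X ω) (avgVec hT) ∂μ
      = ∫ p, ∫ q, c p.1 p.2 q.1 q.2 ∂(sqMeasure[|T]) ∂(sqMeasure[|S]) := by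
  rw [hcov.integral_inner_mul_inner hX]
  simp only [integral_mul_avgVec hT, integral_mul_const, integral_mul_avgVec hS]

end Moments

lemma IsContKernel.integrable_of_ae_mem_cube {c : Kernel4} (hc : IsContKernel c)
    {P : Measure ((ℝ × ℝ) × (ℝ × ℝ))} [IsFiniteMeasure P] (hP : ∀ᵐ z ∂P, z ∈ cube) :
    Integrable (fun z : (ℝ × ℝ) × (ℝ × ℝ) => c z.1.1 z.1.2 z.2.1 z.2.2) P := by
  obtain ⟨B, -, hB⟩ := hc.exists_bound
  refine memLp_one_iff_integrable.1 (MemLp.of_bound (Continuous.aestronglyMeasurable hc) B ?_)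
  filter_upwards [hP] with z hz
  exact hB _ hz.1.1 _ hz.1.2 _ hz.2.1 _ hz.2.2

lemma meanTensor_le {K : ℕ} {ν ν' : Fin K → Measure ℝ} (hν : IsCellFamily ν)
    (hν' : IsCellFamily ν') {c : Kernel4} (hc : IsContKernel c) {B : ℝ}
    (hB : ∀ t ∈ Icc (0 : ℝ) 1, ∀ s ∈ Icc (0 : ℝ) 1, ∀ t' ∈ Icc (0 : ℝ) 1, ∀ s' ∈ Icc (0 : ℝ) 1,
      |c t s t' s'| ≤ B) (i j k l : Fin K) : meanTensor ν ν' c i j k l ≤ B := by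
  have := isProbabilityMeasure_boxMeasure hν hν' i j k l
  have h : |meanTensor ν ν' c i j k l - 0| ≤ B :=
    abs_integral_sub_le (integrable_boxMeasure hν hν' hc i j k l)
      ((ae_mem_cube hν hν' i j k l).mono fun z hz => by
        rw [sub_zero]
        exact hB _ hz.1.1 _ hz.1.2 _ hz.2.1 _ hz.2.2)
  rw [sub_zero] at h
  exact (le_abs_self _).trans h

/-! ### Sampling by pixel averages -/

/-- The uniform distributions on the cells. -/
noncomputable def cellLaw (K : ℕ) (i : Fin K) : Measure ℝ := unitMeasure[|cell K i]

lemma unitMeasure_cell {K : ℕ} (i : Fin K) : unitMeasure.real (cell K i) = 1 / K := by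
  rw [← volume_cell i, ← measureReal_restrict_apply_univ, unitMeasure_restrict_cell,
    measureReal_restrict_apply_univ]

lemma unitMeasure_cell_ne_zero {K : ℕ} (i : Fin K) : unitMeasure (cell K i) ≠ 0 := by
  have hK' : (0 : ℝ) < K := by have := i.pos; positivity
  intro h
  have := unitMeasure_cell i
  rw [measureReal_def, h, ENNReal.toReal_zero] at this
  have h2 : (0 : ℝ) < 1 / K := by positivity
  linarith

lemma isCellFamily_cellLaw (K : ℕ) : IsCellFamily (cellLaw K) where
  prob i := cond_isProbabilityMeasure (unitMeasure_cell_ne_zero i)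
  mem i := (ae_cond_mem₀ (measurableSet_cell i).nullMeasurableSet).mono fun _ h => Ico_subset_Icc_self h

lemma cond_pixel {K : ℕ} (i j : Fin K) :
    sqMeasure[|cell K i ×ˢ cell K j] = (cellLaw K i).prod (cellLaw K j) := by
  have h := unitMeasure_cell_ne_zero i
  have h' := unitMeasure_cell_ne_zero j
  simp only [cellLaw, ProbabilityTheory.cond, sqMeasure_eq]
  rw [Measure.prod_smul_left, Measure.prod_smul_right, smul_smul, Measure.prod_restrict, Measure.prod_prod,
    ENNReal.mul_inv (Or.inl h) (Or.inr h')]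

lemma measurableSet_pixel {K : ℕ} (i j : Fin K) : MeasurableSet (cell K i ×ˢ cell K j) :=
  (measurableSet_cell i).prod (measurableSet_cell j)

lemma sqMeasure_pixel {K : ℕ} (i j : Fin K) :
    sqMeasure.real (cell K i ×ˢ cell K j) = ((K : ℝ) ^ 2)⁻¹ := by
  rw [sqMeasure_eq, measureReal_prod_prod, unitMeasure_cell, unitMeasure_cell]
  field_simp

/-- The pixel averages of a surface. -/
noncomputable def pixelMap (K : ℕ) (f : L2Square) (i j : Fin K) : ℝ :=
  inner ℝ f (avgVec (measurableSet_pixel i j))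

lemma measurable_pixelMap (K : ℕ) : Measurable (pixelMap K) := by
  refine measurable_pi_lambda _ fun i => measurable_pi_lambda _ fun j => ?_
  exact Continuous.measurable (by unfold pixelMap; fun_prop)

lemma PixelScheme.eq_pixelMap {Ω : Type*} {X : ℕ → Ω → L2Square}
    {x : (K : ℕ) → ℕ → Ω → Fin K → Fin K → ℝ} [MeasurableSpace Ω] (h : PixelScheme X x) (K n : ℕ) (ω : Ω) :
    x K n ω = pixelMap K (X n ω) := by
  ext i j
  have e : sqMeasure.restrict (cell K i ×ˢ cell K j) = volume.restrict (cell K i ×ˢ cell K j) := by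
    rw [sqMeasure, Measure.restrict_restrict (measurableSet_pixel i j),
      inter_eq_self_of_subset_left]
    exact prod_mono ((cell_subset_Ico i).trans Ico_subset_Icc_self)
      ((cell_subset_Ico j).trans Ico_subset_Icc_self)
  rw [h K n ω i j, pixelMap, inner_avgVec, integral_cond_eq, sqMeasure_pixel, div_eq_inv_mul, e]

lemma disjoint_cell {K : ℕ} {i j : Fin K} (h : i ≠ j) : Disjoint (cell K i) (cell K j) := by
  have hK' : (0 : ℝ) < K := by have := i.pos; positivity
  rw [Set.disjoint_left]
  rintro t ⟨h1, h2⟩ ⟨h3, h4⟩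
  rw [div_le_iff₀ hK'] at h1 h3
  rw [lt_div_iff₀ hK'] at h2 h4
  have a : (i : ℝ) < j + 1 := by linarith
  have b : (j : ℝ) < i + 1 := by linarith
  have a' : (i : ℕ) < j + 1 := by exact_mod_cast a
  have b' : (j : ℕ) < i + 1 := by exact_mod_cast b
  exact h (Fin.ext (by omega))

/-- Bessel's inequality: pixels are disjoint and of measure `K⁻²`, so the averaging vectors scaled
by `K⁻¹` are orthonormal. -/
lemma sum_pixelMap_sq_le (K : ℕ) (f : L2Square) :
    (∑ i, ∑ j, pixelMap K f i j ^ 2) / (K : ℝ) ^ 2 ≤ ‖f‖ ^ 2 := by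
  rcases Nat.eq_zero_or_pos K with rfl | hK
  · simp
  have hK' : (0 : ℝ) < K := by exact_mod_cast hK
  have horth : Orthonormal ℝ fun v : Fin K × Fin K =>
      (K : ℝ)⁻¹ • avgVec (measurableSet_pixel v.1 v.2) := by
    rw [orthonormal_iff_ite]
    rintro ⟨i, j⟩ ⟨k, l⟩
    simp only [avgVec, inner_smul_left, inner_smul_right,
      L2.real_inner_indicatorConstLp_one_indicatorConstLp_one, sqMeasure_pixel]
    split_ifs with h
    · cases h
      rw [inter_self, sqMeasure_pixel]
      simp
      field_simp
    · have : (cell K i ×ˢ cell K j) ∩ (cell K k ×ˢ cell K l) = ∅ := by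
        rw [← disjoint_iff_inter_eq_empty, Set.disjoint_prod]
        by_contra h'
        rw [not_or] at h'
        exact h (Prod.ext (not_imp_comm.1 disjoint_cell h'.1) (not_imp_comm.1 disjoint_cell h'.2))
      rw [this]
      simp
  have h := horth.sum_inner_products_le (x := f) (s := Finset.univ)
  refine le_of_eq_of_le ?_ h
  rw [Fintype.sum_prod_type, Finset.sum_div]
  refine Finset.sum_congr rfl fun i _ => ?_
  rw [Finset.sum_div]
  refine Finset.sum_congr rfl fun j _ => ?_
  rw [pixelMap, inner_smul_left, real_inner_comm, norm_mul, mul_pow]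
  simp
  field_simp

lemma hasSignalMoments_pixelMap {Ω : Type*} [MeasurableSpace Ω] {μ : Measure Ω}
    [IsProbabilityMeasure μ] {X : Ω → L2Square} {c : Kernel4} (hX : MemLp X 4 μ)
    (hcov : IsCenteredWithCov μ X c) (hc : IsContKernel c) {B : ℝ}
    (hB : ∀ t ∈ Icc (0 : ℝ) 1, ∀ s ∈ Icc (0 : ℝ) 1, ∀ t' ∈ Icc (0 : ℝ) 1, ∀ s' ∈ Icc (0 : ℝ) 1,
      |c t s t' s'| ≤ B) (K : ℕ) :
    HasSignalMoments μ (fun ω => pixelMap K (X ω)) (meanTensor (cellLaw K) (cellLaw K) c) B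
      (∫ ω, ‖X ω‖ ^ 4 ∂μ) where
  memLp i j := memLp_inner hX _
  mean i j k l := by
    have h := hcov.integral_avg_mul_avg (hX.mono_exponent (by norm_num)) (measurableSet_pixel i j)
      (measurableSet_pixel k l)
    refine h.trans ?_
    have hi := integrable_boxMeasure (isCellFamily_cellLaw K) (isCellFamily_cellLaw K) hc i j k l
    have := (isCellFamily_cellLaw K).prob
    rw [cond_pixel, cond_pixel, meanTensor]
    unfold boxMeasure at hi ⊢
    rw [integral_prod _ hi]
  diag_le i j := meanTensor_le (isCellFamily_cellLaw K) (isCellFamily_cellLaw K) hc hB i j i j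
  four := by
    refine integral_mono_of_nonneg (Filter.Eventually.of_forall fun ω => by positivity) ?_
      (Filter.Eventually.of_forall fun ω => ?_)
    · exact hX.integrable_norm_pow (by norm_num)
    · have h := pow_le_pow_left₀ (by positivity) (sum_pixelMap_sq_le K (X ω)) 2
      calc _ ≤ _ := h
        _ = _ := by ring

/-! ### Pointwise sampling -/

/-- Squared distances expand into three inner products with the same limit, and `r - 2 r + r = 0`.
-/
lemma cauchySeq_of_tendsto_inner {H : Type*} [NormedAddCommGroup H] [InnerProductSpace ℝ H]
    {u : ℕ → H} {r : ℝ}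
    (h : Filter.Tendsto (fun p : ℕ × ℕ => inner ℝ (u p.1) (u p.2)) Filter.atTop (nhds r)) :
    CauchySeq u := by
  rw [cauchySeq_iff_tendsto_dist_atTop_0]
  have hfst : Filter.Tendsto (fun p : ℕ × ℕ => (p.1, p.1)) Filter.atTop Filter.atTop := by
    rw [← Filter.prod_atTop_atTop_eq]
    exact Filter.tendsto_fst.prodMk Filter.tendsto_fst
  have hsnd : Filter.Tendsto (fun p : ℕ × ℕ => (p.2, p.2)) Filter.atTop Filter.atTop := by
    rw [← Filter.prod_atTop_atTop_eq]
    exact Filter.tendsto_snd.prodMk Filter.tendsto_snd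
  have hsq := (((h.comp hfst).sub (h.const_mul 2)).add (h.comp hsnd)).sqrt
  have e : √(r - 2 * r + r) = 0 := by
    rw [show r - 2 * r + r = 0 by ring, Real.sqrt_zero]
  rw [e] at hsq
  refine hsq.congr fun p => ?_
  simp only [Function.comp]
  rw [dist_eq_norm, ← Real.sqrt_sq (norm_nonneg (u p.1 - u p.2)), norm_sub_sq_real,
    real_inner_self_eq_norm_sq, real_inner_self_eq_norm_sq]

lemma inner_toLp_toLp {Ω : Type*} [MeasurableSpace Ω] {μ : Measure Ω} {f g : Ω → ℝ}
    (hf : MemLp f 2 μ) (hg : MemLp g 2 μ) :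
    inner ℝ (hf.toLp f) (hg.toLp g) = ∫ ω, f ω * g ω ∂μ := by
  rw [L2.inner_def]
  refine integral_congr_ae ?_
  filter_upwards [hf.coeFn_toLp, hg.coeFn_toLp] with ω h1 h2
  rw [h1, h2]
  simp [mul_comm]

/-- Completeness provides an `L²` limit, and a subsequence converging almost everywhere identifies
it with `y`. Convergence of the second moments thus replaces any domination hypothesis. -/
lemma exists_tendsto_toLp {Ω : Type*} [MeasurableSpace Ω] {μ : Measure Ω} {f : ℕ → Ω → ℝ}
    (hf : ∀ n, MemLp (f n) 2 μ) {y : Ω → ℝ}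
    (hy : ∀ᵐ ω ∂μ, Filter.Tendsto (fun n => f n ω) Filter.atTop (nhds (y ω))) {r : ℝ}
    (hr : Filter.Tendsto (fun p : ℕ × ℕ => ∫ ω, f p.1 ω * f p.2 ω ∂μ) Filter.atTop (nhds r)) :
    ∃ h : MemLp y 2 μ,
      Filter.Tendsto (fun n => (hf n).toLp (f n)) Filter.atTop (nhds (h.toLp y)) := by
  have hC : CauchySeq fun n => (hf n).toLp (f n) :=
    cauchySeq_of_tendsto_inner (r := r) (hr.congr fun p => (inner_toLp_toLp _ _).symm)
  obtain ⟨g, hg⟩ := cauchySeq_tendsto_of_complete hC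
  obtain ⟨ns, hns, hae⟩ := (tendstoInMeasure_of_tendsto_Lp hg).exists_seq_tendsto_ae
  have hgy : g =ᵐ[μ] y := by
    have hall : ∀ᵐ ω ∂μ, ∀ n, (hf n).toLp (f n) ω = f n ω := ae_all_iff.2 fun n => (hf n).coeFn_toLp
    filter_upwards [hy, hae, hall] with ω h1 h2 h3
    refine tendsto_nhds_unique h2 ?_
    simp only [h3]
    exact h1.comp hns.tendsto_atTop
  have h : MemLp y 2 μ := (memLp_congr_ae hgy).1 (Lp.memLp g)
  refine ⟨h, ?_⟩
  have e : h.toLp y = g := by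
    refine Lp.ext ?_
    exact h.coeFn_toLp.trans hgy.symm
  rwa [e]

lemma integral_mul_eq_of_tendsto {Ω : Type*} [MeasurableSpace Ω] {μ : Measure Ω}
    {f g : ℕ → Ω → ℝ} (hf : ∀ n, MemLp (f n) 2 μ) (hg : ∀ n, MemLp (g n) 2 μ) {y z : Ω → ℝ}
    (hy : ∀ᵐ ω ∂μ, Filter.Tendsto (fun n => f n ω) Filter.atTop (nhds (y ω)))
    (hz : ∀ᵐ ω ∂μ, Filter.Tendsto (fun n => g n ω) Filter.atTop (nhds (z ω))) {r₁ r₂ r : ℝ}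
    (hr₁ : Filter.Tendsto (fun p : ℕ × ℕ => ∫ ω, f p.1 ω * f p.2 ω ∂μ) Filter.atTop (nhds r₁))
    (hr₂ : Filter.Tendsto (fun p : ℕ × ℕ => ∫ ω, g p.1 ω * g p.2 ω ∂μ) Filter.atTop (nhds r₂))
    (hr : Filter.Tendsto (fun p : ℕ × ℕ => ∫ ω, f p.1 ω * g p.2 ω ∂μ) Filter.atTop (nhds r)) :
    ∫ ω, y ω * z ω ∂μ = r := by
  obtain ⟨h1, ht1⟩ := exists_tendsto_toLp hf hy hr₁
  obtain ⟨h2, ht2⟩ := exists_tendsto_toLp hg hz hr₂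
  have ht := ht1.inner (𝕜 := ℝ) ht2
  simp only [inner_toLp_toLp] at ht
  have hdiag : Filter.Tendsto (fun m : ℕ => (m, m)) Filter.atTop Filter.atTop := by
    rw [← Filter.prod_atTop_atTop_eq]
    exact Filter.tendsto_id.prodMk Filter.tendsto_id
  exact tendsto_nhds_unique ht (hr.comp hdiag)

/-- A small square inside the unit square, close to `u`. -/
def nearBox (u : ℝ × ℝ) (m : ℕ) : Set (ℝ × ℝ) :=
  Icc ((1 - 1 / ((m : ℝ) + 1)) * u.1) ((1 - 1 / ((m : ℝ) + 1)) * u.1 + 1 / ((m : ℝ) + 1)) ×ˢ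
    Icc ((1 - 1 / ((m : ℝ) + 1)) * u.2) ((1 - 1 / ((m : ℝ) + 1)) * u.2 + 1 / ((m : ℝ) + 1))

lemma measurableSet_nearBox (u : ℝ × ℝ) (m : ℕ) : MeasurableSet (nearBox u m) :=
  measurableSet_Icc.prod measurableSet_Icc

/-- Starting at `(1 - r) * t` rather than centring at `t` keeps the interval inside `[0, 1]` at the
end points too, and it still contains `t`. -/
lemma mem_nearInterval {r t y : ℝ} (hr : 0 < r) (hr1 : r ≤ 1) (ht : t ∈ Icc (0 : ℝ) 1)
    (hy : y ∈ Icc ((1 - r) * t) ((1 - r) * t + r)) : y ∈ Icc (0 : ℝ) 1 ∧ dist y t ≤ r := by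
  have h1 : 0 ≤ (1 - r) * t := mul_nonneg (by linarith) ht.1
  have h2 : (1 - r) * t ≤ 1 - r := mul_le_of_le_one_right (by linarith) ht.2
  have h3 : r * t ≤ r := mul_le_of_le_one_right hr.le ht.2
  have h4 : 0 ≤ r * t := mul_nonneg hr.le ht.1
  refine ⟨⟨h1.trans hy.1, by linarith [hy.2]⟩, ?_⟩
  rw [Real.dist_eq, abs_le]
  constructor <;> nlinarith [hy.1, hy.2]

/-- The unit square. -/
def square : Set (ℝ × ℝ) := Icc (0 : ℝ) 1 ×ˢ Icc (0 : ℝ) 1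

lemma mem_nearBox {u p : ℝ × ℝ} (hu : u ∈ square) {m : ℕ} (hp : p ∈ nearBox u m) :
    p ∈ square ∧ dist p u ≤ 1 / ((m : ℝ) + 1) := by
  have hr : 0 < 1 / ((m : ℝ) + 1) := by positivity
  have hr1 : 1 / ((m : ℝ) + 1) ≤ 1 := by
    rw [div_le_one (by positivity)]
    linarith [(Nat.cast_nonneg m : (0 : ℝ) ≤ m)]
  have h1 := mem_nearInterval hr hr1 hu.1 hp.1
  have h2 := mem_nearInterval hr hr1 hu.2 hp.2
  exact ⟨⟨h1.1, h2.1⟩, max_le h1.2 h2.2⟩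

lemma sqMeasure_nearBox_ne_zero {u : ℝ × ℝ} (hu : u ∈ square) (m : ℕ) :
    sqMeasure (nearBox u m) ≠ 0 := by
  have hr : 0 < 1 / ((m : ℝ) + 1) := by positivity
  have hsub : nearBox u m ⊆ Icc (0 : ℝ) 1 ×ˢ Icc (0 : ℝ) 1 := fun p hp => (mem_nearBox hu hp).1
  rw [sqMeasure, Measure.restrict_apply (measurableSet_nearBox u m),
    inter_eq_self_of_subset_left hsub, nearBox, Measure.volume_eq_prod, Measure.prod_prod]
  simp only [Real.volume_Icc, add_sub_cancel_left]
  exact mul_ne_zero (by simpa using hr) (by simpa using hr)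

lemma tendsto_inner_avgVec {u : ℝ × ℝ} (hu : u ∈ square) {f : L2Square} {Y : ℝ × ℝ → ℝ}
    (hY : ContinuousOn Y square) (hfY : f =ᵐ[sqMeasure] Y) :
    Filter.Tendsto (fun m => inner ℝ f (avgVec (measurableSet_nearBox u m))) Filter.atTop
      (nhds (Y u)) := by
  rw [Metric.tendsto_atTop]
  intro ε hε
  obtain ⟨ρ, hρ, hYρ⟩ := Metric.continuousOn_iff.1 hY u hu (ε / 2) (by positivity)
  obtain ⟨N, hN⟩ := exists_nat_one_div_lt hρ
  refine ⟨N, fun m hm => ?_⟩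
  have hm' : 1 / ((m : ℝ) + 1) < ρ :=
    lt_of_le_of_lt (one_div_le_one_div_of_le (by positivity) (by simpa using hm)) hN
  have := cond_isProbabilityMeasure (sqMeasure_nearBox_ne_zero hu m)
  have hae : f =ᵐ[sqMeasure[|nearBox u m]] Y := hfY.filter_mono (cond_absolutelyContinuous).ae_le
  have hbox : ∀ᵐ p ∂(sqMeasure[|nearBox u m]), p ∈ nearBox u m :=
    ae_cond_mem₀ (measurableSet_nearBox u m).nullMeasurableSet
  have hnear : ∀ᵐ p ∂(sqMeasure[|nearBox u m]), |f p - Y u| ≤ ε / 2 := by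
    filter_upwards [hae, hbox] with p h1 h2
    rw [h1]
    have h3 := mem_nearBox hu h2
    exact (hYρ p h3.1 (h3.2.trans_lt hm')).le
  have hint : Integrable f (sqMeasure[|nearBox u m]) := by
    refine memLp_one_iff_integrable.1 (MemLp.of_bound
      ((Lp.aestronglyMeasurable f).mono_ac cond_absolutelyContinuous) (|Y u| + ε / 2) ?_)
    filter_upwards [hnear] with p hp
    calc ‖f p‖ = |f p - Y u + Y u| := by rw [sub_add_cancel]; rfl
      _ ≤ |f p - Y u| + |Y u| := abs_add_le _ _
      _ ≤ |Y u| + ε / 2 := by linarith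
  rw [inner_avgVec, Real.dist_eq]
  exact (abs_integral_sub_le hint hnear).trans_lt (by linarith)

lemma tendsto_integral_cond {u v : ℝ × ℝ} (hu : u ∈ square) (hv : v ∈ square) {c : Kernel4}
    (hc : IsContKernel c) :
    Filter.Tendsto (fun p : ℕ × ℕ => ∫ z, ∫ w, c z.1 z.2 w.1 w.2
        ∂(sqMeasure[|nearBox v p.2]) ∂(sqMeasure[|nearBox u p.1])) Filter.atTop
      (nhds (c u.1 u.2 v.1 v.2)) := by
  rw [Metric.tendsto_atTop]
  intro ε hε
  obtain ⟨ρ, hρ, hmod⟩ := hc.exists_modulus (half_pos hε)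
  obtain ⟨N, hN⟩ := exists_nat_one_div_lt hρ
  refine ⟨(N, N), fun p hp => ?_⟩
  have hsmall : ∀ m ≥ N, 1 / ((m : ℝ) + 1) < ρ := fun m hm =>
    lt_of_le_of_lt (one_div_le_one_div_of_le (by positivity) (by simpa using hm)) hN
  have := cond_isProbabilityMeasure (sqMeasure_nearBox_ne_zero hu p.1)
  have := cond_isProbabilityMeasure (sqMeasure_nearBox_ne_zero hv p.2)
  have hbox : ∀ (u : ℝ × ℝ) (m : ℕ), ∀ᵐ p ∂(sqMeasure[|nearBox u m]), p ∈ nearBox u m :=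
    fun u m => ae_cond_mem₀ (measurableSet_nearBox u m).nullMeasurableSet
  have hae := ae_prod_and (hbox u p.1) (hbox v p.2)
  have hint := hc.integrable_of_ae_mem_cube
    (P := (sqMeasure[|nearBox u p.1]).prod (sqMeasure[|nearBox v p.2]))
    (hae.mono fun z hz => ⟨(mem_nearBox hu hz.1).1, (mem_nearBox hv hz.2).1⟩)
  have e := integral_prod _ hint
  simp only at e
  rw [← e, Real.dist_eq]
  refine (abs_integral_sub_le hint (hae.mono fun z hz => ?_)).trans_lt (by linarith : ε / 2 < ε)
  have h1 := mem_nearBox hu hz.1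
  have h2 := mem_nearBox hv hz.2
  exact (hmod z ⟨h1.1, h2.1⟩ (u, v) ⟨hu, hv⟩
    (max_lt (h1.2.trans_lt (hsmall _ hp.1)) (h2.2.trans_lt (hsmall _ hp.2)))).le

/-- The value at `u` of the continuous version of a surface. -/
noncomputable def pointValue (u : ℝ × ℝ) (f : L2Square) : ℝ :=
  Filter.limsup (fun m => inner ℝ f (avgVec (measurableSet_nearBox u m))) Filter.atTop

/-- Point evaluation is not defined on classes in `L²`. As a limsup of continuous functionals it
becomes a measurable function of the class, through which independence and equality of laws pass
from the surfaces to their point samples. -/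
lemma measurable_pointValue (u : ℝ × ℝ) : Measurable (pointValue u) := by
  refine Measurable.limsup fun m => ?_
  exact Continuous.measurable (by fun_prop)

lemma pointValue_eq {u : ℝ × ℝ} (hu : u ∈ square) {f : L2Square} {Y : ℝ × ℝ → ℝ}
    (hY : ContinuousOn Y square) (hfY : f =ᵐ[sqMeasure] Y) : pointValue u f = Y u :=
  (tendsto_inner_avgVec hu hY hfY).limsup_eq

section Moments

variable {Ω : Type*} [MeasurableSpace Ω] {μ : Measure Ω} [IsProbabilityMeasure μ]
  {X : Ω → L2Square} {Y : Ω → ℝ × ℝ → ℝ} {c : Kernel4}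

/-- The covariance is given only weakly, against `L²` functions. Averages over shrinking boxes
converge pathwise to the point values, and their second moments converge by continuity of `c`, which
gives convergence in `L²(μ)` and identifies the limit. -/
lemma integral_pointValue_mul (hX : MemLp X 2 μ) (hcov : IsCenteredWithCov μ X c)
    (hc : IsContKernel c)
    (hY : ∀ᵐ ω ∂μ, ContinuousOn (Y ω) square ∧ X ω =ᵐ[sqMeasure] Y ω) {u v : ℝ × ℝ}
    (hu : u ∈ square) (hv : v ∈ square) : ∫ ω, Y ω u * Y ω v ∂μ = c u.1 u.2 v.1 v.2 := by
  have hA : ∀ u m, MemLp (fun ω => inner ℝ (X ω) (avgVec (measurableSet_nearBox u m))) 2 μ :=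
    fun u m => memLp_inner hX _
  have hlim : ∀ u ∈ square, ∀ᵐ ω ∂μ, Filter.Tendsto
      (fun m => inner ℝ (X ω) (avgVec (measurableSet_nearBox u m))) Filter.atTop
      (nhds (Y ω u)) := fun u hu => by
    filter_upwards [hY] with ω hω
    exact tendsto_inner_avgVec hu hω.1 hω.2
  have hAA : ∀ u ∈ square, ∀ v ∈ square, Filter.Tendsto (fun p : ℕ × ℕ =>
      ∫ ω, inner ℝ (X ω) (avgVec (measurableSet_nearBox u p.1))
        * inner ℝ (X ω) (avgVec (measurableSet_nearBox v p.2)) ∂μ) Filter.atTop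
      (nhds (c u.1 u.2 v.1 v.2)) := fun u hu v hv => by
    refine (tendsto_integral_cond hu hv hc).congr fun p => ?_
    exact (hcov.integral_avg_mul_avg hX _ _).symm
  exact integral_mul_eq_of_tendsto (hA u) (hA v) (hlim u hu) (hlim v hv) (hAA u hu u hu)
    (hAA v hv v hv) (hAA u hu v hv)

end Moments

/-- The values of the continuous version of a surface on a grid. -/
noncomputable def gridMap {K : ℕ} (τ ξ : Fin K → ℝ) (f : L2Square) (i j : Fin K) : ℝ :=
  pointValue (τ i, ξ j) f

lemma measurable_gridMap {K : ℕ} (τ ξ : Fin K → ℝ) : Measurable (gridMap τ ξ) :=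
  measurable_pi_lambda _ fun _ => measurable_pi_lambda _ fun _ => measurable_pointValue _

lemma isCellFamily_dirac {K : ℕ} {τ : Fin K → ℝ}
    (hτ : ∀ i : Fin K, τ i ∈ Icc ((i : ℝ) / K) (((i : ℝ) + 1) / K)) :
    IsCellFamily fun i => Measure.dirac (τ i) where
  prob i := inferInstance
  mem i := by
    exact (ae_dirac_iff measurableSet_Icc).2 (hτ i)

lemma memLp_four_of_integrable {Ω : Type*} [MeasurableSpace Ω] {μ : Measure Ω} {f : Ω → ℝ}
    (hf : AEStronglyMeasurable f μ) (h : Integrable (fun ω => f ω ^ 4) μ) : MemLp f 4 μ := by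
  rw [← integrable_norm_rpow_iff hf (by norm_num) (by norm_num)]
  refine h.congr (Filter.Eventually.of_forall fun ω => ?_)
  have e : (4 : ENNReal).toReal = ((4 : ℕ) : ℝ) := by norm_num
  simp only [e, Real.rpow_natCast, Real.norm_eq_abs]
  exact (Even.pow_abs (by decide) _).symm

lemma sq_mean_sq_le (K : ℕ) (y : Fin K → Fin K → ℝ) :
    ((∑ i, ∑ j, y i j ^ 2) / (K : ℝ) ^ 2) ^ 2 ≤ (∑ i, ∑ j, y i j ^ 4) / (K : ℝ) ^ 2 := by
  rcases Nat.eq_zero_or_pos K with rfl | hK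
  · simp
  have hK' : (0 : ℝ) < K := by exact_mod_cast hK
  have h := sq_sum_le_card_mul_sum_sq (s := (Finset.univ : Finset (Fin K × Fin K)))
    (f := fun v => y v.1 v.2 ^ 2)
  rw [Fintype.sum_prod_type, Fintype.sum_prod_type, Finset.card_univ, Fintype.card_prod,
    Fintype.card_fin] at h
  push_cast at h
  rw [div_pow, div_le_div_iff₀ (by positivity) (by positivity)]
  have e : ∀ r : ℝ, (r ^ 2) ^ 2 = r ^ 4 := fun r => by ring
  simp only [e] at h
  calc _ ≤ ((K : ℝ) * K * ∑ i, ∑ j, y i j ^ 4) * (K : ℝ) ^ 2 := by gcongr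
    _ = _ := by ring

lemma mem_square_of_mem_cells {K : ℕ} {i j : Fin K} {t s : ℝ}
    (ht : t ∈ Icc ((i : ℝ) / K) (((i : ℝ) + 1) / K))
    (hs : s ∈ Icc ((j : ℝ) / K) (((j : ℝ) + 1) / K)) : (t, s) ∈ square :=
  ⟨(isNear_of_mem ht).1, (isNear_of_mem hs).1⟩

lemma hasSignalMoments_grid {Ω : Type*} [MeasurableSpace Ω] {μ : Measure Ω}
    [IsProbabilityMeasure μ] {X : Ω → L2Square} {Y : Ω → ℝ × ℝ → ℝ} {c : Kernel4}
    (hX : MemLp X 2 μ) (hcov : IsCenteredWithCov μ X c) (hc : IsContKernel c)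
    (hY : ∀ᵐ ω ∂μ, ContinuousOn (Y ω) square ∧ X ω =ᵐ[sqMeasure] Y ω) {m : ℝ}
    (hm : ∀ u ∈ square, Integrable (fun ω => (Y ω u) ^ 4) μ ∧ ∫ ω, (Y ω u) ^ 4 ∂μ ≤ m) {B : ℝ}
    (hB : ∀ t ∈ Icc (0 : ℝ) 1, ∀ s ∈ Icc (0 : ℝ) 1, ∀ t' ∈ Icc (0 : ℝ) 1, ∀ s' ∈ Icc (0 : ℝ) 1,
      |c t s t' s'| ≤ B) {K : ℕ} {τ ξ : Fin K → ℝ}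
    (hτ : ∀ i : Fin K, τ i ∈ Icc ((i : ℝ) / K) (((i : ℝ) + 1) / K))
    (hξ : ∀ j : Fin K, ξ j ∈ Icc ((j : ℝ) / K) (((j : ℝ) + 1) / K)) :
    HasSignalMoments μ (fun ω i j => Y ω (τ i, ξ j))
      (meanTensor (fun i => Measure.dirac (τ i)) (fun j => Measure.dirac (ξ j)) c) B m := by
  have hsq : ∀ i j : Fin K, (τ i, ξ j) ∈ square := fun i j =>
    mem_square_of_mem_cells (hτ i) (hξ j)
  have hmeas : ∀ i j : Fin K, AEStronglyMeasurable (fun ω => Y ω (τ i, ξ j)) μ := fun i j => by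
    refine ((measurable_pointValue (τ i, ξ j)).comp_aemeasurable
      hX.aestronglyMeasurable.aemeasurable).aestronglyMeasurable.congr ?_
    filter_upwards [hY] with ω hω
    exact pointValue_eq (hsq i j) hω.1 hω.2
  refine ⟨fun i j => memLp_four_of_integrable (hmeas i j) (hm _ (hsq i j)).1, fun i j k l => ?_,
    fun i j => meanTensor_le (isCellFamily_dirac hτ) (isCellFamily_dirac hξ) hc hB i j i j, ?_⟩
  · rw [integral_pointValue_mul hX hcov hc hY (hsq i j) (hsq k l), meanTensor, boxMeasure,
      Measure.dirac_prod_dirac, Measure.dirac_prod_dirac, Measure.dirac_prod_dirac,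
      integral_dirac]
  · have hm0 : 0 ≤ m := by
      have h := (hm (0, 0) ⟨by simp, by simp⟩).2
      exact (integral_nonneg fun ω => by positivity).trans h
    have hint : ∀ i j : Fin K, Integrable (fun ω => (Y ω (τ i, ξ j)) ^ 4) μ := fun i j =>
      (hm _ (hsq i j)).1
    refine (integral_mono_of_nonneg (Filter.Eventually.of_forall fun ω => by positivity) ?_
      (Filter.Eventually.of_forall fun ω => sq_mean_sq_le K fun i j => Y ω (τ i, ξ j))).trans ?_
    · exact (integrable_finsetSum _ fun i _ => integrable_finsetSum _ fun j _ =>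
        hint i j).div_const _
    · rw [integral_div, integral_finsetSum _ fun i _ => integrable_finsetSum _ fun j _ =>
        hint i j]
      rcases Nat.eq_zero_or_pos K with rfl | hK
      · simpa using hm0
      have hK' : (0 : ℝ) < K := by exact_mod_cast hK
      rw [div_le_iff₀ (by positivity)]
      calc _ ≤ ∑ _i : Fin K, ∑ _j : Fin K, m := by
            refine Finset.sum_le_sum fun i _ => ?_
            rw [integral_finsetSum _ fun j _ => hint i j]
            exact Finset.sum_le_sum fun j _ => (hm _ (hsq i j)).2
        _ = m * (K : ℝ) ^ 2 := by
            simp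
            ring

/-! ### The noisy observations form a sample -/

/-- The noisy array is almost surely a measurable image of the pair of surface and error, which
transfers independence and equality of laws. -/
lemma isSample_add {Ω : Type*} [MeasurableSpace Ω] {μ : Measure Ω} [IsProbabilityMeasure μ]
    {K : ℕ} {X : ℕ → Ω → L2Square} {x e : ℕ → Ω → Fin K → Fin K → ℝ} {σ B m : ℝ} {M₀ : Tensor K}
    {Φ : L2Square → Fin K → Fin K → ℝ} (hΦ : Measurable Φ)
    (hxΦ : ∀ n, ∀ᵐ ω ∂μ, x n ω = Φ (X n ω))
    (hindep : iIndepFun (fun n ω => (X n ω, e n ω)) μ)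
    (hident : ∀ n, IdentDistrib (fun ω => (X n ω, e n ω)) (fun ω => (X 0 ω, e 0 ω)) μ μ)
    (hnoise : IsNoise μ σ (x 0) (e 0)) (hx : HasSignalMoments μ (x 0) M₀ B m) (hB : 0 ≤ B) :
    IsSample μ (fun n ω => x n ω + e n ω) M₀ (2 * m + 2 * (3 * (2 * (σ ^ 2 * B) + σ ^ 4))) := by
  have hG : Measurable fun p : L2Square × (Fin K → Fin K → ℝ) => Φ p.1 + p.2 :=
    (hΦ.comp measurable_fst).add measurable_snd
  have hae : ∀ n, (fun ω => Φ (X n ω) + e n ω) =ᵐ[μ] fun ω => x n ω + e n ω := fun n => by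
    filter_upwards [hxΦ n] with ω hω
    rw [hω]
  have haem : ∀ n, AEMeasurable (fun ω => Φ (X n ω) + e n ω) μ := fun n =>
    hG.comp_aemeasurable (hident n).aemeasurable_fst
  refine ⟨?_, fun n => ?_, hasOuterMean_add hnoise hx, ?_, fun d hd => ?_, fun d hd => ?_,
    fun d hd => ?_⟩
  · exact (hindep.comp (fun _ => fun p : L2Square × (Fin K → Fin K → ℝ) => Φ p.1 + p.2)
      fun _ => hG).congr hae
  · have h1 : IdentDistrib (fun ω => Φ (X n ω) + e n ω) (fun ω => Φ (X 0 ω) + e 0 ω) μ μ :=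
      (hident n).comp hG
    exact ((IdentDistrib.of_ae_eq (haem n) (hae n)).symm.trans h1).trans
      (IdentDistrib.of_ae_eq (haem 0) (hae 0))
  · exact integral_norm_sq_outerSq_le isTame_starVec hnoise hx hB
  · exact integral_norm_sq_outerSq_le (isTame_trace₁Vec hd) hnoise hx hB
  · exact integral_norm_sq_outerSq_le (isTame_trace₂Vec hd) hnoise hx hB
  · exact integral_norm_sq_outerSq_le (isTame_traceVec hd) hnoise hx hB

/-- Under either sampling scheme, the observations form a sample whose mean tensor consists of
local means of the covariance kernel. -/
theorem exists_isSample {Ω : Type*} [MeasurableSpace Ω] {μ : Measure Ω} [IsProbabilityMeasure μ]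
    {X : ℕ → Ω → L2Square} {x e : (K : ℕ) → ℕ → Ω → Fin K → Fin K → ℝ} {σ : ℝ} {c : Kernel4}
    (hmom : MemLp (X 0) 4 μ) (hcov : IsCenteredWithCov μ (X 0) c) (hc : IsContKernel c)
    (hindep : ∀ K, iIndepFun (fun n ω => (X n ω, e K n ω)) μ)
    (hident : ∀ K n,
      IdentDistrib (fun ω => (X n ω, e K n ω)) (fun ω => (X 0 ω, e K 0 ω)) μ μ)
    (hscheme : PointwiseScheme μ X x ∨ PixelScheme X x)
    (hnoise : ∀ K n, IsNoise μ σ (x K n) (e K n)) :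
    ∃ (ν ν' : (K : ℕ) → Fin K → Measure ℝ) (V : ℝ), 0 ≤ V ∧ (∀ K, IsCellFamily (ν K)) ∧
      (∀ K, IsCellFamily (ν' K)) ∧
      ∀ K, IsSample μ (fun n ω => x K n ω + e K n ω) (meanTensor (ν K) (ν' K) c) V := by
  obtain ⟨B, hB0, hB⟩ := hc.exists_bound
  rcases hscheme with ⟨Y, τ, ξ, hY, ⟨m, hm⟩, hτ, hξ, hx⟩ | hx
  · have hm0 : 0 ≤ m := by
      have h := (hm (0, 0) ⟨by simp, by simp⟩).2
      exact (integral_nonneg fun ω => by positivity).trans h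
    refine ⟨fun K i => Measure.dirac (τ K i), fun K i => Measure.dirac (ξ K i),
      2 * m + 2 * (3 * (2 * (σ ^ 2 * B) + σ ^ 4)), by positivity, fun K => isCellFamily_dirac (hτ K),
      fun K => isCellFamily_dirac (hξ K), fun K => ?_⟩
    refine isSample_add (measurable_gridMap (τ K) (ξ K)) (fun n => ?_) (hindep K) (hident K)
      (hnoise K 0) ?_ hB0
    · filter_upwards [hY n] with ω hω
      ext i j
      rw [hx K n ω i j]
      exact (pointValue_eq (mem_square_of_mem_cells (hτ K i) (hξ K j)) hω.1 hω.2).symm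
    · have e : x K 0 = fun ω i j => Y 0 ω (τ K i, ξ K j) := by
        ext ω i j
        exact hx K 0 ω i j
      rw [e]
      exact hasSignalMoments_grid (hmom.mono_exponent (by norm_num)) hcov hc (hY 0) hm hB (hτ K)
        (hξ K)
  · refine ⟨cellLaw, cellLaw, 2 * (∫ ω, ‖X 0 ω‖ ^ 4 ∂μ) + 2 * (3 * (2 * (σ ^ 2 * B) + σ ^ 4)),
      by positivity, isCellFamily_cellLaw, isCellFamily_cellLaw, fun K => ?_⟩
    refine isSample_add (measurable_pixelMap K) (fun n => ?_) (hindep K) (hident K)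
      (hnoise K 0) ?_ hB0
    · exact Filter.Eventually.of_forall fun ω => hx.eq_pixelMap K n ω
    · have e : x K 0 = fun ω => pixelMap K (X 0 ω) := by
        ext1 ω
        exact hx.eq_pixelMap K 0 ω
      rw [e]
      exact hasSignalMoments_pixelMap hmom hcov hc hB K

/-! ### Bandedness of continuous stationary kernels -/

lemma prod_sqMeasure_eq : sqMeasure.prod sqMeasure = volume.restrict cube := by
  rw [sqMeasure, Measure.prod_restrict]
  rfl

/-- Interior lags `q` are realised by the pairs `(1 - q) / 2`, `(1 + q) / 2`, which are interior
points. A nonzero value would persist on an open set, which has positive measure. -/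
lemma IsBandedBy.eq_zero_of_mem_Ioo {δ : ℝ} {ς : ℝ → ℝ → ℝ}
    (hς : ContinuousOn (fun h : ℝ × ℝ => ς h.1 h.2) (Icc (0 : ℝ) 1 ×ˢ Icc (0 : ℝ) 1))
    (h : IsBandedBy δ (statKernel ς)) {q : ℝ × ℝ} (hq : q ∈ Ioo (0 : ℝ) 1 ×ˢ Ioo (0 : ℝ) 1)
    (hδq : δ < max q.1 q.2) : ς q.1 q.2 = 0 := by
  by_contra hne
  set W : Set (ℝ × ℝ) := (Ioo (0 : ℝ) 1 ×ˢ Ioo (0 : ℝ) 1) ∩ (fun p => ς p.1 p.2) ⁻¹' {0}ᶜ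
  have hW : IsOpen W :=
    (hς.mono (prod_mono Ioo_subset_Icc_self Ioo_subset_Icc_self)).isOpen_inter_preimage
      (isOpen_Ioo.prod isOpen_Ioo) isOpen_compl_singleton
  set U : Set ((ℝ × ℝ) × (ℝ × ℝ)) := ((Ioo (0 : ℝ) 1 ×ˢ Ioo (0 : ℝ) 1) ×ˢ
    (Ioo (0 : ℝ) 1 ×ˢ Ioo (0 : ℝ) 1)) ∩
      ((fun z => (|z.1.1 - z.2.1|, |z.1.2 - z.2.2|)) ⁻¹' W ∩
        {z | δ < max |z.1.1 - z.2.1| |z.1.2 - z.2.2|})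
  have hU : IsOpen U := by
    refine ((isOpen_Ioo.prod isOpen_Ioo).prod (isOpen_Ioo.prod isOpen_Ioo)).inter ?_
    exact (hW.preimage (by fun_prop)).inter (isOpen_lt (by fun_prop) (by fun_prop))
  have hne' : U.Nonempty := by
    refine ⟨(((1 - q.1) / 2, (1 - q.2) / 2), ((1 + q.1) / 2, (1 + q.2) / 2)), ?_⟩
    have e : ∀ r : ℝ, 0 < r → |(1 - r) / 2 - (1 + r) / 2| = r := fun r hr => by
      rw [show (1 - r) / 2 - (1 + r) / 2 = -r by ring, abs_neg, abs_of_pos hr]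
    obtain ⟨⟨h1, h2⟩, h3, h4⟩ := hq
    refine ⟨⟨⟨⟨?_, ?_⟩, ?_, ?_⟩, ⟨?_, ?_⟩, ?_, ?_⟩, ?_, ?_⟩
    any_goals dsimp only; linarith
    · simp only [mem_preimage, e _ h1, e _ h3]
      exact ⟨⟨⟨h1, h2⟩, h3, h4⟩, hne⟩
    · simp only [mem_ofPred_eq, e _ h1, e _ h3]
      exact hδq
  have hpos := hU.measure_pos volume hne'
  have hsub : U ⊆ cube := fun z hz =>
    prod_mono (prod_mono Ioo_subset_Icc_self Ioo_subset_Icc_self)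
      (prod_mono Ioo_subset_Icc_self Ioo_subset_Icc_self) hz.1
  unfold IsBandedBy at h
  rw [prod_sqMeasure_eq, ae_restrict_iff' isCompact_cube.isClosed.measurableSet] at h
  refine hpos.ne' (measure_mono_null (fun z hz => ?_) h)
  intro hcon
  exact hz.2.1.2 (hcon (hsub hz) hz.2.2.le)

/-- Lags on the boundary, and those with maximum equal to `δ`, are reached along the segment towards
`(r, r)` with `δ < r < 1`: its inner points are interior lags strictly beyond `δ`. -/
lemma IsBandedBy.eq_zero {δ : ℝ} (hδ : δ ∈ Ico (0 : ℝ) 1) {ς : ℝ → ℝ → ℝ}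
    (hς : ContinuousOn (fun h : ℝ × ℝ => ς h.1 h.2) (Icc (0 : ℝ) 1 ×ˢ Icc (0 : ℝ) 1))
    (h : IsBandedBy δ (statKernel ς)) {x y : ℝ} (hx : x ∈ Icc (0 : ℝ) 1) (hy : y ∈ Icc (0 : ℝ) 1)
    (hδq : δ ≤ max x y) : ς x y = 0 := by
  obtain ⟨r, hr1, hr2⟩ := exists_between hδ.2
  have hr0 : 0 < r := hδ.1.trans_lt hr1
  set γ : ℝ → ℝ × ℝ := fun θ => ((1 - θ) * x + θ * r, (1 - θ) * y + θ * r)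
  have hγ : Continuous γ := by fun_prop
  have hγ0 : γ 0 = (x, y) := by simp [γ]
  have key : ∀ θ ∈ Ioo (0 : ℝ) 1, ∀ u ∈ Icc (0 : ℝ) 1, (1 - θ) * u + θ * r ∈ Ioo (0 : ℝ) 1 := by
    intro θ hθ u hu
    have h1 : 0 < 1 - θ := by linarith [hθ.2]
    have h2 : 0 ≤ (1 - θ) * u := mul_nonneg h1.le hu.1
    have h3 : (1 - θ) * u ≤ 1 - θ := mul_le_of_le_one_right h1.le hu.2
    have h4 : 0 < θ * r := mul_pos hθ.1 hr0
    have h5 : θ * r < θ := mul_lt_of_lt_one_right hθ.1 hr2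
    constructor <;> linarith
  have hzero : ∀ θ ∈ Ioo (0 : ℝ) 1, ς (γ θ).1 (γ θ).2 = 0 := by
    intro θ hθ
    refine h.eq_zero_of_mem_Ioo hς ⟨key θ hθ x hx, key θ hθ y hy⟩ ?_
    have hlt : ∀ u, δ ≤ u → δ < (1 - θ) * u + θ * r := fun u hu => by
      have h1 : (1 - θ) * δ ≤ (1 - θ) * u := by
        have := hθ.2
        gcongr
      have h2 : θ * δ < θ * r := by
        have := hθ.1
        gcongr
      linarith
    rcases le_max_iff.1 hδq with h' | h'
    · exact lt_max_of_lt_left (hlt x h')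
    · exact lt_max_of_lt_right (hlt y h')
  have hIoo : Ioo (0 : ℝ) 1 ∈ nhdsWithin (0 : ℝ) (Ioi 0) := Ioo_mem_nhdsGT one_pos
  have hmem : ∀ᶠ θ in nhdsWithin (0 : ℝ) (Ioi 0), γ θ ∈ Icc (0 : ℝ) 1 ×ˢ Icc (0 : ℝ) 1 := by
    filter_upwards [hIoo] with θ hθ
    exact ⟨Ioo_subset_Icc_self (key θ hθ x hx), Ioo_subset_Icc_self (key θ hθ y hy)⟩
  have hγt : Filter.Tendsto γ (nhdsWithin 0 (Ioi 0))
      (nhdsWithin (x, y) (Icc (0 : ℝ) 1 ×ˢ Icc (0 : ℝ) 1)) := by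
    refine tendsto_nhdsWithin_iff.2 ⟨?_, hmem⟩
    rw [← hγ0]
    exact hγ.continuousAt.mono_left nhdsWithin_le_nhds
  have ht : Filter.Tendsto (fun θ => ς (γ θ).1 (γ θ).2) (nhdsWithin 0 (Ioi 0)) (nhds (ς x y)) :=
    (hς (x, y) ⟨hx, hy⟩).tendsto.comp hγt
  refine tendsto_nhds_unique ht (tendsto_const_nhds.congr' ?_)
  filter_upwards [hIoo] with θ hθ
  exact (hzero θ hθ).symm

lemma IsBandedBy.mono {δ δ' : ℝ} (hδ : δ ≤ δ') {b : Kernel4} (h : IsBandedBy δ b) :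
    IsBandedBy δ' b := by
  unfold IsBandedBy at *
  filter_upwards [h] with z hz h'
  exact hz (hδ.trans h')

/-! ### Kernels that agree on the unit cube -/

/-- The kernels `f` and `g` agree on the unit cube. -/
def EqOnCube (f g : Kernel4) : Prop :=
  ∀ t ∈ Icc (0 : ℝ) 1, ∀ s ∈ Icc (0 : ℝ) 1, ∀ t' ∈ Icc (0 : ℝ) 1, ∀ s' ∈ Icc (0 : ℝ) 1,
    f t s t' s' = g t s t' s'

section Congr

variable {f g : Kernel4} {δ : ℝ}

lemma mem_of_mem_uIcc (hδ : δ ∈ Ico (0 : ℝ) 1) {t : ℝ} (ht : t ∈ uIcc 0 (1 - δ)) :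
    t ∈ Icc (0 : ℝ) 1 ∧ t + δ ∈ Icc (0 : ℝ) 1 := by
  rw [uIcc_of_le (by linarith [hδ.2])] at ht
  exact ⟨⟨ht.1, by linarith [ht.2, hδ.1]⟩, by linarith [ht.1, hδ.1], by linarith [ht.2]⟩

lemma EqOnCube.shiftTrace (h : EqOnCube f g) (hδ : δ ∈ Ico (0 : ℝ) 1) :
    shiftTrace δ f = shiftTrace δ g := by
  refine intervalIntegral.integral_congr fun t ht => intervalIntegral.integral_congr fun s hs => ?_
  have ht' := mem_of_mem_uIcc hδ ht
  have hs' := mem_of_mem_uIcc hδ hs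
  exact h _ ht'.1 _ hs'.1 _ ht'.2 _ hs'.2

lemma EqOnCube.sepProxy (h : EqOnCube f g) (hδ : δ ∈ Ico (0 : ℝ) 1) :
    EqOnCube (sepProxy δ f) (sepProxy δ g) := by
  intro t ht s hs t' ht' s' hs'
  have e1 : shiftTrace₁ δ f t t' = shiftTrace₁ δ g t t' :=
    intervalIntegral.integral_congr fun y hy => by
      have hy' := mem_of_mem_uIcc hδ hy
      exact h _ ht _ hy'.1 _ ht' _ hy'.2
  have e2 : shiftTrace₂ δ f s s' = shiftTrace₂ δ g s s' :=
    intervalIntegral.integral_congr fun y hy => by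
      have hy' := mem_of_mem_uIcc hδ hy
      exact h _ hy'.1 _ hs _ hy'.2 _ hs'
  simp only [SPT.sepProxy, e1, e2, h.shiftTrace hδ]

lemma EqOnCube.isStationaryOnCube (h : EqOnCube f g) (hg : IsStationaryOnCube g) :
    IsStationaryOnCube f := by
  intro z hz w hw hzw
  rw [h _ hz.1.1 _ hz.1.2 _ hz.2.1 _ hz.2.2, h _ hw.1.1 _ hw.1.2 _ hw.2.1 _ hw.2.2]
  exact hg z hz w hw hzw

lemma EqOnCube.sub {f' g' : Kernel4} (h : EqOnCube f g) (h' : EqOnCube f' g') :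
    EqOnCube (f - f') (g - g') := by
  intro t ht s hs t' ht' s' hs'
  simp only [Pi.sub_apply, h t ht s hs t' ht' s' hs', h' t ht s hs t' ht' s' hs']

lemma EqOnCube.symm (h : EqOnCube f g) : EqOnCube g f :=
  fun t ht s hs t' ht' s' hs' => (h t ht s hs t' ht' s' hs').symm

lemma ae_sqMeasure_mem_square : ∀ᵐ p ∂sqMeasure, p ∈ square :=
  ae_restrict_mem (measurableSet_Icc.prod measurableSet_Icc)

lemma EqOnCube.isCenteredWithCov (h : EqOnCube f g) {Ω : Type*} [MeasurableSpace Ω]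
    {μ : Measure Ω} {X : Ω → L2Square} (hX : IsCenteredWithCov μ X f) :
    IsCenteredWithCov μ X g := by
  refine ⟨hX.1, fun u v => (hX.2 u v).trans ?_⟩
  refine integral_congr_ae ?_
  filter_upwards [ae_sqMeasure_mem_square] with p hp
  refine integral_congr_ae ?_
  filter_upwards [ae_sqMeasure_mem_square] with q hq
  rw [h _ hp.1 _ hp.2 _ hq.1 _ hq.2]

lemma EqOnCube.hsNormSq (h : EqOnCube f g) : hsNormSq f = hsNormSq g := by
  refine integral_congr_ae ?_
  filter_upwards [ae_sqMeasure_mem_square] with p hp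
  refine integral_congr_ae ?_
  filter_upwards [ae_sqMeasure_mem_square] with q hq
  rw [h _ hp.1 _ hp.2 _ hq.1 _ hq.2]

end Congr

/-! ### The theoretical objective of stationary residuals -/

/-- All four sign choices have the same absolute lags, so the integrand is constant. The half-open
intervals keep both lags below one, hence the denominator nonzero. -/
lemma toeplitzSymbol_eq_of_isStationaryOnCube {f : Kernel4} (hf : IsStationaryOnCube f)
    {t s t' s' : ℝ} (ht : t ∈ Ico (0 : ℝ) 1) (hs : s ∈ Ico (0 : ℝ) 1) (ht' : t' ∈ Ico (0 : ℝ) 1)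
    (hs' : s' ∈ Ico (0 : ℝ) 1) : toeplitzSymbol f |t - t'| |s - s'| = f t s t' s' := by
  have hlag : ∀ {x y : ℝ}, x ∈ Ico (0 : ℝ) 1 → y ∈ Ico (0 : ℝ) 1 → |x - y| ∈ Ico (0 : ℝ) 1 := by
    intro x y hx hy
    refine ⟨abs_nonneg _, ?_⟩
    rw [abs_lt]
    constructor <;> linarith [hx.1, hx.2, hy.1, hy.2]
  have hh := hlag ht ht'
  have hl := hlag hs hs'
  have hz : (((t, s), (t', s')) : (ℝ × ℝ) × (ℝ × ℝ)) ∈ cube :=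
    ⟨⟨Ico_subset_Icc_self ht, Ico_subset_Icc_self hs⟩, Ico_subset_Icc_self ht',
      Ico_subset_Icc_self hs'⟩
  unfold toeplitzSymbol
  have e : ∀ x ∈ uIcc 0 (1 - |t - t'|), ∀ y ∈ uIcc 0 (1 - |s - s'|),
      f x y (x + |t - t'|) (y + |s - s'|) + f (x + |t - t'|) y x (y + |s - s'|)
        + f x (y + |s - s'|) (x + |t - t'|) y + f (x + |t - t'|) (y + |s - s'|) x y
      = 4 * f t s t' s' := by
    intro x hx y hy
    obtain ⟨x1, x2⟩ := mem_of_mem_uIcc hh hx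
    obtain ⟨y1, y2⟩ := mem_of_mem_uIcc hl hy
    have h1 := hf _ hz ((x, y), (x + |t - t'|, y + |s - s'|)) ⟨⟨x1, y1⟩, x2, y2⟩ ⟨by simp, by simp⟩
    have h2 := hf _ hz ((x + |t - t'|, y), (x, y + |s - s'|)) ⟨⟨x2, y1⟩, x1, y2⟩ ⟨by simp, by simp⟩
    have h3 := hf _ hz ((x, y + |s - s'|), (x + |t - t'|, y)) ⟨⟨x1, y2⟩, x2, y1⟩ ⟨by simp, by simp⟩
    have h4 := hf _ hz ((x + |t - t'|, y + |s - s'|), (x, y)) ⟨⟨x2, y2⟩, x1, y1⟩ ⟨by simp, by simp⟩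
    simp only at h1 h2 h3 h4
    rw [← h1, ← h2, ← h3, ← h4]
    ring
  have e' : (∫ x in (0 : ℝ)..(1 - |t - t'|), ∫ y in (0 : ℝ)..(1 - |s - s'|),
      (f x y (x + |t - t'|) (y + |s - s'|) + f (x + |t - t'|) y x (y + |s - s'|)
        + f x (y + |s - s'|) (x + |t - t'|) y + f (x + |t - t'|) (y + |s - s'|) x y))
      = ∫ _x in (0 : ℝ)..(1 - |t - t'|), ∫ _y in (0 : ℝ)..(1 - |s - s'|), 4 * f t s t' s' :=
    intervalIntegral.integral_congr fun x hx => intervalIntegral.integral_congr fun y hy =>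
      e x hx y hy
  rw [e']
  simp only [intervalIntegral.integral_const, smul_eq_mul, sub_zero]
  have p1 : (1 - |t - t'|) ≠ 0 := by linarith [hh.2]
  have p2 : (1 - |s - s'|) ≠ 0 := by linarith [hl.2]
  field_simp

lemma ae_sqMeasure_mem_Ico : ∀ᵐ p ∂sqMeasure, p.1 ∈ Ico (0 : ℝ) 1 ∧ p.2 ∈ Ico (0 : ℝ) 1 := by
  rw [sqMeasure_eq]
  exact ae_prod_and ae_unitMeasure_mem_Ico ae_unitMeasure_mem_Ico

/-- A stationary residual is reproduced by Toeplitz averaging. In contrapositive form this turns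
identifiability, `0 < Xi δ c`, into the non-stationarity needed for the separation. -/
lemma Xi_eq_zero_of_isStationaryOnCube {δ : ℝ} {c : Kernel4}
    (h : IsStationaryOnCube (c - sepProxy δ c)) : Xi δ c = 0 := by
  have e : ∀ᵐ p ∂sqMeasure, ∫ q, (fullProxy δ c p.1 p.2 q.1 q.2 - c p.1 p.2 q.1 q.2) ^ 2 ∂sqMeasure
      = 0 := by
    filter_upwards [ae_sqMeasure_mem_Ico] with p hp
    refine integral_eq_zero_of_ae ?_
    filter_upwards [ae_sqMeasure_mem_Ico] with q hq
    have h1 := toeplitzSymbol_eq_of_isStationaryOnCube h hp.1 hp.2 hq.1 hq.2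
    have h2 : fullProxy δ c p.1 p.2 q.1 q.2
        = sepProxy δ c p.1 p.2 q.1 q.2 + (c - sepProxy δ c) p.1 p.2 q.1 q.2 := by
      rw [← h1]
      rfl
    rw [h2]
    simp
  exact integral_eq_zero_of_ae e

/-! ### Extending kernels continuously from the unit cube -/

/-- The nearest point of the unit interval. -/
noncomputable def clamp (t : ℝ) : ℝ := max 0 (min t 1)

lemma clamp_mem (t : ℝ) : clamp t ∈ Icc (0 : ℝ) 1 :=
  ⟨le_max_left _ _, max_le zero_le_one (min_le_right _ _)⟩

lemma clamp_of_mem {t : ℝ} (ht : t ∈ Icc (0 : ℝ) 1) : clamp t = t := by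
  rw [clamp, min_eq_left ht.2, max_eq_right ht.1]

lemma continuous_clamp : Continuous clamp := by
  unfold clamp
  fun_prop

/-- Extension of a kernel from the unit cube by its values at nearest points. -/
noncomputable def clampKernel (c : Kernel4) : Kernel4 := fun t s t' s' =>
  c (clamp t) (clamp s) (clamp t') (clamp s')

lemma eqOnCube_clampKernel (c : Kernel4) : EqOnCube (clampKernel c) c := by
  intro t ht s hs t' ht' s' hs'
  rw [clampKernel, clamp_of_mem ht, clamp_of_mem hs, clamp_of_mem ht', clamp_of_mem hs']

/-- The model controls kernels on the cube only, whereas the approximation arguments use continuity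
everywhere. -/
lemma isContKernel_clampKernel {c : Kernel4}
    (hc : ContinuousOn (fun z : (ℝ × ℝ) × (ℝ × ℝ) => c z.1.1 z.1.2 z.2.1 z.2.2) cube) :
    IsContKernel (clampKernel c) := by
  have := continuous_clamp
  refine hc.comp_continuous (f := fun z : (ℝ × ℝ) × (ℝ × ℝ) =>
    ((clamp z.1.1, clamp z.1.2), (clamp z.2.1, clamp z.2.2))) (by fun_prop) fun z => ?_
  exact ⟨⟨clamp_mem _, clamp_mem _⟩, clamp_mem _, clamp_mem _⟩

lemma IsLipschitzOnCube.continuousOn {L : ℝ} {a : Kernel4} (h : IsLipschitzOnCube L a) :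
    ContinuousOn (fun z : (ℝ × ℝ) × (ℝ × ℝ) => a z.1.1 z.1.2 z.2.1 z.2.2) cube := by
  intro w hw
  rw [ContinuousWithinAt, tendsto_iff_dist_tendsto_zero]
  set b : (ℝ × ℝ) × (ℝ × ℝ) → ℝ := fun z => L * Real.sqrt ((z.1.1 - w.1.1) ^ 2
    + (z.1.2 - w.1.2) ^ 2 + (z.2.1 - w.2.1) ^ 2 + (z.2.2 - w.2.2) ^ 2)
  have hb : Continuous b := by fun_prop
  have hb0 : b w = 0 := by simp [b]
  refine squeeze_zero' (g := b) (Filter.Eventually.of_forall fun _ => dist_nonneg) ?_ ?_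
  · filter_upwards [self_mem_nhdsWithin] with z hz
    exact h _ hz.1.1 _ hz.1.2 _ hz.2.1 _ hz.2.2 _ hw.1.1 _ hw.1.2 _ hw.2.1 _ hw.2.2
  · rw [← hb0]
    exact hb.continuousAt.mono_left nhdsWithin_le_nhds

lemma IsLipschitzOnCube.clampKernel {L : ℝ} {a : Kernel4} (h : IsLipschitzOnCube L a) :
    IsLipschitzOnCube L (clampKernel a) := by
  intro t ht s hs t' ht' s' hs' u hu v hv u' hu' v' hv'
  rw [eqOnCube_clampKernel a t ht s hs t' ht' s' hs', eqOnCube_clampKernel a u hu v hv u' hu' v' hv']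
  exact h t ht s hs t' ht' s' hs' u hu v hv u' hu' v' hv'

lemma abs_sub_mem_Icc {x y : ℝ} (hx : x ∈ Icc (0 : ℝ) 1) (hy : y ∈ Icc (0 : ℝ) 1) :
    |x - y| ∈ Icc (0 : ℝ) 1 := by
  refine ⟨abs_nonneg _, ?_⟩
  rw [abs_le]
  constructor <;> linarith [hx.1, hx.2, hy.1, hy.2]

lemma continuousOn_statKernel {ς : ℝ → ℝ → ℝ}
    (hς : ContinuousOn (fun h : ℝ × ℝ => ς h.1 h.2) (Icc (0 : ℝ) 1 ×ˢ Icc (0 : ℝ) 1)) :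
    ContinuousOn (fun z : (ℝ × ℝ) × (ℝ × ℝ) => statKernel ς z.1.1 z.1.2 z.2.1 z.2.2) cube :=
  hς.comp (f := fun z : (ℝ × ℝ) × (ℝ × ℝ) => (|z.1.1 - z.2.1|, |z.1.2 - z.2.2|)) (by fun_prop)
    fun _ hz => ⟨abs_sub_mem_Icc hz.1.1 hz.2.1, abs_sub_mem_Icc hz.1.2 hz.2.2⟩

end SPT

/-! ### The main theorem -/

open SPT

theorem theoremG3
    {Ω : Type*} [MeasurableSpace Ω] (μ : Measure Ω) [IsProbabilityMeasure μ]
    -- the covariance model: separable part, stationary banded part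
    (a₁ a₂ ς : ℝ → ℝ → ℝ) (c : SPT.Kernel4) (L δstar : ℝ)
    (hc : c = fun t s t' s' =>
      SPT.sepKernel a₁ a₂ t s t' s' + SPT.statKernel ς t s t' s')
    (hL : 0 < L) (hLip : SPT.IsLipschitzOnCube L (SPT.sepKernel a₁ a₂))
    (hς : ContinuousOn (fun h : ℝ × ℝ => ς h.1 h.2) (Icc (0 : ℝ) 1 ×ˢ Icc (0 : ℝ) 1))
    (hδstar : δstar ∈ Ico (0 : ℝ) 1)
    (hband : SPT.IsBandedBy δstar (SPT.statKernel ς))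
    -- the candidate bandwidths
    (Δ : Finset ℝ) (hΔ : ∀ δ ∈ Δ, δ ∈ Ico (0 : ℝ) 1)
    (hTr : ∀ δ ∈ Δ, SPT.shiftTrace δ c ≠ 0)
    (hlarge : ∃ δ ∈ Δ, δstar < δ)
    (hident : ∀ δ ∈ Δ, ¬ SPT.IsBandedBy δ (SPT.statKernel ς) → 0 < SPT.Xi δ c)
    -- the random surfaces, their discrete versions and the measurement errors
    (X : ℕ → Ω → SPT.L2Square)
    (x e : (K : ℕ) → ℕ → Ω → Fin K → Fin K → ℝ) (σ : ℝ)
    (hmom : MemLp (X 0) 4 μ)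
    (hcov : SPT.IsCenteredWithCov μ (X 0) c)
    (hindep : ∀ K, iIndepFun (fun n ω => (X n ω, e K n ω)) μ)
    (hident_distrib : ∀ K n,
      IdentDistrib (fun ω => (X n ω, e K n ω)) (fun ω => (X 0 ω, e K 0 ω)) μ μ)
    (hscheme : SPT.PointwiseScheme μ X x ∨ SPT.PixelScheme X x)
    (hnoise : ∀ K n, SPT.IsNoise μ σ (x K n) (e K n))
    -- the selected bandwidth: any minimizer over the candidates of the empirical objective
    (δhat : ℕ → ℕ → Ω → ℝ)
    (hδhat : ∀ N K ω, δhat N K ω ∈ Δ ∧ ∀ δ ∈ Δ,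
      SPT.XiHat N (fun n => x K n ω + e K n ω) (δhat N K ω)
        ≤ SPT.XiHat N (fun n => x K n ω + e K n ω) δ) :
    ∃ K₀ : ℕ, ∀ ε : ℝ, 0 < ε → ∃ (M : ℝ) (N₀ : ℕ), ∀ N ≥ N₀, ∀ K ≥ K₀,
      μ {ω | M / (N : ℝ) + 2 * ((K : ℝ) ^ 2)⁻¹ * L ^ 2
          < SPT.hsNormSq (fun t s t' s' =>
              SPT.continuation
                (SPT.sepEst (SPT.discreteBandwidth (δhat N K ω) K)
                  (SPT.empCov (fun n => x K n ω + e K n ω) (Finset.range N))) t s t' s'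
              - SPT.sepKernel a₁ a₂ t s t' s')}
        ≤ ENNReal.ofReal ε := by
  set good : ℝ → Prop := fun δ => IsBandedBy δ (statKernel ς)
  set A₁ : ℝ → ℝ → ℝ := fun t t' => a₁ (clamp t) (clamp t')
  set A₂ : ℝ → ℝ → ℝ := fun s s' => a₂ (clamp s) (clamp s')
  -- Clamping acts on each variable separately, so it preserves separability.
  have hA : sepKernel A₁ A₂ = clampKernel (sepKernel a₁ a₂) := rfl
  have hAcont : IsContKernel (sepKernel A₁ A₂) := isContKernel_clampKernel hLip.continuousOn
  have hc' : IsContKernel (clampKernel c) := by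
    refine isContKernel_clampKernel ?_
    rw [hc]
    exact hLip.continuousOn.add (continuousOn_statKernel hς)
  have hcc := eqOnCube_clampKernel c
  have hdiff : ∀ z ∈ cube, clampKernel c z.1.1 z.1.2 z.2.1 z.2.2
      = sepKernel A₁ A₂ z.1.1 z.1.2 z.2.1 z.2.2 + ς |z.1.1 - z.2.1| |z.1.2 - z.2.2| := by
    intro z hz
    rw [hA, hcc _ hz.1.1 _ hz.1.2 _ hz.2.1 _ hz.2.2,
      eqOnCube_clampKernel _ _ hz.1.1 _ hz.1.2 _ hz.2.1 _ hz.2.2, hc]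
    rfl
  obtain ⟨ν, ν', V, hV, hν, hν', hsample⟩ := exists_isSample hmom
    (hcc.symm.isCenteredWithCov hcov) hc' hindep hident_distrib hscheme hnoise
  have hprod : ∀ K i j k l, meanTensor (ν K) (ν' K) (sepKernel A₁ A₂) i j k l
      = meanMatrix (ν K) A₁ i k * meanMatrix (ν' K) A₂ j l := fun K i j k l =>
    meanTensor_sepKernel (hν K) (hν' K) hAcont i j k l
  obtain ⟨R, τ, κ, hτ, hκ, K₁, hsep⟩ := exists_isSeparated (good := good) hΔ hc'
    (fun δ hδ => by
      rw [hcc.shiftTrace (hΔ δ hδ)]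
      exact hTr δ hδ)
    (a := sepKernel A₁ A₂)
    (fun z hz w hw hzw => by
      beta_reduce
      rw [hdiff z hz, hdiff w hw, hzw.1, hzw.2, add_sub_cancel_left, add_sub_cancel_left])
    (fun δ hδ hbad hstat => by
      have h := (hcc.symm.sub (hcc.symm.sepProxy (hΔ δ hδ))).isStationaryOnCube hstat
      exact (hident δ hδ hbad).ne' (Xi_eq_zero_of_isStationaryOnCube h))
    (approximates_meanTensor hν hν' hc')
    (α₁ := fun K => meanMatrix (ν K) A₁) (α₂ := fun K => meanMatrix (ν' K) A₂)
    (by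
      simp only [← hprod]
      exact approximates_meanTensor hν hν' hAcont)
    -- Vanishing almost everywhere would not suffice here: under pointwise sampling the cell
    -- measures are Dirac masses, so `IsBandedBy.eq_zero` has to supply vanishing at every point.
    (fun δ hδ hg K i j k l hlag => by
      rw [← hprod]
      refine meanTensor_congr_of_lag_le (hν K) (hν' K) (hΔ δ hδ).1 (fun z hz hmax => ?_) hlag
      rw [hdiff z hz, hg.eq_zero (hΔ δ hδ) hς (abs_sub_mem_Icc hz.1.1 hz.2.1)
        (abs_sub_mem_Icc hz.1.2 hz.2.2) hmax, add_zero])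
  obtain ⟨δ₁, hδ₁, hδ₁'⟩ := hlarge
  -- `K₁` comes from the deterministic separation alone, so it can be fixed before `ε`.
  refine ⟨max 1 K₁, fun ε hε => ?_⟩
  obtain ⟨m, N₀, hrate⟩ := exists_rate_of_isSeparated (K₀ := K₁) hδ₁ (hband.mono hδ₁'.le) hτ hκ hV
    (fun K hK => (hsep K hK).1) (fun K _ => hsample K) hδhat hε
  -- The factor `3` is the Young weight in `hsNormSq_continuation_sub_le`, and `sepLip R τ ^ 2`
  -- converts the squared seminorm error `m / N` into a squared error of the separable estimator.
  refine ⟨3 * (sepLip R τ ^ 2 * m), N₀, fun N hN K hK => ?_⟩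
  have hK₁ : K₁ ≤ K := le_of_max_le_right hK
  have hK0 : 0 < K := le_of_max_le_left hK
  refine (measure_mono fun ω hω => ?_).trans (hrate N hN K hK₁).2
  rintro ⟨hg, hsq, hmin⟩
  refine absurd (mem_ofPred_eq ▸ hω) (not_lt.2 ?_)
  have hδ := (hδhat N K ω).1
  set d := discreteBandwidth (δhat N K ω) K
  set Chat := empCov (fun n => x K n ω + e K n ω) (Finset.range N)
  -- At a banded bandwidth the population estimator is unbiased for the local means of the separable
  -- part, so only the stochastic error and the Lipschitz bias remain.
  have hEst : sepEst d (meanTensor (ν K) (ν' K) (clampKernel c))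
      = meanTensor (ν K) (ν' K) (sepKernel A₁ A₂) := by
    rw [(hsep K hK₁).2 _ hδ hg]
    ext i j k l
    exact (hprod K i j k l).symm
  have hlip := norm_sepEst_sub_le hτ ((hsep K hK₁).1.norm_le _ hδ) ((hsep K hK₁).1.trace_le _ hδ)
    (hmin.trans (min_le_left _ _)) (hmin.trans (min_le_right _ _))
  have hbias := hsNormSq_continuation_sub_le hK0 (hν K) (hν' K) hAcont
    (hLip.clampKernel : IsLipschitzOnCube L (sepKernel A₁ A₂)) (sepEst d Chat)
  have hnorm : hsNormSq (fun t s t' s' => continuation (sepEst d Chat) t s t' s'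
        - sepKernel a₁ a₂ t s t' s')
      = hsNormSq (fun t s t' s' => continuation (sepEst d Chat) t s t' s'
        - sepKernel A₁ A₂ t s t' s') := by
    refine EqOnCube.hsNormSq fun t ht s hs t' ht' s' hs' => ?_
    rw [hA, eqOnCube_clampKernel _ t ht s hs t' ht' s' hs']
  rw [hnorm]
  refine hbias.trans ?_
  gcongr
  rw [← hEst]
  calc _ ≤ 3 * (sepLip R τ * bandSeminorm d (Chat - meanTensor (ν K) (ν' K) (clampKernel c))) ^ 2 := by
        gcongr
    _ ≤ 3 * (sepLip R τ ^ 2 * (m / N)) := by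
        rw [mul_pow]
        gcongr
    _ = _ := by ring
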